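/- Let $n > 1$ be an integer. Then there is a complete smooth Riemannian metric $g$ on $\mathbb{R}^n$ which has quadratic curvature decay and slow volume growth. That is, for every basepoint $m_0 \in \mathbb{R}^n$, writing $d$ for the Riemannian distance of $g$, $B_t$ for the metric ball of radius $t$ around $m_0$ and $\mathrm{vol}$ for the Riemannian volume of $g$: 1. there is a constant $C > 0$ such that for all $m \in \mathbb{R}^n$ with $m \neq m_0$ and all $2$-planes $P \subset T_m\mathbb{R}^n$ the sectional curvature satisfies $|K(P)| \le C / d(m_0, m)^2$; 2. $\displaystyle\liminf_{t \to \infty} \frac{\mathrm{vol}(B_t)}{t^n} = 0$. -/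

import Mathlib

open scoped Manifold ContDiff Bundle ENNReal
open Filter MeasureTheory

noncomputable section

/-! ### Riemannian metrics on a real vector space, and their distance -/

section Distance

variable (E : Type*) [NormedAddCommGroup E] [NormedSpace ℝ E]

/-- A smooth Riemannian metric on the manifold `E`. -/
abbrev SmoothMetric : Type _ :=
  Bundle.ContMDiffRiemannianMetric 𝓘(ℝ, E) ∞ E (fun x : E => TangentSpace 𝓘(ℝ, E) x)

variable {E}

/-- The inner product `g_x(u, v)`; each tangent space of `E` is identified with `E`. -/
def SmoothMetric.form (g : SmoothMetric E) (x u v : E) : ℝ :=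
  g.inner x (u : TangentSpace 𝓘(ℝ, E) x) (v : TangentSpace 𝓘(ℝ, E) x)

/-- The extended metric space structure on `E` given by the Riemannian distance of `g`,
the infimum of the `g`-lengths of the `C¹` paths between two points. -/
abbrev SmoothMetric.emetricSpace (g : SmoothMetric E) : EMetricSpace E :=
  letI : Bundle.RiemannianBundle (fun x : E => TangentSpace 𝓘(ℝ, E) x) :=
    ⟨g.toRiemannianMetric⟩
  haveI : IsContinuousRiemannianBundle E (fun x : E => TangentSpace 𝓘(ℝ, E) x) :=
    ⟨⟨g.inner, g.contMDiff.continuous, fun _ _ _ => rfl⟩⟩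
  EMetricSpace.ofRiemannianMetric 𝓘(ℝ, E) E

/-- The Riemannian distance of `g`, with values in `[0, ∞]`. -/
def SmoothMetric.edist (g : SmoothMetric E) (x y : E) : ℝ≥0∞ :=
  g.emetricSpace.edist x y

/-- The Riemannian distance of `g` as a real number (it is finite, as `E` is path connected). -/
def SmoothMetric.dist (g : SmoothMetric E) (x y : E) : ℝ :=
  (g.edist x y).toReal

/-- The open metric ball of radius `t` around `m₀`. -/
def SmoothMetric.ball (g : SmoothMetric E) (m₀ : E) (t : ℝ) : Set E :=
  {x | g.edist m₀ x < ENNReal.ofReal t}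

/-- Completeness of `g`: the Riemannian distance is complete. -/
def SmoothMetric.IsComplete (g : SmoothMetric E) : Prop :=
  @CompleteSpace E g.emetricSpace.toUniformSpace

end Distance

/-! ### Curvature and volume on `ℝⁿ`, in the standard coordinates -/

section Coordinates

variable {n : ℕ}

/-- The partial derivative `∂ᵢ f` at `x`. -/
def partialDeriv (i : Fin n) (f : EuclideanSpace ℝ (Fin n) → ℝ)
    (x : EuclideanSpace ℝ (Fin n)) : ℝ :=
  fderiv ℝ f x (EuclideanSpace.single i 1)

/-- The matrix `(gᵢⱼ(x))` of the metric. -/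
def SmoothMetric.gram (g : SmoothMetric (EuclideanSpace ℝ (Fin n)))
    (x : EuclideanSpace ℝ (Fin n)) : Matrix (Fin n) (Fin n) ℝ :=
  Matrix.of fun i j => g.form x (EuclideanSpace.single i 1) (EuclideanSpace.single j 1)

/-- The Christoffel symbol `Γᵏᵢⱼ` of the Levi-Civita connection:
`½ ∑ₗ gᵏˡ (∂ᵢ gⱼₗ + ∂ⱼ gᵢₗ - ∂ₗ gᵢⱼ)`. -/
def SmoothMetric.christoffel (g : SmoothMetric (EuclideanSpace ℝ (Fin n)))
    (k i j : Fin n) (x : EuclideanSpace ℝ (Fin n)) : ℝ :=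
  (1 / 2) * ∑ l, (g.gram x)⁻¹ k l *
    (partialDeriv i (fun y => g.gram y j l) x + partialDeriv j (fun y => g.gram y i l) x
      - partialDeriv l (fun y => g.gram y i j) x)

/-- The component along `∂ₗ` of
`R(∂ᵢ, ∂ⱼ) ∂ₖ = ∇_{∂ᵢ} ∇_{∂ⱼ} ∂ₖ - ∇_{∂ⱼ} ∇_{∂ᵢ} ∂ₖ`. -/
def SmoothMetric.riemann (g : SmoothMetric (EuclideanSpace ℝ (Fin n)))
    (l i j k : Fin n) (x : EuclideanSpace ℝ (Fin n)) : ℝ :=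
  partialDeriv i (g.christoffel l j k) x - partialDeriv j (g.christoffel l i k) x
    + ∑ m, (g.christoffel m j k x * g.christoffel l i m x
      - g.christoffel m i k x * g.christoffel l j m x)

/-- The vector `R(u, v) w` at `x`. -/
def SmoothMetric.curvatureOp (g : SmoothMetric (EuclideanSpace ℝ (Fin n)))
    (x u v w : EuclideanSpace ℝ (Fin n)) : EuclideanSpace ℝ (Fin n) :=
  WithLp.toLp 2 fun l => ∑ i, ∑ j, ∑ k, g.riemann l i j k x * u i * v j * w k

/-- The sectional curvature at `x` of the plane spanned by the linearly independent vectors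
`u` and `v`: `g(R(u, v) v, u) / (g(u, u) g(v, v) - g(u, v)²)`. -/
def SmoothMetric.sectionalCurvature (g : SmoothMetric (EuclideanSpace ℝ (Fin n)))
    (x u v : EuclideanSpace ℝ (Fin n)) : ℝ :=
  g.form x (g.curvatureOp x u v v) u / (g.form x u u * g.form x v v - g.form x u v ^ 2)

/-- The Riemannian volume measure `√(det gᵢⱼ) dx`. -/
def SmoothMetric.volume (g : SmoothMetric (EuclideanSpace ℝ (Fin n))) :
    Measure (EuclideanSpace ℝ (Fin n)) :=
  (MeasureTheory.volume : Measure (EuclideanSpace ℝ (Fin n))).withDensity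
    fun x => ENNReal.ofReal (Real.sqrt (g.gram x).det)

/-- Quadratic curvature decay with respect to the basepoint `m₀`: for some `C > 0`, every
2-plane `P` in the tangent space at `m` has `|K(P)| ≤ C / d(m₀, m)²`. At `m = m₀` the right-hand
side is infinite, so nothing is required there. -/
def SmoothMetric.HasQuadraticCurvatureDecay (g : SmoothMetric (EuclideanSpace ℝ (Fin n)))
    (m₀ : EuclideanSpace ℝ (Fin n)) : Prop :=
  ∃ C : ℝ, 0 < C ∧ ∀ m : EuclideanSpace ℝ (Fin n), m ≠ m₀ →
    ∀ u v : EuclideanSpace ℝ (Fin n), LinearIndependent ℝ ![u, v] →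
      |g.sectionalCurvature m u v| ≤ C / g.dist m₀ m ^ 2

/-- Slow volume growth with respect to the basepoint `m₀`:
`liminf_{t → ∞} vol(B_t(m₀)) / tⁿ = 0`, as a lower limit in `[0, ∞]`. -/
def SmoothMetric.HasSlowVolumeGrowth (g : SmoothMetric (EuclideanSpace ℝ (Fin n)))
    (m₀ : EuclideanSpace ℝ (Fin n)) : Prop :=
  liminf (fun t : ℝ => g.volume (g.ball m₀ t) / ENNReal.ofReal (t ^ n)) atTop = 0

end Coordinates

end

/-! The metric is an infinite nest of rescaled copies of one model on ℝⁿ, where n = d + 2. The model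
is Euclidean space pinched around the unit circle of the first coordinate plane. In tubular
coordinates (angle y₀, squared distance s to the circle) it reads f(s)² dy₀² + dy₁² + ⋯. Here f is
the constant η = ε²ⁿ for s ≤ ε², f = sⁿ from s = 4ε² to s = 1/64, and the metric is Euclidean again
from s = 1/16 on. Two regions are flat: the thin core tube, which contains a round ball of radius
comparable to η, and the outer end.

Level k is the model with ε = `tubeRad k`, magnified by T = `scale k`. The scales are chosen so that
a round ball in the core of level k + 1 is isometric to a ball of level k whose boundary lies in the
Euclidean end; the former is replaced by the latter. A ball replaces a ball, so the manifold stays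
ℝⁿ. All levels live on one fixed ℝⁿ through the linear maps `coords k`, followed by a fixed
diffeomorphism (`Straightening`) that bends a neighbourhood of the origin into the tube. Flat
overlaps make the pieces agree (`levelForm_of_three_le`, `levelForm_succ_of_lt`,
`globalForm_eventuallyEq`).

Curvature: away from the tubes, level k is T times a fixed compact piece, so |K| ≤ C / T², while the
distance to the origin is at most 8T. Inside a tube, rescaling angle and radius turns every level
into (Tε)² times a single warped product. The profile of that product is eventually a power, hence
it is self-similar at infinity and |K| decays quadratically in the distance to its axis. Since the
distance to the origin is at most 10 T (ε + √s), the product |K| d² is bounded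
(`exists_curvature_mul_bound`).

Volume: a cutoff function with bounded gradient shows that the ball of radius c T ε around the
origin stays in the tube (`exists_ball_subset_tube`), which also gives completeness. The tube has
volume at most a constant times Tⁿ η, all earlier levels included, so the volume ratio is at most a
constant times η / εⁿ = εⁿ, which tends to 0 along the levels. Both growth conditions are
insensitive to the basepoint. -/

noncomputable section


/-! ### Smooth metrics as fields of bilinear forms; estimates of the distance; completeness -/

section FieldMetric

variable {E : Type*} [NormedAddCommGroup E] [NormedSpace ℝ E]

/-- The tangent bundle of a vector space is trivialized by the identity. This is what turns
smoothness of a section into smoothness of an ordinary map into bilinear forms. -/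
theorem trivializationAt_linear_snd (x y : E) (σ : TangentSpace 𝓘(ℝ, E) y →L[ℝ] ℝ) :
    (trivializationAt (E →L[ℝ] ℝ)
      (fun x : E ↦ TangentSpace 𝓘(ℝ, E) x →L[ℝ] ℝ) x ⟨y, σ⟩).2 = σ := by
  rw [hom_trivializationAt_apply]
  ext v
  simp only [ContinuousLinearMap.inCoordinates]
  simp
  rfl

theorem trivializationAt_bilinear_snd (x y : E)
    (σ : TangentSpace 𝓘(ℝ, E) y →L[ℝ] TangentSpace 𝓘(ℝ, E) y →L[ℝ] ℝ) :
    (trivializationAt (E →L[ℝ] E →L[ℝ] ℝ)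
      (fun x : E ↦ TangentSpace 𝓘(ℝ, E) x →L[ℝ] TangentSpace 𝓘(ℝ, E) x →L[ℝ] ℝ) x
        ⟨y, σ⟩).2 = σ := by
  rw [hom_trivializationAt_apply]
  ext v w
  simp only [ContinuousLinearMap.inCoordinates]
  simp
  rw [Bundle.Trivialization.coe_linearMapAt_of_mem]
  · exact congrArg (fun L : E →L[ℝ] ℝ ↦ L w) (trivializationAt_linear_snd x y (σ v))
  · simp
    exact Set.mem_univ y

/-- The field of bilinear forms underlying a smooth metric. -/
def SmoothMetric.field (g : SmoothMetric E) (x : E) : E →L[ℝ] E →L[ℝ] ℝ :=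
  g.inner x

theorem SmoothMetric.form_eq_field (g : SmoothMetric E) (x u v : E) :
    g.form x u v = g.field x u v := rfl

theorem SmoothMetric.form_comm (g : SmoothMetric E) (x u v : E) :
    g.form x u v = g.form x v u := g.symm x u v

theorem SmoothMetric.form_self_pos (g : SmoothMetric E) (x : E) {u : E} (hu : u ≠ 0) :
    0 < g.form x u u := g.pos x u hu

theorem SmoothMetric.form_self_nonneg (g : SmoothMetric E) (x u : E) :
    0 ≤ g.form x u u := by
  rcases eq_or_ne u 0 with rfl | hu
  · simp [g.form_eq_field]
  · exact (g.form_self_pos x hu).le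

theorem SmoothMetric.contDiff_field (g : SmoothMetric E) : ContDiff ℝ ∞ g.field := by
  rw [← contMDiff_iff_contDiff]
  intro x
  have h := g.contMDiff x
  rw [Bundle.contMDiffAt_section] at h
  exact h.congr_of_eventuallyEq
    (Eventually.of_forall fun y ↦ (trivializationAt_bilinear_snd x y (g.inner y)).symm)

theorem SmoothMetric.contDiff_form (g : SmoothMetric E) (u v : E) :
    ContDiff ℝ ∞ (fun x ↦ g.form x u v) := by
  simp only [g.form_eq_field]
  exact (g.contDiff_field.clm_apply contDiff_const).clm_apply contDiff_const

/-- A positive definite form on a finite dimensional space is bounded below on the unit sphere. -/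
theorem exists_pos_mul_sq_le_of_posDef [FiniteDimensional ℝ E] (B : E →L[ℝ] E →L[ℝ] ℝ)
    (hpos : ∀ u, u ≠ 0 → 0 < B u u) : ∃ c : ℝ, 0 < c ∧ ∀ u, c * ‖u‖ ^ 2 ≤ B u u := by
  have := FiniteDimensional.proper ℝ E
  rcases subsingleton_or_nontrivial E with hE | hE
  · refine ⟨1, one_pos, fun u ↦ ?_⟩
    simp [Subsingleton.elim u 0]
  obtain ⟨u₀, hu₀, hmin⟩ := (isCompact_sphere (0 : E) 1).exists_isMinOn
    (NormedSpace.sphere_nonempty.2 zero_le_one)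
    (f := fun u ↦ B u u) ((B.continuous.clm_apply continuous_id).continuousOn)
  have hne : u₀ ≠ 0 := by
    rintro rfl; simp at hu₀
  refine ⟨B u₀ u₀, hpos _ hne, fun u ↦ ?_⟩
  rcases eq_or_ne u 0 with rfl | hu
  · simp
  have hn : 0 < ‖u‖ := norm_pos_iff.2 hu
  have h := hmin (a := ‖u‖⁻¹ • u) (by simp [norm_smul, hn.ne'])
  simp only [map_smul, smul_apply, smul_eq_mul, Set.mem_ofPred_eq] at h
  calc B u₀ u₀ * ‖u‖ ^ 2 ≤ (‖u‖⁻¹ * (‖u‖⁻¹ * B u u)) * ‖u‖ ^ 2 := by gcongr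
    _ = B u u := by field_simp

/-- The smooth metric given by a smooth field of positive definite symmetric bilinear forms. -/
def SmoothMetric.ofField [FiniteDimensional ℝ E] (G : E → E →L[ℝ] E →L[ℝ] ℝ)
    (hG : ContDiff ℝ ∞ G)
    (hsymm : ∀ x u v, G x u v = G x v u) (hpos : ∀ x u, u ≠ 0 → 0 < G x u u) :
    SmoothMetric E where
  inner x := G x
  symm x u v := hsymm x u v
  pos x u hu := hpos x u hu
  isVonNBounded x := by
    obtain ⟨c, hc, h⟩ := exists_pos_mul_sq_le_of_posDef (G x) (hpos x)
    have hs : {v : E | G x v v < 1} ⊆ Metric.ball (0 : E) (Real.sqrt (1 / c)) := by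
      intro v hv
      rw [mem_ball_zero_iff]
      apply Real.lt_sqrt_of_sq_lt
      rw [lt_div_iff₀ hc, mul_comm]
      exact (h v).trans_lt hv
    exact (NormedSpace.isVonNBounded_ball ℝ E _).subset hs
  contMDiff := by
    intro x
    have h : ContMDiffAt 𝓘(ℝ, E) (𝓘(ℝ, E).prod 𝓘(ℝ, E →L[ℝ] E →L[ℝ] ℝ)) ∞
        (fun b ↦ Bundle.TotalSpace.mk' (E →L[ℝ] E →L[ℝ] ℝ)
        (E := fun x : E ↦ TangentSpace 𝓘(ℝ, E) x →L[ℝ] TangentSpace 𝓘(ℝ, E) x →L[ℝ] ℝ)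
        b (id (G b))) x := by
      rw [Bundle.contMDiffAt_section]
      exact ((contMDiff_iff_contDiff.2 hG) x).congr_of_eventuallyEq
        (Eventually.of_forall fun y ↦ trivializationAt_bilinear_snd x y (id (G y)))
    exact h

theorem SmoothMetric.edist_le_of_path (g : SmoothMetric E) {γ : ℝ → E} (hγ : ContDiff ℝ 1 γ)
    {c : ℝ} (hc : ∀ t ∈ Set.Icc (0 : ℝ) 1, g.form (γ t) (deriv γ t) (deriv γ t) ≤ c ^ 2)
    (hc0 : 0 ≤ c) :
    g.edist (γ 0) (γ 1) ≤ ENNReal.ofReal c := by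
  let _ : Bundle.RiemannianBundle (fun x : E => TangentSpace 𝓘(ℝ, E) x) :=
    ⟨g.toRiemannianMetric⟩
  have _ : IsContinuousRiemannianBundle E (fun x : E => TangentSpace 𝓘(ℝ, E) x) :=
    ⟨⟨g.inner, g.contMDiff.continuous, fun _ _ _ => rfl⟩⟩
  have h1 : g.edist (γ 0) (γ 1) ≤ Manifold.pathELength 𝓘(ℝ, E) γ 0 1 :=
    Manifold.riemannianEDist_le_pathELength (contMDiff_iff_contDiff.2 hγ).contMDiffOn rfl rfl
      zero_le_one
  refine h1.trans ?_
  rw [Manifold.pathELength_eq_lintegral_mfderiv_Icc]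
  have h2 : ∀ t ∈ Set.Icc (0 : ℝ) 1,
      ‖(mfderiv 𝓘(ℝ, ℝ) 𝓘(ℝ, E) γ t : ℝ →L[ℝ] TangentSpace 𝓘(ℝ, E) (γ t)) 1‖ₑ
        ≤ ENNReal.ofReal c := by
    intro t ht
    rw [← ofReal_norm]
    apply ENNReal.ofReal_le_ofReal
    rw [norm_eq_sqrt_real_inner, mfderiv_eq_fderiv]
    apply Real.sqrt_le_iff.2 ⟨hc0, hc t ht⟩
  calc _ ≤ ∫⁻ t in Set.Icc (0 : ℝ) 1, ENNReal.ofReal c := setLIntegral_mono' measurableSet_Icc h2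
    _ = _ := by simp

/-- A function whose `g`-gradient has norm at most `c` changes by at most `c` times the length of
any path. This is the only source of lower bounds for the distance. -/
theorem SmoothMetric.ofReal_abs_sub_le_edist (g : SmoothMetric E) {h : E → ℝ}
    (hh : ContDiff ℝ 1 h) {c : ℝ} (hc : 0 ≤ c)
    (hle : ∀ x u, (fderiv ℝ h x u) ^ 2 ≤ c ^ 2 * g.form x u u) (x y : E) :
    ENNReal.ofReal |h y - h x| ≤ ENNReal.ofReal c * g.edist x y := by
  let _ : Bundle.RiemannianBundle (fun x : E => TangentSpace 𝓘(ℝ, E) x) :=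
    ⟨g.toRiemannianMetric⟩
  have _ : IsContinuousRiemannianBundle E (fun x : E => TangentSpace 𝓘(ℝ, E) x) :=
    ⟨⟨g.inner, g.contMDiff.continuous, fun _ _ _ => rfl⟩⟩
  -- The main argument takes a path longer than the distance by at most ε / c, which requires c ≠ 0.
  rcases hc.eq_or_lt with rfl | hc'
  · have : ∀ z, fderiv ℝ h z = 0 := by
      intro z; ext u
      have := hle z u
      simpa using le_antisymm (by simpa using this) (sq_nonneg (fderiv ℝ h z u))
    have := is_const_of_fderiv_eq_zero (hh.differentiable one_ne_zero) this y x
    simp [this]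
  refine ENNReal.le_of_forall_pos_le_add ?_
  intro ε hε hfin
  have hfin' : g.edist x y ≠ ⊤ := by
    rintro htop
    rw [htop, ENNReal.mul_top (by simpa using hc')] at hfin
    exact lt_irrefl _ hfin
  have hlt : Manifold.riemannianEDist 𝓘(ℝ, E) x y < g.edist x y + ε / ENNReal.ofReal c := by
    refine ENNReal.lt_add_right hfin' ?_
    simp [hε.ne']
  obtain ⟨γ, h0, h1, hγ, hlen⟩ := Manifold.exists_lt_of_riemannianEDist_lt hlt
  rw [contMDiffOn_iff_contDiffOn] at hγ
  have hD : ContDiffOn ℝ 1 (h ∘ γ) (Set.Icc 0 1) := hh.comp_contDiffOn hγ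
  have key := enorm_sub_le_lintegral_derivWithin_Icc_of_contDiffOn_Icc hD zero_le_one
  have e1 : ENNReal.ofReal |h y - h x| = ‖(h ∘ γ) 1 - (h ∘ γ) 0‖ₑ := by
    rw [← ofReal_norm]; simp [h0, h1]
  rw [e1]
  refine key.trans ?_
  have hb : ∫⁻ t in Set.Icc (0 : ℝ) 1, ‖derivWithin (h ∘ γ) (Set.Icc 0 1) t‖ₑ ≤
      ENNReal.ofReal c * Manifold.pathELength 𝓘(ℝ, E) γ 0 1 := by
    rw [Manifold.pathELength_eq_lintegral_mfderivWithin_Icc,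
      ← lintegral_const_mul' _ _ ENNReal.ofReal_ne_top]
    refine setLIntegral_mono' measurableSet_Icc fun t ht ↦ ?_
    have hu := uniqueDiffOn_Icc (zero_lt_one (α := ℝ)) t ht
    rw [← ofReal_norm, ← ofReal_norm, ← ENNReal.ofReal_mul hc]
    apply ENNReal.ofReal_le_ofReal
    rw [norm_eq_sqrt_real_inner (F := TangentSpace 𝓘(ℝ, E) (γ t)), mfderivWithin_eq_fderivWithin]
    have e2 : derivWithin (h ∘ γ) (Set.Icc 0 1) t
        = fderiv ℝ h (γ t) (fderivWithin ℝ γ (Set.Icc 0 1) t 1) := by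
      rw [fderivWithin_derivWithin]
      exact ((hh.differentiable one_ne_zero (γ t)).hasFDerivAt.comp_hasDerivWithinAt t
        (hγ.differentiableOn one_ne_zero t ht).hasDerivWithinAt).derivWithin hu
    rw [e2, Real.norm_eq_abs]
    apply abs_le_of_sq_le_sq' _ (by positivity) |> abs_le.2
    rw [mul_pow, Real.sq_sqrt]
    · exact hle _ _
    · exact g.form_self_nonneg _ _
  refine hb.trans ?_
  calc _ ≤ ENNReal.ofReal c * (g.edist x y + ε / ENNReal.ofReal c) := by gcongr
    _ = _ := by
      rw [mul_add, ENNReal.mul_div_cancel (by simpa using hc') ENNReal.ofReal_ne_top]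

theorem SmoothMetric.edist_triangle (g : SmoothMetric E) (x y z : E) :
    g.edist x z ≤ g.edist x y + g.edist y z :=
  @PseudoEMetricSpace.edist_triangle E g.emetricSpace.toPseudoEMetricSpace x y z

theorem SmoothMetric.edist_ne_top (g : SmoothMetric E) (x y : E) : g.edist x y ≠ ⊤ := by
  let γ : ℝ → E := fun t ↦ x + t • (y - x)
  have hγ : ContDiff ℝ 1 γ := by fun_prop
  have hd : ∀ t, deriv γ t = y - x := by
    intro t
    have : HasDerivAt γ ((1 : ℝ) • (y - x)) t :=
      ((hasDerivAt_id t).smul_const (y - x)).const_add x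
    simpa using this.deriv
  have hcont : Continuous fun t ↦ g.form (γ t) (y - x) (y - x) :=
    (g.contDiff_form _ _).continuous.comp hγ.continuous
  obtain ⟨C, hC⟩ := (isCompact_Icc (a := (0 : ℝ)) (b := 1)).bddAbove_image hcont.continuousOn
  have h := g.edist_le_of_path hγ (c := max C 1) (fun t ht ↦ by
    rw [hd]
    have h1 := hC (Set.mem_image_of_mem _ ht)
    have h2 := le_max_left C 1
    have h3 := le_max_right C 1
    nlinarith) (by positivity)
  simp only [γ, zero_smul, add_zero, one_smul, add_sub_cancel] at h
  exact ne_top_of_le_ne_top ENNReal.ofReal_ne_top h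

/-- A Cauchy filter contains a set of diameter at most 1, which lies in a ball of finite radius and
hence in a compact set. -/
theorem completeSpace_of_edist_ball_subset_compact {α : Type*} [PseudoEMetricSpace α] (x₀ : α)
    (hfin : ∀ x, edist x₀ x ≠ ⊤)
    (h : ∀ r : ℝ, ∃ K : Set α, IsCompact K ∧ {x | edist x₀ x < ENNReal.ofReal r} ⊆ K) :
    CompleteSpace α := by
  refine ⟨fun {f} hf ↦ ?_⟩
  obtain ⟨s, hs, hsd⟩ := (EMetric.cauchy_iff.1 hf).2 1 one_pos
  have := hf.1
  obtain ⟨y, hy⟩ := nonempty_of_mem hs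
  obtain ⟨K, hK, hsub⟩ := h ((edist x₀ y).toReal + 1)
  have hsK : s ⊆ K := by
    intro z hz
    apply hsub
    calc edist x₀ z ≤ edist x₀ y + edist y z := edist_triangle _ _ _
      _ < edist x₀ y + 1 := by
        gcongr
        · exact hfin y
        · exact hsd y hy z hz
      _ = ENNReal.ofReal ((edist x₀ y).toReal + 1) := by
        rw [ENNReal.ofReal_add ENNReal.toReal_nonneg zero_le_one, ENNReal.ofReal_toReal (hfin y)]
        simp
  obtain ⟨z, -, hz⟩ := hK.isComplete f hf (le_principal_iff.2 (mem_of_superset hs hsK))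
  exact ⟨z, hz⟩

/-- If all balls of finite radius around `x₀` are relatively compact, the metric is complete. -/
theorem SmoothMetric.isComplete_of_ball_subset_compact (g : SmoothMetric E) (x₀ : E)
    (h : ∀ r : ℝ, ∃ K : Set E, IsCompact K ∧ g.ball x₀ r ⊆ K) : g.IsComplete :=
  @completeSpace_of_edist_ball_subset_compact E g.emetricSpace.toPseudoEMetricSpace x₀
    (g.edist_ne_top x₀) h

end FieldMetric

/-! ### Levi-Civita connection and curvature without coordinates; naturality under homotheties -/

section Connection

set_option synthInstance.maxHeartbeats 400000
set_option maxSynthPendingDepth 5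

variable {E : Type*} [NormedAddCommGroup E] [NormedSpace ℝ E]

theorem fderiv_fderiv_comm {F : Type*} [NormedAddCommGroup F] [NormedSpace ℝ F] {f : E → F}
    (hf : ContDiff ℝ ∞ f) (x u v : E) :
    fderiv ℝ (fderiv ℝ f) x u v = fderiv ℝ (fderiv ℝ f) x v u :=
  (hf.contDiffAt.isSymmSndFDerivAt (by simpa using ENat.LEInfty.out)) u v

/-- `Γ` is the Christoffel map of the Levi-Civita connection of the field of forms `G`. -/
structure IsChristoffel (G : E → E →L[ℝ] E →L[ℝ] ℝ) (Γ : E → E →L[ℝ] E →L[ℝ] E) : Prop where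
  contDiff_form : ContDiff ℝ ∞ G
  contDiff : ContDiff ℝ ∞ Γ
  symm : ∀ x u v, G x u v = G x v u
  pos : ∀ x u, u ≠ 0 → 0 < G x u u
  koszul : ∀ x u v w, 2 * G x (Γ x u v) w =
    fderiv ℝ G x u v w + fderiv ℝ G x v u w - fderiv ℝ G x w u v

/-- The curvature of the connection with Christoffel map `Γ`. -/
def connectionCurvature (Γ : E → E →L[ℝ] E →L[ℝ] E) (x u v w : E) : E :=
  fderiv ℝ Γ x u v w - fderiv ℝ Γ x v u w + Γ x u (Γ x v w) - Γ x v (Γ x u w)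

theorem fderiv_apply_apply {F G : Type*} [NormedAddCommGroup F] [NormedSpace ℝ F]
    [NormedAddCommGroup G] [NormedSpace ℝ G]
    {A : E → F →L[ℝ] F →L[ℝ] G} {x : E} {A' : E →L[ℝ] F →L[ℝ] F →L[ℝ] G}
    {a b : E → F} {a' b' : E →L[ℝ] F}
    (hA : HasFDerivAt A A' x) (ha : HasFDerivAt a a' x) (hb : HasFDerivAt b b' x) (u : E) :
    fderiv ℝ (fun y ↦ A y (a y) (b y)) x u =
      A' u (a x) (b x) + A x (a' u) (b x) + A x (a x) (b' u) := by
  rw [((hA.clm_apply ha).clm_apply hb).fderiv]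
  simp
  abel

theorem hasFDerivAt_comp_bilin {F G : Type*} [NormedAddCommGroup F] [NormedSpace ℝ F]
    [NormedAddCommGroup G] [NormedSpace ℝ G]
    {A : E → F →L[ℝ] F →L[ℝ] G} {Ψ : E → E} {x : E} {A' : E →L[ℝ] F →L[ℝ] F →L[ℝ] G}
    {Ψ' : E →L[ℝ] E} (hA : HasFDerivAt A A' (Ψ x)) (hΨ : HasFDerivAt Ψ Ψ' x) :
    HasFDerivAt (fun y ↦ A (Ψ y)) (A'.comp Ψ') x :=
  HasFDerivAt.comp x hA hΨ

namespace IsChristoffel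

variable {G H : E → E →L[ℝ] E →L[ℝ] ℝ} {Γ Γ' : E → E →L[ℝ] E →L[ℝ] E}

theorem hasFDerivAt_form (h : IsChristoffel G Γ) (x : E) : HasFDerivAt G (fderiv ℝ G x) x :=
  (h.contDiff_form.differentiable (by simp) x).hasFDerivAt

theorem hasFDerivAt (h : IsChristoffel G Γ) (x : E) : HasFDerivAt Γ (fderiv ℝ Γ x) x :=
  (h.contDiff.differentiable (by simp) x).hasFDerivAt

theorem fderiv_const_apply (h : IsChristoffel G Γ) (x u v w : E) :
    fderiv ℝ (fun y ↦ G y v w) x u = fderiv ℝ G x u v w := by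
  rw [fderiv_apply_apply (h.hasFDerivAt_form x) (hasFDerivAt_const v x) (hasFDerivAt_const w x)]
  simp

theorem fderiv_symm (h : IsChristoffel G Γ) (x u v w : E) :
    fderiv ℝ G x u v w = fderiv ℝ G x u w v := by
  rw [← h.fderiv_const_apply, ← h.fderiv_const_apply]
  simp only [h.symm _ v w]

/-- Metric compatibility: in the sum of the Koszul identities for (u, v, w) and (u, w, v) all but
one derivative cancel. -/
theorem fderiv_eq (h : IsChristoffel G Γ) (x u v w : E) :
    fderiv ℝ G x u v w = G x (Γ x u v) w + G x v (Γ x u w) := by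
  have h1 := h.koszul x u v w
  have h2 := h.koszul x u w v
  rw [h.symm x v]
  rw [h.fderiv_symm x u w v] at h2
  rw [h.fderiv_symm x v u w] at h1
  linarith [h.fderiv_symm x v u w]

theorem eq_of_forall_form_eq (h : IsChristoffel G Γ) (x : E) {u v : E}
    (huv : ∀ w, G x u w = G x v w) : u = v := by
  by_contra hne
  have := h.pos x (u - v) (sub_ne_zero.2 hne)
  simp [huv] at this

/-- Second derivatives of y ↦ G_y(w, w) are symmetric. Expressing them through Γ by metric
compatibility, the antisymmetric part is 2 G(R(u, v) w, w). -/
theorem form_curvature_self (h : IsChristoffel G Γ) (x u v w : E) :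
    G x (connectionCurvature Γ x u v w) w = 0 := by
  have hF : ContDiff ℝ ∞ (fun y ↦ G y w w) :=
    (h.contDiff_form.clm_apply contDiff_const).clm_apply contDiff_const
  have key : ∀ a b : E, fderiv ℝ (fderiv ℝ (fun y ↦ G y w w)) x a b =
      2 * (G x (Γ x a (Γ x b w)) w + G x (Γ x b w) (Γ x a w) + G x (fderiv ℝ Γ x a b w) w) := by
    intro a b
    have e1 : fderiv ℝ (fderiv ℝ (fun y ↦ G y w w)) x a b =
        fderiv ℝ (fun y ↦ fderiv ℝ (fun y ↦ G y w w) y b) x a := by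
      have hd : HasFDerivAt (fderiv ℝ (fun y ↦ G y w w))
          (fderiv ℝ (fderiv ℝ (fun y ↦ G y w w)) x) x :=
        ((hF.fderiv_right (m := ∞) (by simp)).differentiable (by simp) x).hasFDerivAt
      rw [(hd.clm_apply (hasFDerivAt_const b x)).fderiv]
      simp
    have e2 : (fun y ↦ fderiv ℝ (fun y ↦ G y w w) y b) = fun y ↦ 2 * G y (Γ y b w) w := by
      ext y
      rw [h.fderiv_const_apply, h.fderiv_eq, h.symm y w]; ring
    have hb : HasFDerivAt (fun y ↦ Γ y b w)
        (((fderiv ℝ Γ x).flip b).flip w) x := by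
      have := ((h.hasFDerivAt x).clm_apply (hasFDerivAt_const b x)).clm_apply
        (hasFDerivAt_const w x)
      convert this using 1
      ext; simp
    rw [e1, e2]
    have hd : DifferentiableAt ℝ (fun y ↦ G y (Γ y b w) w) x :=
      (((h.hasFDerivAt_form x).clm_apply hb).clm_apply (hasFDerivAt_const w x)).differentiableAt
    rw [fderiv_const_mul hd, smul_apply,
      fderiv_apply_apply (h.hasFDerivAt_form x) hb (hasFDerivAt_const w x), h.fderiv_eq]
    simp
  have hs := fderiv_fderiv_comm hF x u v
  rw [key, key] at hs
  simp only [connectionCurvature, map_add, map_sub, add_apply, sub_apply]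
  linarith [h.symm x (Γ x v w) (Γ x u w)]

variable {Ψ : E → E} {c : ℝ} {x : E}

/-- Differentiating the equation `Ψ^* G = c² H`. -/
theorem fderiv_isometry (hG : IsChristoffel G Γ) (hH : IsChristoffel H Γ')
    (hΨ : ContDiff ℝ ∞ Ψ)
    (h : ∀ᶠ y in nhds x, ∀ u v, G (Ψ y) (fderiv ℝ Ψ y u) (fderiv ℝ Ψ y v) = c ^ 2 * H y u v)
    (u v w : E) :
    c ^ 2 * fderiv ℝ H x u v w =
      fderiv ℝ G (Ψ x) (fderiv ℝ Ψ x u) (fderiv ℝ Ψ x v) (fderiv ℝ Ψ x w)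
      + G (Ψ x) (fderiv ℝ (fderiv ℝ Ψ) x u v) (fderiv ℝ Ψ x w)
      + G (Ψ x) (fderiv ℝ Ψ x v) (fderiv ℝ (fderiv ℝ Ψ) x u w) := by
  have hP : HasFDerivAt (fderiv ℝ Ψ) (fderiv ℝ (fderiv ℝ Ψ) x) x :=
    ((hΨ.fderiv_right (m := ∞) (by simp)).differentiable (by simp) x).hasFDerivAt
  have hΨ' : HasFDerivAt Ψ (fderiv ℝ Ψ x) x := (hΨ.differentiable (by simp) x).hasFDerivAt
  have hP' : ∀ v, HasFDerivAt (fun y ↦ fderiv ℝ Ψ y v)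
      ((fderiv ℝ (fderiv ℝ Ψ) x).flip v) x := by
    intro v
    convert hP.clm_apply (hasFDerivAt_const v x) using 1
    ext; simp
  have e := fderiv_apply_apply (hasFDerivAt_comp_bilin (hG.hasFDerivAt_form (Ψ x)) hΨ')
    (hP' v) (hP' w) u
  have e2 : (fun y ↦ G (Ψ y) (fderiv ℝ Ψ y v) (fderiv ℝ Ψ y w)) =ᶠ[nhds x]
      fun y ↦ c ^ 2 * H y v w := by
    filter_upwards [h] with y hy using hy v w
  have hd : DifferentiableAt ℝ (fun y ↦ H y v w) x :=
    (((hH.hasFDerivAt_form x).clm_apply (hasFDerivAt_const v x)).clm_apply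
      (hasFDerivAt_const w x)).differentiableAt
  rw [e2.fderiv_eq, fderiv_const_mul hd, smul_apply, hH.fderiv_const_apply] at e
  simpa using e

theorem injective_of_isometry (hH : IsChristoffel H Γ') (hc : c ≠ 0)
    (h : ∀ u v, G (Ψ x) (fderiv ℝ Ψ x u) (fderiv ℝ Ψ x v) = c ^ 2 * H x u v) :
    Function.Injective (fderiv ℝ Ψ x) := by
  rw [injective_iff_map_eq_zero]
  intro u hu
  by_contra hne
  have h1 := h u u
  have h2 := hH.pos x u hne
  rw [hu] at h1
  simp only [map_zero] at h1
  have : 0 < c ^ 2 * H x u u := by positivity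
  linarith

/-- The transformation law of Christoffel symbols. Three permutations of the differentiated isometry
equation, combined as in the Koszul formula, leave only one second-derivative term; nondegeneracy
then removes the test vector. -/
theorem map_isometry [FiniteDimensional ℝ E] (hG : IsChristoffel G Γ) (hH : IsChristoffel H Γ')
    (hΨ : ContDiff ℝ ∞ Ψ) (hc : c ≠ 0)
    (h : ∀ᶠ y in nhds x, ∀ u v, G (Ψ y) (fderiv ℝ Ψ y u) (fderiv ℝ Ψ y v) = c ^ 2 * H y u v)
    (u v : E) :
    fderiv ℝ Ψ x (Γ' x u v) = Γ (Ψ x) (fderiv ℝ Ψ x u) (fderiv ℝ Ψ x v)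
      + fderiv ℝ (fderiv ℝ Ψ) x u v := by
  have hx := h.self_of_nhds
  have hsurj : Function.Surjective (fderiv ℝ Ψ x) :=
    LinearMap.surjective_of_injective (f := (fderiv ℝ Ψ x : E →ₗ[ℝ] E))
      (injective_of_isometry hH hc hx)
  apply hG.eq_of_forall_form_eq (Ψ x)
  intro w'
  obtain ⟨w, rfl⟩ := hsurj w'
  rw [hx, map_add, add_apply]
  have k1 := hH.koszul x u v w
  have k2 := hG.koszul (Ψ x) (fderiv ℝ Ψ x u) (fderiv ℝ Ψ x v) (fderiv ℝ Ψ x w)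
  have d1 := fderiv_isometry hG hH hΨ h u v w
  have d2 := fderiv_isometry hG hH hΨ h v u w
  have d3 := fderiv_isometry hG hH hΨ h w u v
  rw [fderiv_fderiv_comm hΨ x v u] at d2
  rw [fderiv_fderiv_comm hΨ x w u, fderiv_fderiv_comm hΨ x w v] at d3
  have s1 := hG.symm (Ψ x) (fderiv ℝ Ψ x v) (fderiv ℝ (fderiv ℝ Ψ) x u w)
  have k3 : c ^ 2 * (2 * H x (Γ' x u v) w) = c ^ 2 * fderiv ℝ H x u v w
    + c ^ 2 * fderiv ℝ H x v u w - c ^ 2 * fderiv ℝ H x w u v := by rw [k1]; ring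
  linarith

/-- The transformation law holds on a neighbourhood, so it can be differentiated once more. After
antisymmetrization in u and v the third derivatives of Ψ cancel, as do the products involving its
second derivative. -/
theorem curvature_isometry [FiniteDimensional ℝ E] (hG : IsChristoffel G Γ)
    (hH : IsChristoffel H Γ') (hΨ : ContDiff ℝ ∞ Ψ) (hc : c ≠ 0)
    (h : ∀ᶠ y in nhds x, ∀ u v, G (Ψ y) (fderiv ℝ Ψ y u) (fderiv ℝ Ψ y v) = c ^ 2 * H y u v)
    (u v w : E) :
    fderiv ℝ Ψ x (connectionCurvature Γ' x u v w) =
      connectionCurvature Γ (Ψ x) (fderiv ℝ Ψ x u) (fderiv ℝ Ψ x v) (fderiv ℝ Ψ x w) := by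
  have hC1 : ContDiff ℝ ∞ (fderiv ℝ Ψ) := hΨ.fderiv_right (m := ∞) (by simp)
  have hC2 : ContDiff ℝ ∞ (fderiv ℝ (fderiv ℝ Ψ)) := hC1.fderiv_right (m := ∞) (by simp)
  have hP2 : HasFDerivAt (fderiv ℝ (fderiv ℝ Ψ)) (fderiv ℝ (fderiv ℝ (fderiv ℝ Ψ)) x) x :=
    (hC2.differentiable (by simp) x).hasFDerivAt
  have hP : HasFDerivAt (fderiv ℝ Ψ) (fderiv ℝ (fderiv ℝ Ψ) x) x :=
    (hC1.differentiable (by simp) x).hasFDerivAt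
  have hΨ' : HasFDerivAt Ψ (fderiv ℝ Ψ x) x := (hΨ.differentiable (by simp) x).hasFDerivAt
  have hP' : ∀ v, HasFDerivAt (fun y ↦ fderiv ℝ Ψ y v)
      ((fderiv ℝ (fderiv ℝ Ψ) x).flip v) x := by
    intro v
    convert hP.clm_apply (hasFDerivAt_const v x) using 1
    ext; simp
  have hconst : ∀ b w, HasFDerivAt (fun y ↦ Γ' y b w) (((fderiv ℝ Γ' x).flip b).flip w) x := by
    intro b w
    convert ((hH.hasFDerivAt x).clm_apply (hasFDerivAt_const b x)).clm_apply
      (hasFDerivAt_const w x) using 1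
    ext; simp
  have hconst2 : ∀ b w, HasFDerivAt (fun y ↦ fderiv ℝ (fderiv ℝ Ψ) y b w)
      (((fderiv ℝ (fderiv ℝ (fderiv ℝ Ψ)) x).flip b).flip w) x := by
    intro b w
    convert (hP2.clm_apply (hasFDerivAt_const b x)).clm_apply
      (hasFDerivAt_const w x) using 1
    ext; simp
  have hmap : ∀ a b, fderiv ℝ Ψ x (Γ' x a b) = Γ (Ψ x) (fderiv ℝ Ψ x a) (fderiv ℝ Ψ x b)
      + fderiv ℝ (fderiv ℝ Ψ) x a b := map_isometry hG hH hΨ hc h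
  have D : ∀ a b e, fderiv ℝ (fderiv ℝ Ψ) x a (Γ' x b e) + fderiv ℝ Ψ x (fderiv ℝ Γ' x a b e) =
      fderiv ℝ Γ (Ψ x) (fderiv ℝ Ψ x a) (fderiv ℝ Ψ x b) (fderiv ℝ Ψ x e)
      + Γ (Ψ x) (fderiv ℝ (fderiv ℝ Ψ) x a b) (fderiv ℝ Ψ x e)
      + Γ (Ψ x) (fderiv ℝ Ψ x b) (fderiv ℝ (fderiv ℝ Ψ) x a e)
      + fderiv ℝ (fderiv ℝ (fderiv ℝ Ψ)) x a b e := by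
    intro a b e
    have ev : (fun y ↦ fderiv ℝ Ψ y (Γ' y b e)) =ᶠ[nhds x]
        fun y ↦ Γ (Ψ y) (fderiv ℝ Ψ y b) (fderiv ℝ Ψ y e)
          + fderiv ℝ (fderiv ℝ Ψ) y b e := by
      filter_upwards [h.eventually_nhds] with y hy
      exact map_isometry hG hH hΨ hc hy b e
    have hl := (hP.clm_apply (hconst b e)).fderiv
    have hΓΨ := hasFDerivAt_comp_bilin (hG.hasFDerivAt (Ψ x)) hΨ'
    have hr1 := fderiv_apply_apply hΓΨ (hP' b) (hP' e) a
    have hd1 : DifferentiableAt ℝ (fun y ↦ Γ (Ψ y) (fderiv ℝ Ψ y b) (fderiv ℝ Ψ y e)) x :=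
      ((hΓΨ.clm_apply (hP' b)).clm_apply (hP' e)).differentiableAt
    have hr := fderiv_fun_add hd1 (hconst2 b e).differentiableAt
    rw [← ev.fderiv_eq, hl] at hr
    have hr' := congrArg (fun L : E →L[ℝ] E ↦ L a) hr
    simp only [add_apply] at hr'
    rw [hr1, (hconst2 b e).fderiv] at hr'
    simp at hr'
    rw [add_comm]
    simpa using hr'
  have s2 := fderiv_fderiv_comm hΨ x u v
  have s3 := congrArg (fun L : E →L[ℝ] E ↦ L w) (fderiv_fderiv_comm hC1 x u v)
  have D1 := D u v w
  have D2 := D v u w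
  rw [s2, s3] at D1
  simp only [connectionCurvature, map_add, map_sub]
  rw [eq_sub_of_add_eq' D1, eq_sub_of_add_eq' D2, hmap u, hmap v, hmap v, hmap u]
  simp only [map_add]
  abel

end IsChristoffel

end Connection

/-! ### Agreement of the coordinate formulas for Γ and R with the coordinate-free ones -/

section SectionalCurvature

set_option synthInstance.maxHeartbeats 400000
set_option maxSynthPendingDepth 5

variable {n : ℕ}

namespace EuclideanSpace

theorem eq_sum_smul_single (u : EuclideanSpace ℝ (Fin n)) :
    u = ∑ i, u i • EuclideanSpace.single i (1 : ℝ) := by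
  ext j
  simp [Finset.sum_apply, Pi.single_apply]

end EuclideanSpace

theorem fderiv_apply_eq_sum_partialDeriv (f : EuclideanSpace ℝ (Fin n) → ℝ)
    (x u : EuclideanSpace ℝ (Fin n)) : fderiv ℝ f x u = ∑ i, u i * partialDeriv i f x := by
  conv_lhs => rw [EuclideanSpace.eq_sum_smul_single u]
  simp [partialDeriv]

theorem contDiff_partialDeriv (i : Fin n) {f : EuclideanSpace ℝ (Fin n) → ℝ}
    (hf : ContDiff ℝ ∞ f) : ContDiff ℝ ∞ (partialDeriv i f) :=
  (hf.fderiv_right (m := ∞) (by simp)).clm_apply contDiff_const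

namespace SmoothMetric

variable (g : SmoothMetric (EuclideanSpace ℝ (Fin n)))

theorem form_eq_sum (x u v : EuclideanSpace ℝ (Fin n)) :
    g.form x u v = ∑ i, ∑ j, u i * v j * g.gram x i j := by
  conv_lhs => rw [EuclideanSpace.eq_sum_smul_single u, EuclideanSpace.eq_sum_smul_single v]
  simp only [form_eq_field, map_sum, map_smul, sum_apply, smul_apply,
    smul_eq_mul, gram, Matrix.of_apply, Finset.mul_sum]
  rw [Finset.sum_comm]
  refine Finset.sum_congr rfl fun i _ ↦ Finset.sum_congr rfl fun j _ ↦ by ring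

theorem gram_symm (x : EuclideanSpace ℝ (Fin n)) (i j : Fin n) :
    g.gram x i j = g.gram x j i := g.form_comm x _ _

theorem contDiff_gram (i j : Fin n) : ContDiff ℝ ∞ (fun x ↦ g.gram x i j) :=
  g.contDiff_form _ _

theorem det_gram_ne_zero (x : EuclideanSpace ℝ (Fin n)) : (g.gram x).det ≠ 0 := by
  intro h
  obtain ⟨v, hv, hv0⟩ := Matrix.exists_mulVec_eq_zero_iff.2 h
  have hne : WithLp.toLp 2 v ≠ 0 := by
    intro h0; apply hv
    exact congrArg WithLp.ofLp h0
  have := g.form_self_pos x hne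
  rw [form_eq_sum] at this
  have h0 : ∀ i, ∑ j, g.gram x i j * v j = 0 := fun i ↦ congrFun hv0 i
  have h1 : ∑ i, ∑ j, v i * v j * g.gram x i j = 0 := by
    apply Finset.sum_eq_zero
    intro i _
    have : ∑ j, v i * v j * g.gram x i j = v i * ∑ j, g.gram x i j * v j := by
      rw [Finset.mul_sum]; exact Finset.sum_congr rfl fun j _ ↦ by ring
    rw [this, h0, mul_zero]
  simp only at this
  linarith

theorem contDiff_gram_det : ContDiff ℝ ∞ (fun x ↦ (g.gram x).det) := by
  simp only [Matrix.det_apply']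
  exact ContDiff.sum fun σ _ ↦ contDiff_const.mul (contDiff_prod fun i _ ↦ g.contDiff_gram _ _)

theorem contDiff_gram_inv (i j : Fin n) : ContDiff ℝ ∞ (fun x ↦ (g.gram x)⁻¹ i j) := by
  have e : (fun x ↦ (g.gram x)⁻¹ i j) =
      fun x ↦ ((g.gram x).det)⁻¹ * (g.gram x).adjugate i j := by
    ext x
    rw [Matrix.inv_def]
    simp [Ring.inverse_eq_inv']
  rw [e]
  refine (g.contDiff_gram_det.inv g.det_gram_ne_zero).mul ?_
  simp only [Matrix.adjugate_apply, Matrix.det_apply']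
  refine ContDiff.sum fun σ _ ↦ contDiff_const.mul (contDiff_prod fun k _ ↦ ?_)
  by_cases hk : σ k = j
  · simp only [hk, Matrix.updateRow_self]; exact contDiff_const
  · simp only [Matrix.updateRow_ne hk]; exact g.contDiff_gram _ _

theorem contDiff_christoffel (k i j : Fin n) : ContDiff ℝ ∞ (g.christoffel k i j) := by
  unfold christoffel
  refine contDiff_const.mul (ContDiff.sum fun l _ ↦ (g.contDiff_gram_inv _ _).mul ?_)
  exact ((contDiff_partialDeriv _ (g.contDiff_gram _ _)).add
    (contDiff_partialDeriv _ (g.contDiff_gram _ _))).sub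
    (contDiff_partialDeriv _ (g.contDiff_gram _ _))

/-- The Christoffel symbols as a field of bilinear maps. -/
def christoffelMap (x : EuclideanSpace ℝ (Fin n)) :
    EuclideanSpace ℝ (Fin n) →L[ℝ] EuclideanSpace ℝ (Fin n) →L[ℝ] EuclideanSpace ℝ (Fin n) :=
  ∑ k, ∑ i, ∑ j, g.christoffel k i j x •
    (EuclideanSpace.proj i : EuclideanSpace ℝ (Fin n) →L[ℝ] ℝ).smulRight
      ((EuclideanSpace.proj j : EuclideanSpace ℝ (Fin n) →L[ℝ] ℝ).smulRight
        (EuclideanSpace.single k (1 : ℝ)))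

theorem contDiff_christoffelMap : ContDiff ℝ ∞ g.christoffelMap := by
  unfold christoffelMap
  exact ContDiff.sum fun k _ ↦ ContDiff.sum fun i _ ↦ ContDiff.sum fun j _ ↦
    (g.contDiff_christoffel k i j).smul contDiff_const

theorem christoffelMap_apply (x u v : EuclideanSpace ℝ (Fin n)) (k : Fin n) :
    g.christoffelMap x u v k = ∑ i, ∑ j, g.christoffel k i j x * u i * v j := by
  simp [christoffelMap, Finset.sum_apply, Pi.single_apply,
    Finset.sum_ite_eq, mul_assoc]

theorem fderiv_field_single (x u : EuclideanSpace ℝ (Fin n)) (i j : Fin n) :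
    fderiv ℝ g.field x u (EuclideanSpace.single i 1) (EuclideanSpace.single j 1) =
      fderiv ℝ (fun y ↦ g.gram y i j) x u := by
  have h := fderiv_apply_apply ((g.contDiff_field.differentiable (by simp) x).hasFDerivAt)
    (hasFDerivAt_const (EuclideanSpace.single i (1 : ℝ)) x)
    (hasFDerivAt_const (EuclideanSpace.single j (1 : ℝ)) x) u
  simp only [zero_apply, map_zero, add_zero] at h
  exact h.symm

/-- Contracting the coordinate formula for Γ with the Gram matrix cancels the inverse Gram matrix in
it; what remains is the Koszul formula on basis vectors. -/
theorem field_christoffelMap_single (x : EuclideanSpace ℝ (Fin n)) (i j l : Fin n) :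
    2 * g.field x (g.christoffelMap x (EuclideanSpace.single i 1) (EuclideanSpace.single j 1))
      (EuclideanSpace.single l 1) =
    partialDeriv i (fun y ↦ g.gram y j l) x + partialDeriv j (fun y ↦ g.gram y i l) x
      - partialDeriv l (fun y ↦ g.gram y i j) x := by
  have hc : ∀ k, g.christoffelMap x (EuclideanSpace.single i 1) (EuclideanSpace.single j 1) k
      = g.christoffel k i j x := by
    intro k
    simp [christoffelMap_apply]
  rw [← form_eq_field, form_eq_sum]
  simp only [hc]
  have h1 : ∀ k, ∑ m, g.christoffel k i j x *
      (EuclideanSpace.single l (1 : ℝ) : EuclideanSpace ℝ (Fin n)) m * g.gram x k m =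
      g.gram x l k * g.christoffel k i j x := by
    intro k
    rw [Finset.sum_eq_single l]
    · simp [g.gram_symm x l k, mul_comm]
    · intro b _ hb; simp [hb]
    · simp
  refine (congrArg (2 * ·) (Finset.sum_congr rfl fun k _ ↦ h1 k)).trans ?_
  simp only [christoffel]
  have hinv : g.gram x * (g.gram x)⁻¹ = 1 :=
    Matrix.mul_nonsing_inv _ (isUnit_iff_ne_zero.2 (g.det_gram_ne_zero x))
  generalize hX : (fun m ↦ partialDeriv i (fun y ↦ g.gram y j m) x
    + partialDeriv j (fun y ↦ g.gram y i m) x - partialDeriv m (fun y ↦ g.gram y i j) x) = X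
  have hX' : ∀ m, partialDeriv i (fun y ↦ g.gram y j m) x
    + partialDeriv j (fun y ↦ g.gram y i m) x - partialDeriv m (fun y ↦ g.gram y i j) x = X m :=
    fun m ↦ congrFun hX m
  simp only [hX']
  calc 2 * ∑ k, g.gram x l k * (1 / 2 * ∑ m, (g.gram x)⁻¹ k m * X m)
      = ∑ k, ∑ m, g.gram x l k * (g.gram x)⁻¹ k m * X m := by
        rw [Finset.mul_sum]
        refine Finset.sum_congr rfl fun k _ ↦ ?_
        rw [show 2 * (g.gram x l k * (1 / 2 * ∑ m, (g.gram x)⁻¹ k m * X m)) =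
          g.gram x l k * ∑ m, (g.gram x)⁻¹ k m * X m by ring, Finset.mul_sum]
        exact Finset.sum_congr rfl fun m _ ↦ by ring
    _ = ∑ m, (g.gram x * (g.gram x)⁻¹) l m * X m := by
        rw [Finset.sum_comm]
        refine Finset.sum_congr rfl fun m _ ↦ ?_
        rw [Matrix.mul_apply, Finset.sum_mul]
    _ = X l := by
        rw [hinv]; simp [Matrix.one_apply]

theorem trilinear_ext {A B : EuclideanSpace ℝ (Fin n) →L[ℝ] EuclideanSpace ℝ (Fin n) →L[ℝ]
    EuclideanSpace ℝ (Fin n) →L[ℝ] ℝ}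
    (h : ∀ i j k, A (EuclideanSpace.single i 1) (EuclideanSpace.single j 1)
        (EuclideanSpace.single k 1) =
      B (EuclideanSpace.single i 1) (EuclideanSpace.single j 1) (EuclideanSpace.single k 1))
    (u v w : EuclideanSpace ℝ (Fin n)) : A u v w = B u v w := by
  rw [EuclideanSpace.eq_sum_smul_single u, EuclideanSpace.eq_sum_smul_single v,
    EuclideanSpace.eq_sum_smul_single w]
  simp only [map_sum, map_smul, sum_apply, smul_apply, h]

theorem isChristoffel : IsChristoffel g.field g.christoffelMap where
  contDiff_form := g.contDiff_field
  contDiff := g.contDiff_christoffelMap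
  symm := g.form_comm
  pos x u hu := g.form_self_pos x hu
  koszul x u v w := by
    have h := trilinear_ext
      (A := (2 : ℝ) • (ContinuousLinearMap.compL ℝ _ _ _ (g.field x)).comp (g.christoffelMap x))
      (B := fderiv ℝ g.field x + (fderiv ℝ g.field x).flip
        - (ContinuousLinearMap.flipₗᵢ ℝ _ _ _).toContinuousLinearEquiv.toContinuousLinearMap.comp
          (fderiv ℝ g.field x).flip) (fun i j k ↦ by
        have := g.field_christoffelMap_single x i j k
        change 2 * g.field x (g.christoffelMap x (EuclideanSpace.single i 1)
          (EuclideanSpace.single j 1)) (EuclideanSpace.single k 1) =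
          fderiv ℝ g.field x (EuclideanSpace.single i 1) (EuclideanSpace.single j 1)
            (EuclideanSpace.single k 1) +
          fderiv ℝ g.field x (EuclideanSpace.single j 1) (EuclideanSpace.single i 1)
            (EuclideanSpace.single k 1) -
          fderiv ℝ g.field x (EuclideanSpace.single k 1) (EuclideanSpace.single i 1)
            (EuclideanSpace.single j 1)
        rw [fderiv_field_single, fderiv_field_single, fderiv_field_single]
        exact this) u v w
    exact h

theorem fderiv_christoffelMap_apply (x u v w : EuclideanSpace ℝ (Fin n)) (l : Fin n) :
    fderiv ℝ g.christoffelMap x u v w l =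
      ∑ i, ∑ j, ∑ k, partialDeriv i (g.christoffel l j k) x * u i * v j * w k := by
  have h1 := fderiv_apply_apply
    ((g.contDiff_christoffelMap.differentiable (by simp) x).hasFDerivAt)
    (hasFDerivAt_const v x) (hasFDerivAt_const w x) u
  simp only [zero_apply, map_zero, add_zero] at h1
  have hd : DifferentiableAt ℝ (fun y ↦ g.christoffelMap y v w) x :=
    ((g.contDiff_christoffelMap.clm_apply contDiff_const).clm_apply
      contDiff_const).differentiable (by simp) x
  have h2 : fderiv ℝ (fun y ↦ g.christoffelMap y v w l) x u =
      fderiv ℝ g.christoffelMap x u v w l := by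
    rw [← h1]
    have := ((EuclideanSpace.proj l : EuclideanSpace ℝ (Fin n) →L[ℝ] ℝ).hasFDerivAt.comp x
      hd.hasFDerivAt).fderiv
    exact congrArg (fun L : EuclideanSpace ℝ (Fin n) →L[ℝ] ℝ ↦ L u) this
  rw [← h2]
  simp only [christoffelMap_apply]
  have hdc : ∀ j k, DifferentiableAt ℝ (fun y ↦ g.christoffel l j k y * v j * w k) x :=
    fun j k ↦ (((g.contDiff_christoffel l j k).differentiable (by simp) x).mul_const _).mul_const _
  rw [fderiv_fun_sum fun j _ ↦ DifferentiableAt.fun_sum fun k _ ↦ hdc j k]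
  rw [sum_apply, Finset.sum_comm]
  have h3 : ∀ j, fderiv ℝ (fun y ↦ ∑ k, g.christoffel l j k y * v j * w k) x u =
      ∑ i, ∑ k, partialDeriv i (g.christoffel l j k) x * u i * v j * w k := by
    intro j
    rw [fderiv_fun_sum fun k _ ↦ hdc j k, sum_apply, Finset.sum_comm]
    refine Finset.sum_congr rfl fun k _ ↦ ?_
    have hc := (g.contDiff_christoffel l j k).differentiable (by simp) x
    rw [fderiv_mul_const (hc.mul_const _), fderiv_mul_const hc, smul_apply, smul_apply,
      fderiv_apply_eq_sum_partialDeriv, smul_eq_mul, smul_eq_mul, Finset.mul_sum, Finset.mul_sum]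
    exact Finset.sum_congr rfl fun i _ ↦ by ring
  exact Finset.sum_congr rfl fun j _ ↦ h3 j

theorem christoffelMap_christoffelMap_apply (x u v w : EuclideanSpace ℝ (Fin n)) (l : Fin n) :
    g.christoffelMap x u (g.christoffelMap x v w) l =
      ∑ i, ∑ j, ∑ k, (∑ m, g.christoffel m j k x * g.christoffel l i m x) * u i * v j * w k := by
  simp only [christoffelMap_apply, Finset.mul_sum, Finset.sum_mul]
  refine Finset.sum_congr rfl fun i _ ↦ ?_
  rw [Finset.sum_comm]
  refine Finset.sum_congr rfl fun j _ ↦ ?_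
  rw [Finset.sum_comm]
  exact Finset.sum_congr rfl fun k _ ↦ Finset.sum_congr rfl fun m _ ↦ by ring

theorem curvatureOp_eq (x u v w : EuclideanSpace ℝ (Fin n)) :
    g.curvatureOp x u v w = connectionCurvature g.christoffelMap x u v w := by
  ext l
  simp only [curvatureOp, connectionCurvature, PiLp.sub_apply, PiLp.add_apply,
    fderiv_christoffelMap_apply,
    christoffelMap_christoffelMap_apply]
  rw [Finset.sum_comm (s := Finset.univ) (t := Finset.univ)
      (f := fun i j : Fin n ↦ ∑ k : Fin n, partialDeriv i (g.christoffel l j k) x * v i * u j * w k),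
    Finset.sum_comm (s := Finset.univ) (t := Finset.univ)
      (f := fun i j : Fin n ↦ ∑ k : Fin n, (∑ m : Fin n, g.christoffel m j k x * g.christoffel l i m x)
        * v i * u j * w k)]
  simp only [← Finset.sum_sub_distrib, ← Finset.sum_add_distrib]
  refine Finset.sum_congr rfl fun i _ ↦ Finset.sum_congr rfl fun j _ ↦
    Finset.sum_congr rfl fun k _ ↦ ?_
  simp only [riemann, Finset.sum_sub_distrib]
  ring

end SmoothMetric

end SectionalCurvature

/-! ### Sectional curvature: scaling, dependence on the plane only, bounds on compact sets -/

section SectionalCurvatureBounds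

set_option synthInstance.maxHeartbeats 400000
set_option maxSynthPendingDepth 5

variable {n : ℕ}

namespace SmoothMetric

variable (g : SmoothMetric (EuclideanSpace ℝ (Fin n)))

/-- The sectional curvature is invariant under local isometries, and scales as the inverse of
the metric. -/
theorem sectionalCurvature_of_isometry (h : SmoothMetric (EuclideanSpace ℝ (Fin n)))
    {Ψ : EuclideanSpace ℝ (Fin n) → EuclideanSpace ℝ (Fin n)} (hΨ : ContDiff ℝ ∞ Ψ)
    {c : ℝ} (hc : c ≠ 0) {x : EuclideanSpace ℝ (Fin n)}
    (hiso : ∀ᶠ y in nhds x, ∀ u v,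
      g.form (Ψ y) (fderiv ℝ Ψ y u) (fderiv ℝ Ψ y v) = c ^ 2 * h.form y u v)
    (u v : EuclideanSpace ℝ (Fin n)) :
    g.sectionalCurvature (Ψ x) (fderiv ℝ Ψ x u) (fderiv ℝ Ψ x v)
      = h.sectionalCurvature x u v / c ^ 2 := by
  have hcurv := IsChristoffel.curvature_isometry g.isChristoffel h.isChristoffel hΨ hc hiso u v v
  have hx := hiso.self_of_nhds
  unfold sectionalCurvature
  rw [curvatureOp_eq, curvatureOp_eq, ← hcurv, hx, hx, hx, hx]
  field_simp

theorem form_curvatureOp_antisymm (x u v w z : EuclideanSpace ℝ (Fin n)) :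
    g.form x (g.curvatureOp x u v w) z = - g.form x (g.curvatureOp x u v z) w := by
  have h0 : ∀ w, g.field x (connectionCurvature g.christoffelMap x u v w) w = 0 :=
    g.isChristoffel.form_curvature_self x u v
  have hadd : connectionCurvature g.christoffelMap x u v (w + z) =
      connectionCurvature g.christoffelMap x u v w +
      connectionCurvature g.christoffelMap x u v z := by
    simp only [connectionCurvature, map_add]; abel
  have h := h0 (w + z)
  rw [hadd] at h
  simp only [map_add, add_apply, h0] at h
  simp only [curvatureOp_eq, form_eq_field]
  linarith

theorem form_curvatureOp_lincomb (x e f : EuclideanSpace ℝ (Fin n)) (a b c : ℝ) :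
    g.form x (g.curvatureOp x (a • e) (b • e + c • f) (b • e + c • f)) (a • e) =
      (a * c) ^ 2 * g.form x (g.curvatureOp x e f f) e := by
  have h0 : g.form x (g.curvatureOp x e f e) e = 0 := by
    have := g.form_curvatureOp_antisymm x e f e e
    linarith
  have hR : g.curvatureOp x (a • e) (b • e + c • f) (b • e + c • f) =
      (a * c * b) • g.curvatureOp x e f e + (a * c * c) • g.curvatureOp x e f f := by
    simp only [curvatureOp_eq, connectionCurvature, map_add, map_smul, add_apply, smul_apply]
    module
  rw [hR]
  simp only [form_eq_field, map_add, map_smul, add_apply, smul_apply, smul_eq_mul] at h0 ⊢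
  rw [h0]; ring

/-- Numerator and denominator both acquire the factor (a c)². Together with Gram–Schmidt this
reduces curvature bounds to Euclidean orthonormal pairs. -/
theorem sectionalCurvature_lincomb (x e f : EuclideanSpace ℝ (Fin n)) {a b c : ℝ}
    (ha : a ≠ 0) (hc : c ≠ 0) :
    g.sectionalCurvature x (a • e) (b • e + c • f) = g.sectionalCurvature x e f := by
  unfold sectionalCurvature
  rw [form_curvatureOp_lincomb]
  have hden : g.form x (a • e) (a • e) * g.form x (b • e + c • f) (b • e + c • f)
      - g.form x (a • e) (b • e + c • f) ^ 2 =
      (a * c) ^ 2 * (g.form x e e * g.form x f f - g.form x e f ^ 2) := by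
    have hs : g.field x f e = g.field x e f := g.form_comm x f e
    simp only [form_eq_field, map_add, map_smul, add_apply, smul_apply, smul_eq_mul, hs]
    ring
  rw [hden, mul_div_mul_left _ _ (by positivity)]

theorem form_sq_lt_of_linearIndependent (x : EuclideanSpace ℝ (Fin n))
    {u v : EuclideanSpace ℝ (Fin n)} (h : LinearIndependent ℝ ![u, v]) :
    0 < g.form x u u * g.form x v v - g.form x u v ^ 2 := by
  have hu : u ≠ 0 := h.ne_zero 0
  have hw : g.form x u u • v - g.form x u v • u ≠ 0 := by
    intro h0
    have := LinearIndependent.pair_iff.1 h (-g.form x u v) (g.form x u u) (by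
      rw [← h0]; module)
    exact (g.form_self_pos x hu).ne' this.2
  have h1 := g.form_self_pos x hw
  have h2 := g.form_self_pos x hu
  have h3 : g.form x (g.form x u u • v - g.form x u v • u) (g.form x u u • v - g.form x u v • u)
      = g.form x u u * (g.form x u u * g.form x v v - g.form x u v ^ 2) := by
    have hs : g.field x v u = g.field x u v := g.form_comm x v u
    simp only [form_eq_field, map_sub, map_smul, sub_apply, smul_apply, smul_eq_mul, hs]
    ring
  rw [h3] at h1
  exact pos_of_mul_pos_right h1 h2.le

theorem exists_orthonormal_pair {u v : EuclideanSpace ℝ (Fin n)}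
    (h : LinearIndependent ℝ ![u, v]) :
    ∃ e f : EuclideanSpace ℝ (Fin n), ‖e‖ = 1 ∧ ‖f‖ = 1 ∧ inner ℝ e f = 0 ∧
      ∃ a b c : ℝ, a ≠ 0 ∧ c ≠ 0 ∧ u = a • e ∧ v = b • e + c • f := by
  have hu : u ≠ 0 := h.ne_zero 0
  have hun : ‖u‖ ≠ 0 := norm_ne_zero_iff.2 hu
  set e := ‖u‖⁻¹ • u with he
  have hen : ‖e‖ = 1 := by rw [he, norm_smul, norm_inv, norm_norm, inv_mul_cancel₀ hun]
  have hue : u = ‖u‖ • e := by rw [he, smul_smul, mul_inv_cancel₀ hun, one_smul]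
  set w := v - (inner ℝ e v : ℝ) • e with hw
  have hw0 : w ≠ 0 := by
    intro h0
    have := LinearIndependent.pair_iff.1 h (-(inner ℝ e v : ℝ) * ‖u‖⁻¹) 1 (by
      rw [mul_smul, ← he, one_smul, ← h0, hw]; module)
    exact one_ne_zero this.2
  have hwn : ‖w‖ ≠ 0 := norm_ne_zero_iff.2 hw0
  refine ⟨e, ‖w‖⁻¹ • w, hen, ?_, ?_, ‖u‖, inner ℝ e v, ‖w‖, hun, hwn, hue, ?_⟩
  · rw [norm_smul, norm_inv, norm_norm, inv_mul_cancel₀ hwn]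
  · rw [inner_smul_right, hw, inner_sub_right, inner_smul_right, real_inner_self_eq_norm_sq, hen]
    simp
  · have hww : ‖w‖ • ‖w‖⁻¹ • w = w := by rw [smul_smul, mul_inv_cancel₀ hwn, one_smul]
    rw [hww, hw]; abel

theorem linearIndependent_of_orthonormal {e f : EuclideanSpace ℝ (Fin n)} (he : ‖e‖ = 1)
    (hf : ‖f‖ = 1) (hef : inner ℝ e f = 0) : LinearIndependent ℝ ![e, f] := by
  apply Orthonormal.linearIndependent (𝕜 := ℝ)
  constructor
  · intro i; fin_cases i <;> simp [he, hf]
  · intro i j hij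
    fin_cases i <;> fin_cases j <;> simp_all [real_inner_comm]

/-- The sectional curvatures at the points of a compact set are bounded. -/
theorem exists_sectionalCurvature_bound {K : Set (EuclideanSpace ℝ (Fin n))} (hK : IsCompact K) :
    ∃ C : ℝ, 0 < C ∧ ∀ x ∈ K, ∀ u v : EuclideanSpace ℝ (Fin n),
      LinearIndependent ℝ ![u, v] → |g.sectionalCurvature x u v| ≤ C := by
  -- Euclidean orthonormal frames over `K` form a compact set on which the denominator of the
  -- sectional curvature never vanishes, although the metric is not Euclidean.
  let S : Set (EuclideanSpace ℝ (Fin n) × EuclideanSpace ℝ (Fin n) × EuclideanSpace ℝ (Fin n)) :=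
    K ×ˢ ((Metric.sphere 0 1 ×ˢ Metric.sphere 0 1) ∩ {p | (inner ℝ p.1 p.2 : ℝ) = 0})
  have hS : IsCompact S := by
    refine hK.prod (((isCompact_sphere 0 1).prod (isCompact_sphere 0 1)).inter_right ?_)
    exact isClosed_eq (by fun_prop) continuous_const
  have hli : ∀ p ∈ S, LinearIndependent ℝ ![p.2.1, p.2.2] := by
    rintro ⟨x, e, f⟩ ⟨-, ⟨he, hf⟩, hef⟩
    exact linearIndependent_of_orthonormal (by simpa using he) (by simpa using hf) hef
  have hcΓ : Continuous g.christoffelMap := g.contDiff_christoffelMap.continuous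
  have hcdΓ : Continuous (fderiv ℝ g.christoffelMap) :=
    (g.contDiff_christoffelMap.fderiv_right (m := ∞) (by simp)).continuous
  have hcG : Continuous g.field := g.contDiff_field.continuous
  have c1 : Continuous fun p : EuclideanSpace ℝ (Fin n) × EuclideanSpace ℝ (Fin n) ×
      EuclideanSpace ℝ (Fin n) ↦ p.1 := continuous_fst
  have c2 : Continuous fun p : EuclideanSpace ℝ (Fin n) × EuclideanSpace ℝ (Fin n) ×
      EuclideanSpace ℝ (Fin n) ↦ p.2.1 := continuous_fst.comp continuous_snd
  have c3 : Continuous fun p : EuclideanSpace ℝ (Fin n) × EuclideanSpace ℝ (Fin n) ×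
      EuclideanSpace ℝ (Fin n) ↦ p.2.2 := continuous_snd.comp continuous_snd
  have hcR : Continuous fun p : EuclideanSpace ℝ (Fin n) × EuclideanSpace ℝ (Fin n) ×
      EuclideanSpace ℝ (Fin n) ↦ connectionCurvature g.christoffelMap p.1 p.2.1 p.2.2 p.2.2 := by
    unfold connectionCurvature
    exact (((((hcdΓ.comp c1).clm_apply c2).clm_apply c3).clm_apply c3).sub
      ((((hcdΓ.comp c1).clm_apply c3).clm_apply c2).clm_apply c3)).add
      (((hcΓ.comp c1).clm_apply c2).clm_apply (((hcΓ.comp c1).clm_apply c3).clm_apply c3)) |>.sub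
      (((hcΓ.comp c1).clm_apply c3).clm_apply (((hcΓ.comp c1).clm_apply c2).clm_apply c3))
  have hform : ∀ {a b : EuclideanSpace ℝ (Fin n) × EuclideanSpace ℝ (Fin n) ×
      EuclideanSpace ℝ (Fin n) → EuclideanSpace ℝ (Fin n)}, Continuous a → Continuous b →
      Continuous fun p ↦ g.form p.1 (a p) (b p) := by
    intro a b ha hb
    exact ((hcG.comp c1).clm_apply ha).clm_apply hb
  have hcont : ContinuousOn (fun p : EuclideanSpace ℝ (Fin n) × EuclideanSpace ℝ (Fin n) ×
      EuclideanSpace ℝ (Fin n) ↦ g.sectionalCurvature p.1 p.2.1 p.2.2) S := by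
    unfold sectionalCurvature
    simp only [curvatureOp_eq]
    refine ContinuousOn.div (hform hcR c2).continuousOn
      (((hform c2 c2).mul (hform c3 c3)).sub ((hform c2 c3).pow 2)).continuousOn fun p hp ↦ ?_
    exact (g.form_sq_lt_of_linearIndependent p.1 (hli p hp)).ne'
  obtain ⟨C, hC⟩ := hS.exists_bound_of_continuousOn hcont
  refine ⟨max C 1, by positivity, fun x hx u v huv ↦ ?_⟩
  obtain ⟨e, f, he, hf, hef, a, b, c, ha, hc, rfl, rfl⟩ := exists_orthonormal_pair huv
  rw [g.sectionalCurvature_lincomb x e f ha hc]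
  refine le_max_of_le_left ?_
  exact hC (x, e, f) ⟨hx, ⟨by simpa using he, by simpa using hf⟩, hef⟩

end SmoothMetric

end SectionalCurvatureBounds

/-! ### Profile functions for the collapsing circle -/

section Profile

/-- A smooth function equal to `1` for `s ≤ 1` and to `s ^ p` for `s ≥ 4`. -/
def powerProfile (p : ℕ) (s : ℝ) : ℝ := 1 + Real.smoothTransition ((s - 1) / 3) * (s ^ p - 1)

theorem contDiff_powerProfile (p : ℕ) : ContDiff ℝ ∞ (powerProfile p) := by
  unfold powerProfile
  have h : ContDiff ℝ ∞ fun s : ℝ ↦ Real.smoothTransition ((s - 1) / 3) :=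
    Real.smoothTransition.contDiff.comp (by fun_prop)
  exact contDiff_const.add (h.mul (by fun_prop))

theorem powerProfile_of_le_one (p : ℕ) {s : ℝ} (hs : s ≤ 1) : powerProfile p s = 1 := by
  simp [powerProfile, Real.smoothTransition.zero_of_nonpos (show (s - 1) / 3 ≤ 0 by linarith)]

theorem powerProfile_of_four_le (p : ℕ) {s : ℝ} (hs : 4 ≤ s) : powerProfile p s = s ^ p := by
  simp [powerProfile, Real.smoothTransition.one_of_one_le (show 1 ≤ (s - 1) / 3 by linarith)]

theorem one_le_powerProfile (p : ℕ) (s : ℝ) : 1 ≤ powerProfile p s := by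
  rcases le_total s 1 with h | h
  · rw [powerProfile_of_le_one p h]
  · have h1 : 1 ≤ s ^ p := one_le_pow₀ h
    have := mul_nonneg (Real.smoothTransition.nonneg ((s - 1) / 3)) (sub_nonneg.2 h1)
    simp only [powerProfile]; linarith

theorem powerProfile_le (p : ℕ) {s : ℝ} (hs : 0 ≤ s) : powerProfile p s ≤ (1 + s) ^ p := by
  rcases le_total s 1 with h | h
  · rw [powerProfile_of_le_one p h]
    exact one_le_pow₀ (by linarith)
  · have h1 : 1 ≤ s ^ p := one_le_pow₀ h
    have h2 := mul_le_mul_of_nonneg_right (Real.smoothTransition.le_one ((s - 1) / 3))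
      (sub_nonneg.2 h1)
    have h3 : s ^ p ≤ (1 + s) ^ p := pow_le_pow_left₀ hs (by linarith) p
    simp only [powerProfile]; linarith

/-- The length of the collapsing circle at squared distance `s` from its core. -/
def circleProfile (p : ℕ) (ε s : ℝ) : ℝ := (ε ^ 2) ^ p * powerProfile p (s / ε ^ 2)

theorem contDiff_circleProfile (p : ℕ) (ε : ℝ) : ContDiff ℝ ∞ (circleProfile p ε) :=
  contDiff_const.mul ((contDiff_powerProfile p).comp (by fun_prop))

theorem circleProfile_pos (p : ℕ) {ε : ℝ} (hε : 0 < ε) (s : ℝ) : 0 < circleProfile p ε s :=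
  mul_pos (by positivity) (one_pos.trans_le (one_le_powerProfile p _))

theorem circleProfile_of_le (p : ℕ) {ε s : ℝ} (hε : 0 < ε) (hs : s ≤ ε ^ 2) :
    circleProfile p ε s = (ε ^ 2) ^ p := by
  rw [circleProfile, powerProfile_of_le_one, mul_one]
  rw [div_le_one (by positivity)]; exact hs

theorem circleProfile_of_ge (p : ℕ) {ε s : ℝ} (hε : 0 < ε) (hs : 4 * ε ^ 2 ≤ s) :
    circleProfile p ε s = s ^ p := by
  rw [circleProfile, powerProfile_of_four_le, ← mul_pow, mul_div_cancel₀]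
  · positivity
  · rw [le_div_iff₀ (by positivity)]; exact hs

/-- The crude bound (ε²)ᵖ (1 + s/ε²)ᵖ = (ε² + s)ᵖ ≤ ε² + s suffices both to compare the model with
the Euclidean metric and to estimate path lengths in a tube. -/
theorem circleProfile_le {p : ℕ} (hp : p ≠ 0) {ε s : ℝ} (hε : 0 < ε) (hs : 0 ≤ s)
    (hs1 : ε ^ 2 + s ≤ 1) : circleProfile p ε s ≤ ε ^ 2 + s := by
  have h1 : circleProfile p ε s ≤ (ε ^ 2) ^ p * (1 + s / ε ^ 2) ^ p := by
    unfold circleProfile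
    gcongr
    exact powerProfile_le p (by positivity)
  refine h1.trans ?_
  rw [← mul_pow, mul_add, mul_one, mul_div_cancel₀ _ (by positivity)]
  exact pow_le_of_le_one (by positivity) hs1 hp

/-- A smooth cutoff equal to `1` for `s ≤ 1 / 64` and to `0` for `1 / 16 ≤ s`. -/
def ringCutoff (s : ℝ) : ℝ := Real.smoothTransition ((1 / 16 - s) * (64 / 3))

theorem contDiff_ringCutoff : ContDiff ℝ ∞ ringCutoff :=
  Real.smoothTransition.contDiff.comp (by fun_prop)

theorem ringCutoff_of_le {s : ℝ} (hs : s ≤ 1 / 64) : ringCutoff s = 1 :=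
  Real.smoothTransition.one_of_one_le (by linarith)

theorem ringCutoff_of_ge {s : ℝ} (hs : 1 / 16 ≤ s) : ringCutoff s = 0 :=
  Real.smoothTransition.zero_of_nonpos (by linarith)

end Profile

/-! ### The model metric: Euclidean space pinched along the unit circle -/

section Ring

set_option synthInstance.maxHeartbeats 400000
set_option maxSynthPendingDepth 5

/-- Euclidean space of dimension `d + 2`. -/
abbrev Euc (d : ℕ) : Type := EuclideanSpace ℝ (Fin (d + 2))

variable {d : ℕ}

namespace Euc

theorem inner_single_right (u : Euc d) (i : Fin (d + 2)) :
    inner ℝ u (EuclideanSpace.single i (1 : ℝ)) = u i := by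
  simp [EuclideanSpace.inner_single_right]

theorem inner_single_left (u : Euc d) (i : Fin (d + 2)) :
    inner ℝ (EuclideanSpace.single i (1 : ℝ)) u = u i := by
  rw [real_inner_comm, inner_single_right]

theorem coord_sq_add_coord_sq_le (m : Euc d) : m 0 ^ 2 + m 1 ^ 2 ≤ ‖m‖ ^ 2 := by
  rw [EuclideanSpace.norm_sq_eq, Fin.sum_univ_succ, Fin.sum_univ_succ]
  have h : 0 ≤ ∑ i : Fin d, ‖m i.succ.succ‖ ^ 2 := Finset.sum_nonneg fun i _ ↦ sq_nonneg _
  simp only [Real.norm_eq_abs, sq_abs] at h ⊢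
  simpa [← add_assoc] using h

/-- The squared distance to the axis `ℝ e₀`. -/
def tubeSq (y : Euc d) : ℝ := ‖y‖ ^ 2 - y 0 ^ 2

theorem coord_one_sq_le_tubeSq (y : Euc d) : y 1 ^ 2 ≤ tubeSq y := by
  have := coord_sq_add_coord_sq_le y
  unfold tubeSq; linarith

theorem tubeSq_nonneg (y : Euc d) : 0 ≤ tubeSq y :=
  (sq_nonneg _).trans (coord_one_sq_le_tubeSq y)

theorem contDiff_coord (i : Fin (d + 2)) : ContDiff ℝ ∞ (fun y : Euc d ↦ y i) := by
  fun_prop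

theorem contDiff_tubeSq : ContDiff ℝ ∞ (tubeSq (d := d)) :=
  (contDiff_norm_sq ℝ).sub ((contDiff_coord 0).pow 2)

/-- The diagonal map with entries `a, b, …, b`. -/
def scl (a b : ℝ) : Euc d →L[ℝ] Euc d :=
  b • ContinuousLinearMap.id ℝ (Euc d) +
    (a - b) • (EuclideanSpace.proj 0 : Euc d →L[ℝ] ℝ).smulRight (EuclideanSpace.single 0 1)

theorem scl_apply_zero (a b : ℝ) (x : Euc d) : scl a b x 0 = a * x 0 := by
  simp [scl]; ring

theorem scl_apply_of_ne (a b : ℝ) (x : Euc d) {i : Fin (d + 2)} (hi : i ≠ 0) :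
    scl a b x i = b * x i := by
  simp [scl, hi]

theorem scl_scl (a b a' b' : ℝ) (x : Euc d) :
    scl a b (scl a' b' x) = scl (a * a') (b * b') x := by
  ext i
  by_cases hi : i = 0
  · subst hi; simp only [scl_apply_zero]; ring
  · simp only [scl_apply_of_ne _ _ _ hi]; ring

theorem scl_one_one (x : Euc d) : scl 1 1 x = x := by
  simp [scl]

theorem inner_scl_scl (a b : ℝ) (x y : Euc d) :
    inner ℝ (scl a b x) (scl a b y) = b ^ 2 * inner ℝ x y + (a ^ 2 - b ^ 2) * (x 0 * y 0) := by
  have e : ∀ x : Euc d, scl a b x = b • x + ((a - b) * x 0) • EuclideanSpace.single 0 (1 : ℝ) := by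
    intro x; simp [scl, smul_smul]
  rw [e, e]
  simp only [inner_add_left, inner_add_right, inner_smul_left, inner_smul_right,
    inner_single_right, inner_single_left]
  simp
  ring

theorem tubeSq_scl (a b : ℝ) (x : Euc d) : tubeSq (scl a b x) = b ^ 2 * tubeSq x := by
  simp only [tubeSq, ← real_inner_self_eq_norm_sq, inner_scl_scl, scl_apply_zero]
  ring

/-- The radius in the plane of the first two coordinates. -/
def radius (m : Euc d) : ℝ := √(m 0 ^ 2 + m 1 ^ 2)

theorem radius_sq (m : Euc d) : radius m ^ 2 = m 0 ^ 2 + m 1 ^ 2 :=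
  Real.sq_sqrt (by positivity)

theorem contDiffAt_radius {m : Euc d} (h : radius m ≠ 0) : ContDiffAt ℝ ∞ (radius (d := d)) m := by
  unfold radius
  refine ContDiffAt.sqrt ?_ ?_
  · exact (((contDiff_coord 0).pow 2).add ((contDiff_coord 1).pow 2)).contDiffAt
  · rw [← radius_sq]; positivity

theorem continuous_radius : Continuous (radius (d := d)) := by
  unfold radius; fun_prop

/-- The squared distance to the unit circle of the plane of the first two coordinates. -/
def ringSq (m : Euc d) : ℝ := ‖m‖ ^ 2 - 2 * radius m + 1

theorem continuous_ringSq : Continuous (ringSq (d := d)) := by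
  have := continuous_radius (d := d)
  unfold ringSq; fun_prop

theorem contDiffAt_ringSq {m : Euc d} (h : radius m ≠ 0) : ContDiffAt ℝ ∞ (ringSq (d := d)) m :=
  (((contDiff_norm_sq ℝ).contDiffAt).sub (contDiffAt_const.mul (contDiffAt_radius h))).add
    contDiffAt_const

theorem sq_le_ringSq (m : Euc d) : (radius m - 1) ^ 2 ≤ ringSq m := by
  have := coord_sq_add_coord_sq_le m
  have := radius_sq m
  unfold ringSq; nlinarith

theorem ringSq_nonneg (m : Euc d) : 0 ≤ ringSq m := (sq_nonneg _).trans (sq_le_ringSq m)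

theorem radius_gt_of_ringSq_lt {m : Euc d} (h : ringSq m < 1 / 16) : 3 / 4 < radius m := by
  have := sq_le_ringSq m
  nlinarith

theorem ringSq_of_norm_ge {m : Euc d} (h : 2 ≤ ‖m‖) : 1 ≤ ringSq m := by
  have h1 : radius m ≤ ‖m‖ := by
    apply Real.sqrt_le_iff.2 ⟨norm_nonneg _, coord_sq_add_coord_sq_le m⟩
  unfold ringSq; nlinarith

/-- The form `m₁ dm₀ - m₀ dm₁`. -/
def angularForm (m : Euc d) : Euc d →L[ℝ] ℝ :=
  m 1 • (EuclideanSpace.proj 0 : Euc d →L[ℝ] ℝ) - m 0 • (EuclideanSpace.proj 1 : Euc d →L[ℝ] ℝ)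

theorem angularForm_apply (m u : Euc d) : angularForm m u = m 1 * u 0 - m 0 * u 1 := by
  simp [angularForm]

theorem angularForm_sq_le (m u : Euc d) : angularForm m u ^ 2 ≤ radius m ^ 2 * ‖u‖ ^ 2 := by
  have h := coord_sq_add_coord_sq_le u
  rw [angularForm_apply, radius_sq]
  have : (m 1 * u 0 - m 0 * u 1) ^ 2 ≤ (m 0 ^ 2 + m 1 ^ 2) * (u 0 ^ 2 + u 1 ^ 2) := by
    nlinarith [sq_nonneg (m 0 * u 0 + m 1 * u 1)]
  refine this.trans ?_
  gcongr

/-- The coefficient of the rank one perturbation in `ringForm`. -/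
def ringCoeff (ε : ℝ) (m : Euc d) : ℝ :=
  -- In polar coordinates `angularForm` is r² dθ. Adding this multiple of its square changes r² dθ²
  -- into (χ f² + (1 - χ) r²) dθ², with χ the cutoff and f the profile.
  ringCutoff (ringSq m) * (circleProfile (d + 2) ε (ringSq m) ^ 2 - radius m ^ 2) / radius m ^ 4

theorem ringCoeff_of_ge (ε : ℝ) {m : Euc d} (h : 1 / 16 ≤ ringSq m) : ringCoeff ε m = 0 := by
  simp [ringCoeff, ringCutoff_of_ge h]

theorem contDiff_ringCoeff (ε : ℝ) : ContDiff ℝ ∞ (ringCoeff (d := d) ε) := by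
  rw [contDiff_iff_contDiffAt]
  intro m
  by_cases h : radius m = 0
  -- The radius is not smooth where it vanishes, but there `ringSq` is at least 1 and the cutoff is
  -- locally zero.
  · have h1 : 1 / 16 < ringSq m := by
      have := sq_le_ringSq m
      rw [h] at this; norm_num at this ⊢; linarith
    have h2 : ringCoeff (d := d) ε =ᶠ[nhds m] fun _ ↦ 0 := by
      filter_upwards [continuous_ringSq.continuousAt.eventually (lt_mem_nhds h1)] with y hy
      exact ringCoeff_of_ge ε hy.le
    exact contDiffAt_const.congr_of_eventuallyEq h2
  · unfold ringCoeff
    have hs := contDiffAt_ringSq h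
    have hr := contDiffAt_radius h
    exact ((contDiff_ringCutoff.contDiffAt.comp m hs).mul
      ((((contDiff_circleProfile (d + 2) ε).contDiffAt.comp m hs).pow 2).sub (hr.pow 2))).div
      (hr.pow 4) (by positivity)

/-- The product equals χ (f² / r² - 1) with 0 < f ≤ r. The lower bound makes `ringForm` positive
definite; the upper one makes it at most Euclidean. -/
theorem ringCoeff_mul_radius_sq_mem {ε : ℝ} (hε : 0 < ε) (hε' : ε ≤ 1 / 32) (m : Euc d) :
    -1 < ringCoeff ε m * radius m ^ 2 ∧ ringCoeff ε m * radius m ^ 2 ≤ 0 := by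
  rcases le_or_gt (1 / 16) (ringSq m) with h | h
  · simp [ringCoeff_of_ge ε h]
  have hr := radius_gt_of_ringSq_lt h
  have hr0 : 0 < radius m := by linarith
  have hε2 : ε ^ 2 ≤ 1 / 1024 := by nlinarith
  have hf := circleProfile_le (p := d + 2) (by simp) hε (ringSq_nonneg m) (by linarith)
  have hf0 := circleProfile_pos (d + 2) hε (ringSq m)
  have e : ringCoeff ε m * radius m ^ 2 = ringCutoff (ringSq m) *
      (circleProfile (d + 2) ε (ringSq m) ^ 2 / radius m ^ 2 - 1) := by
    unfold ringCoeff; field_simp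
  have h0 : 0 ≤ ringCutoff (ringSq m) := Real.smoothTransition.nonneg _
  have h1 : ringCutoff (ringSq m) ≤ 1 := Real.smoothTransition.le_one _
  have hq0 : 0 < circleProfile (d + 2) ε (ringSq m) ^ 2 / radius m ^ 2 := by positivity
  have hq1 : circleProfile (d + 2) ε (ringSq m) ^ 2 / radius m ^ 2 ≤ 1 := by
    rw [div_le_one (by positivity)]
    apply pow_le_pow_left₀ hf0.le; linarith
  rw [e]
  constructor <;> nlinarith

/-- The Euclidean inner product as a bilinear form. -/
def innerForm : Euc d →L[ℝ] Euc d →L[ℝ] ℝ := innerSL ℝ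

theorem innerForm_apply (u v : Euc d) : innerForm u v = inner ℝ u v := rfl

/-- The Euclidean metric, with the circles in the first coordinate plane shrunk near the unit
circle. -/
def ringForm (ε : ℝ) (m : Euc d) : Euc d →L[ℝ] Euc d →L[ℝ] ℝ :=
  innerForm + ringCoeff ε m • (angularForm m).smulRight (angularForm m)

theorem ringForm_apply (ε : ℝ) (m u v : Euc d) : ringForm ε m u v =
    inner ℝ u v + ringCoeff ε m * (angularForm m u * angularForm m v) := by
  simp [ringForm, innerForm_apply]

theorem ringForm_symm (ε : ℝ) (m u v : Euc d) : ringForm ε m u v = ringForm ε m v u := by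
  simp only [ringForm_apply, real_inner_comm, mul_comm]

theorem contDiff_clm_iff {F : Type*} [NormedAddCommGroup F] [NormedSpace ℝ F]
    {G : F → Euc d →L[ℝ] Euc d →L[ℝ] ℝ} :
    ContDiff ℝ ∞ G ↔ ∀ u v, ContDiff ℝ ∞ fun x ↦ G x u v := by
  rw [contDiff_clm_apply_iff]
  exact forall_congr' fun u ↦ contDiff_clm_apply_iff

theorem contDiff_ringForm (ε : ℝ) : ContDiff ℝ ∞ (ringForm (d := d) ε) := by
  rw [contDiff_clm_iff]
  intro u v
  simp only [ringForm_apply, angularForm_apply]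
  have := contDiff_ringCoeff (d := d) ε
  fun_prop

theorem ringForm_self_pos {ε : ℝ} (hε : 0 < ε) (hε' : ε ≤ 1 / 32) (m : Euc d) {u : Euc d}
    (hu : u ≠ 0) : 0 < ringForm ε m u u := by
  obtain ⟨h1, h2⟩ := ringCoeff_mul_radius_sq_mem hε hε' m
  have hn : 0 < ‖u‖ ^ 2 := by positivity
  have hβ := angularForm_sq_le m u
  rw [ringForm_apply, real_inner_self_eq_norm_sq]
  rcases le_or_gt 0 (ringCoeff ε m) with hc | hc
  · have := mul_nonneg hc (mul_self_nonneg (angularForm m u)); linarith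
  · have : ringCoeff ε m * (radius m ^ 2 * ‖u‖ ^ 2) ≤ ringCoeff ε m * angularForm m u ^ 2 :=
      mul_le_mul_of_nonpos_left hβ hc.le
    nlinarith

theorem ringForm_self_le {ε : ℝ} (hε : 0 < ε) (hε' : ε ≤ 1 / 32) (m u : Euc d) :
    ringForm ε m u u ≤ ‖u‖ ^ 2 := by
  obtain ⟨-, h2⟩ := ringCoeff_mul_radius_sq_mem hε hε' m
  rw [ringForm_apply, real_inner_self_eq_norm_sq]
  rcases lt_or_ge 0 (ringCoeff ε m) with hc | hc
  · have hr : radius m ^ 2 ≤ 0 := by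
      by_contra h
      push Not at h
      have := mul_pos hc h; linarith
    have h0 : angularForm m u ^ 2 ≤ 0 := (angularForm_sq_le m u).trans
      (mul_nonpos_of_nonpos_of_nonneg hr (sq_nonneg _))
    nlinarith
  · have := mul_nonpos_of_nonpos_of_nonneg hc (mul_self_nonneg (angularForm m u)); linarith

theorem ringForm_of_ge (ε : ℝ) {m : Euc d} (h : 1 / 16 ≤ ringSq m) (u v : Euc d) :
    ringForm ε m u v = inner ℝ u v := by
  simp [ringForm_apply, ringCoeff_of_ge ε h]

/-- For ε ≤ 1/32 the profile is already the pure power from 4ε² ≤ 1/256 on, so away from the core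
the model is the same at all levels. -/
theorem ringForm_eq_of_lt {ε ε' : ℝ} (hε0 : 0 < ε) (hε : ε ≤ 1 / 32) (hε0' : 0 < ε')
    (hε' : ε' ≤ 1 / 32) {m : Euc d} (h : 1 / 256 ≤ ringSq m) :
    ringForm ε m = ringForm ε' m := by
  have e : ringCoeff ε m = ringCoeff ε' m := by
    unfold ringCoeff
    rw [circleProfile_of_ge _ hε0 (by nlinarith), circleProfile_of_ge _ hε0' (by nlinarith)]
  ext u v
  simp [ringForm_apply, e]

end Euc

end Ring

/-! ### Tubular coordinates around the unit circle -/

section RingParam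

set_option synthInstance.maxHeartbeats 400000
set_option maxSynthPendingDepth 5

variable {d : ℕ}

namespace Euc

/-- Tubular coordinates around the unit circle: the coordinate `y₀` is the angle, and
`1 + y₁` is the radius. -/
def ringParam (y : Euc d) : Euc d :=
  y + ((1 + y 1) * Real.sin (y 0) - y 0) • EuclideanSpace.single 0 (1 : ℝ)
    + ((1 + y 1) * Real.cos (y 0) - y 1) • EuclideanSpace.single 1 (1 : ℝ)

theorem ringParam_apply_zero (y : Euc d) : ringParam y 0 = (1 + y 1) * Real.sin (y 0) := by
  simp [ringParam]

theorem ringParam_apply_one (y : Euc d) : ringParam y 1 = (1 + y 1) * Real.cos (y 0) := by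
  simp [ringParam]

theorem ringParam_apply_of_ne (y : Euc d) {i : Fin (d + 2)} (h0 : i ≠ 0) (h1 : i ≠ 1) :
    ringParam y i = y i := by
  simp [ringParam, h0, h1]

theorem contDiff_ringParam : ContDiff ℝ ∞ (ringParam (d := d)) := by
  unfold ringParam
  have h0 := contDiff_coord (d := d) 0
  have h1 := contDiff_coord (d := d) 1
  exact (contDiff_id.add ((((contDiff_const.add h1).mul h0.sin).sub h0).smul contDiff_const)).add
    ((((contDiff_const.add h1).mul h0.cos).sub h1).smul contDiff_const)

theorem fderiv_ringParam (y u : Euc d) : fderiv ℝ ringParam y u =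
    u + (u 1 * Real.sin (y 0) + (1 + y 1) * Real.cos (y 0) * u 0 - u 0) •
        EuclideanSpace.single 0 (1 : ℝ)
      + (u 1 * Real.cos (y 0) - (1 + y 1) * Real.sin (y 0) * u 0 - u 1) •
        EuclideanSpace.single 1 (1 : ℝ) := by
  have h0 : HasFDerivAt (fun y : Euc d ↦ y 0) (EuclideanSpace.proj 0 : Euc d →L[ℝ] ℝ) y :=
    (EuclideanSpace.proj 0 : Euc d →L[ℝ] ℝ).hasFDerivAt
  have h1 : HasFDerivAt (fun y : Euc d ↦ y 1) (EuclideanSpace.proj 1 : Euc d →L[ℝ] ℝ) y :=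
    (EuclideanSpace.proj 1 : Euc d →L[ℝ] ℝ).hasFDerivAt
  have hA := (((h1.const_add 1).mul h0.sin).sub h0).smul_const
    (EuclideanSpace.single 0 (1 : ℝ) : Euc d)
  have hB := (((h1.const_add 1).mul h0.cos).sub h1).smul_const
    (EuclideanSpace.single 1 (1 : ℝ) : Euc d)
  have h := (((hasFDerivAt_id y).add hA).add hB).fderiv
  have h' := congrArg (fun L : Euc d →L[ℝ] Euc d ↦ L u) h
  refine h'.trans ?_
  simp
  ring_nf

theorem inner_fderiv_ringParam (y u v : Euc d) :
    inner ℝ (fderiv ℝ ringParam y u) (fderiv ℝ ringParam y v) =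
      inner ℝ u v + ((1 + y 1) ^ 2 - 1) * (u 0 * v 0) := by
  have hs := Real.sin_sq_add_cos_sq (y 0)
  rw [fderiv_ringParam, fderiv_ringParam]
  simp only [inner_add_left, inner_add_right, real_inner_smul_left, real_inner_smul_right,
    inner_single_right, inner_single_left]
  simp
  linear_combination (u 1 * v 1 + (1 + y 1) ^ 2 * (u 0 * v 0)) * hs

theorem angularForm_fderiv_ringParam (y u : Euc d) :
    angularForm (ringParam y) (fderiv ℝ ringParam y u) = (1 + y 1) ^ 2 * u 0 := by
  have hs := Real.sin_sq_add_cos_sq (y 0)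
  rw [angularForm_apply, ringParam_apply_zero, ringParam_apply_one, fderiv_ringParam]
  simp
  linear_combination ((1 + y 1) ^ 2 * u 0) * hs

theorem norm_ringParam_sq (y : Euc d) :
    ‖ringParam y‖ ^ 2 = tubeSq y + 1 + 2 * y 1 := by
  have hs := Real.sin_sq_add_cos_sq (y 0)
  simp only [← real_inner_self_eq_norm_sq, tubeSq]
  unfold ringParam
  simp only [inner_add_left, inner_add_right, real_inner_smul_left, real_inner_smul_right,
    inner_single_right, inner_single_left]
  simp
  linear_combination ((1 + y 1) ^ 2) * hs

theorem radius_ringParam {y : Euc d} (hy : tubeSq y ≤ 1) : radius (ringParam y) = 1 + y 1 := by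
  have h1 := coord_one_sq_le_tubeSq y
  have h2 : 0 ≤ 1 + y 1 := by nlinarith
  have hs := Real.sin_sq_add_cos_sq (y 0)
  have e : ((1 + y 1) * Real.sin (y 0)) ^ 2 + ((1 + y 1) * Real.cos (y 0)) ^ 2
      = (1 + y 1) ^ 2 := by
    linear_combination ((1 + y 1) ^ 2) * hs
  rw [radius, ringParam_apply_zero, ringParam_apply_one, e, Real.sqrt_sq h2]

theorem ringSq_ringParam {y : Euc d} (hy : tubeSq y ≤ 1) : ringSq (ringParam y) = tubeSq y := by
  rw [ringSq, radius_ringParam hy, norm_ringParam_sq]; ring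

theorem exists_ringParam_eq {m : Euc d} (hm : ringSq m < 1 / 16) :
    ∃ y : Euc d, |y 0| ≤ Real.pi ∧ tubeSq y = ringSq m ∧ ringParam y = m := by
  have hr := radius_gt_of_ringSq_lt hm
  have hsq := sq_le_ringSq m
  -- The angle is measured from e₁ towards e₀, hence the order of the two coordinates.
  let z : ℂ := ⟨m 1, m 0⟩
  have hz : ‖z‖ = radius m := by
    rw [Complex.norm_def, Complex.normSq_apply, radius]
    congr 1
    simp [z]; ring
  let y : Euc d := m + (z.arg - m 0) • EuclideanSpace.single 0 (1 : ℝ)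
    + (radius m - 1 - m 1) • EuclideanSpace.single 1 (1 : ℝ)
  have y0 : y 0 = z.arg := by simp [y]
  have y1 : y 1 = radius m - 1 := by simp [y]
  have hcos : radius m * Real.cos z.arg = m 1 := by
    rw [← hz]; exact Complex.norm_mul_cos_arg z
  have hsin : radius m * Real.sin z.arg = m 0 := by
    rw [← hz]; exact Complex.norm_mul_sin_arg z
  have hp : ringParam y = m := by
    ext i
    by_cases h0 : i = 0
    · subst h0; rw [ringParam_apply_zero, y0, y1, ← hsin]; ring
    by_cases h1 : i = 1
    · subst h1; rw [ringParam_apply_one, y0, y1, ← hcos]; ring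
    · rw [ringParam_apply_of_ne y h0 h1]; simp [y, h0, h1]
  refine ⟨y, by rw [y0]; exact Complex.abs_arg_le_pi z, ?_, hp⟩
  have := norm_ringParam_sq y
  rw [hp] at this
  rw [ringSq]
  linarith

/-- In tubular coordinates, `ringForm` is a warped product. -/
theorem ringForm_ringParam {ε : ℝ} {y : Euc d} (hy : tubeSq y ≤ 1 / 64) (u v : Euc d) :
    ringForm ε (ringParam y) (fderiv ℝ ringParam y u) (fderiv ℝ ringParam y v) =
      inner ℝ u v + (circleProfile (d + 2) ε (tubeSq y) ^ 2 - 1) * (u 0 * v 0) := by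
  have hy1 : tubeSq y ≤ 1 := by linarith
  have h1 := coord_one_sq_le_tubeSq y
  have h2 : 0 < 1 + y 1 := by nlinarith
  rw [ringForm_apply, inner_fderiv_ringParam, angularForm_fderiv_ringParam,
    angularForm_fderiv_ringParam, ringCoeff, ringSq_ringParam hy1, radius_ringParam hy1,
    ringCutoff_of_le hy]
  field_simp
  ring

end Euc

end RingParam

/-! ### Extending a local diffeomorphism by a translation -/

section Straightening

variable {E : Type*} [NormedAddCommGroup E] [InnerProductSpace ℝ E] [FiniteDimensional ℝ E]

/-- A map with vanishing first order jet at the origin agrees near the origin with a map that is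
`1 / 2`-Lipschitz and supported in the unit ball. -/
theorem exists_small_extension {R : E → E} (hR : ContDiff ℝ ∞ R) (h0 : R 0 = 0)
    (hd0 : fderiv ℝ R 0 = 0) :
    ∃ (S : E → E) (r : ℝ), 0 < r ∧ ContDiff ℝ ∞ S ∧ (∀ y, ‖y‖ < r → S y = R y) ∧
      (∀ y, 1 ≤ ‖y‖ → S y = 0) ∧ ∀ y, ‖fderiv ℝ S y‖ ≤ 1 / 2 := by
  let χ : E → ℝ := fun y ↦ Real.smoothTransition (2 - ‖y‖ ^ 2)
  have hχ : ContDiff ℝ ∞ χ :=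
    Real.smoothTransition.contDiff.comp (contDiff_const.sub (contDiff_norm_sq ℝ))
  have hχ0 : ∀ y, 2 ≤ ‖y‖ ^ 2 → χ y = 0 := fun y hy ↦
    Real.smoothTransition.zero_of_nonpos (by linarith)
  have hχ1 : ∀ y, ‖y‖ ^ 2 ≤ 1 → χ y = 1 := fun y hy ↦
    Real.smoothTransition.one_of_one_le (by linarith)
  have hχle : ∀ y, |χ y| ≤ 1 := fun y ↦ by
    rw [abs_of_nonneg (Real.smoothTransition.nonneg _)]; exact Real.smoothTransition.le_one _
  obtain ⟨C, hC⟩ := (isCompact_closedBall (0 : E) 2).exists_bound_of_continuousOn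
    (hχ.continuous_fderiv (by simp)).continuousOn
  have hC0 : 0 ≤ C := (norm_nonneg _).trans (hC 0 (by simp))
  -- By the product rule the derivative of the cut-off map is at most κ + (C/δ)(κ · 2δ) = κ (1 +
  -- 2C), which is to equal 1/2.
  set κ : ℝ := 1 / (2 * (1 + 2 * C)) with hκ
  have hκ0 : 0 < κ := by positivity
  have hcont : ContinuousAt (fderiv ℝ R) 0 := (hR.continuous_fderiv (by simp)).continuousAt
  obtain ⟨δ₁, hδ₁, hball⟩ := Metric.continuousAt_iff.1 hcont κ hκ0
  have hDR : ∀ y, ‖y‖ < δ₁ → ‖fderiv ℝ R y‖ ≤ κ := by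
    intro y hy
    have := hball (x := y) (by simpa using hy)
    rw [hd0, dist_zero_right] at this
    exact this.le
  have hRle : ∀ y, ‖y‖ < δ₁ → ‖R y‖ ≤ κ * ‖y‖ := by
    intro y hy
    have := (convex_ball (0 : E) δ₁).norm_image_sub_le_of_norm_fderiv_le (f := R) (𝕜 := ℝ)
      (fun z _ ↦ hR.differentiable (by simp) z) (fun z hz ↦ hDR z (by simpa using hz))
      (Metric.mem_ball_self hδ₁) (by simpa using hy : y ∈ Metric.ball 0 δ₁)
    simpa [h0] using this
  -- The cutoff at scale δ vanishes beyond 3δ/2. Hence 2δ ≤ δ₁ keeps its support where `R` is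
  -- controlled, and 2δ ≤ 1 keeps it in the unit ball.
  obtain ⟨δ, hδ0, hδ2, hδh⟩ : ∃ δ : ℝ, 0 < δ ∧ 2 * δ ≤ δ₁ ∧ 2 * δ ≤ 1 :=
    ⟨min δ₁ 1 / 2, by positivity, by linarith [min_le_left δ₁ 1], by linarith [min_le_right δ₁ 1]⟩
  let ψ : E → ℝ := fun y ↦ χ (δ⁻¹ • y)
  have hψ : ContDiff ℝ ∞ ψ := hχ.comp (contDiff_const_smul _)
  have hnorm : ∀ y : E, ‖δ⁻¹ • y‖ = ‖y‖ / δ := by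
    intro y; rw [norm_smul, Real.norm_of_nonneg (by positivity), div_eq_inv_mul]
  have hS0 : ∀ y, 3 / 2 * δ ≤ ‖y‖ → ψ y • R y = 0 := by
    intro y hy
    have : ψ y = 0 := by
      apply hχ0
      rw [hnorm]
      have : 3 / 2 ≤ ‖y‖ / δ := by rw [le_div_iff₀ hδ0]; exact hy
      nlinarith
    rw [this, zero_smul]
  refine ⟨fun y ↦ ψ y • R y, δ, hδ0, hψ.smul hR, ?_, ?_, ?_⟩
  · intro y hy
    have : ψ y = 1 := by
      apply hχ1
      rw [hnorm]
      have h1 : ‖y‖ / δ ≤ 1 := by rw [div_le_one hδ0]; exact hy.le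
      have h2 : 0 ≤ ‖y‖ / δ := by positivity
      nlinarith
    simp [this]
  · intro y hy
    exact hS0 y (by linarith)
  · intro y
    rcases lt_or_ge (‖y‖) (2 * δ) with hy | hy
    · have hyδ : ‖y‖ < δ₁ := by linarith
      have hdψ : ‖fderiv ℝ ψ y‖ ≤ C / δ := by
        have e : fderiv ℝ ψ y = δ⁻¹ • fderiv ℝ χ (δ⁻¹ • y) := fderiv_comp_smul _
        rw [e, norm_smul, Real.norm_of_nonneg (by positivity), div_eq_inv_mul]
        gcongr
        apply hC
        rw [mem_closedBall_zero_iff, hnorm, div_le_iff₀ hδ0]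
        exact hy.le
      rw [fderiv_fun_smul (hψ.differentiable (by simp) y) (hR.differentiable (by simp) y)]
      calc ‖ψ y • fderiv ℝ R y + (fderiv ℝ ψ y).smulRight (R y)‖
          ≤ ‖ψ y • fderiv ℝ R y‖ + ‖(fderiv ℝ ψ y).smulRight (R y)‖ := norm_add_le _ _
        _ ≤ 1 * κ + (C / δ) * (κ * (2 * δ)) := by
            rw [norm_smul, ContinuousLinearMap.norm_smulRight_apply]
            gcongr
            · exact hχle _
            · exact hDR y hyδ
            · exact (hRle y hyδ).trans (by gcongr)
        _ = 1 / 2 := by rw [hκ]; field_simp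
    · have : (fun y ↦ ψ y • R y) =ᶠ[nhds y] fun _ ↦ 0 := by
        filter_upwards [continuous_norm.continuousAt.eventually
          (lt_mem_nhds (show 3 / 2 * δ < ‖y‖ by linarith))] with z hz using hS0 z hz.le
      rw [this.fderiv_eq]
      simp

/-- A smooth perturbation of a translation by a `1 / 2`-Lipschitz map is a diffeomorphism. -/
theorem exists_contDiff_inverse {S : E → E} (hS : ContDiff ℝ ∞ S)
    (hS' : ∀ y, ‖fderiv ℝ S y‖ ≤ 1 / 2) (e : E) :
    ∃ J : E → E, ContDiff ℝ ∞ J ∧ (∀ y, J (y + e + S y) = y) ∧ ∀ z, J z + e + S (J z) = z := by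
  have hM : ContDiff ℝ ∞ fun y ↦ y + e + S y := (contDiff_id.add contDiff_const).add hS
  have hlip : LipschitzWith (1 / 2) S :=
    lipschitzWith_of_nnnorm_fderiv_le (hS.differentiable (by simp)) fun y ↦ by
      rw [← NNReal.coe_le_coe]; simpa using hS' y
  -- A perturbation of the identity with Lipschitz constant below 1 is a homeomorphism; injectivity
  -- of each derivative then makes the inverse smooth.
  have happ : ApproximatesLinearOn (fun y ↦ y + e + S y)
      ((ContinuousLinearEquiv.refl ℝ E : E ≃L[ℝ] E) : E →L[ℝ] E) Set.univ (1 / 2) := by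
    intro x _ y _
    have := hlip.norm_sub_le x y
    simp only [ContinuousLinearEquiv.coe_refl, ContinuousLinearMap.id_apply]
    rw [show x + e + S x - (y + e + S y) - (x - y) = S x - S y by abel]
    exact this
  have hc : Subsingleton E ∨ (1 / 2 : NNReal) <
      ‖(((ContinuousLinearEquiv.refl ℝ E).symm : E ≃L[ℝ] E) : E →L[ℝ] E)‖₊⁻¹ := by
    rcases subsingleton_or_nontrivial E with h | h
    · exact Or.inl h
    · right
      simp only [ContinuousLinearEquiv.refl_symm, ContinuousLinearEquiv.coe_refl,
        ContinuousLinearMap.nnnorm_id, inv_one]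
      exact NNReal.half_lt_self one_ne_zero
  let H := happ.toHomeomorph _ hc
  have hH : ∀ y, H y = y + e + S y := fun y ↦ rfl
  have hinj : ∀ y, Function.Injective
      ((ContinuousLinearMap.id ℝ E + fderiv ℝ S y : E →L[ℝ] E) : E →ₗ[ℝ] E) := by
    intro y
    rw [injective_iff_map_eq_zero]
    intro u hu
    have h1 : u = - fderiv ℝ S y u := by
      apply eq_neg_of_add_eq_zero_left; exact hu
    have h2 : ‖u‖ ≤ 1 / 2 * ‖u‖ := by
      conv_lhs => rw [h1, norm_neg]
      exact (fderiv ℝ S y).le_of_opNorm_le (hS' y) u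
    have h3 : ‖u‖ ≤ 0 := by linarith
    exact norm_le_zero_iff.1 h3
  let L : E → E ≃L[ℝ] E := fun y ↦ (LinearEquiv.ofInjectiveEndo _ (hinj y)).toContinuousLinearEquiv
  have hL : ∀ y, HasFDerivAt H (L y : E →L[ℝ] E) y := by
    intro y
    have h1 := (((hasFDerivAt_id y).add_const e).add
      (hS.differentiable (by simp) y).hasFDerivAt)
    have h2 : (L y : E →L[ℝ] E) = ContinuousLinearMap.id ℝ E + fderiv ℝ S y := by ext; rfl
    rw [h2]
    exact h1
  refine ⟨H.symm, H.contDiff_symm hL hM, fun y ↦ ?_, fun z ↦ ?_⟩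
  · rw [← hH]; exact H.symm_apply_apply y
  · rw [← hH]; exact H.apply_symm_apply z

end Straightening

/-! ### The straightening diffeomorphism and the self-similar warped product -/

section StraighteningRing

set_option synthInstance.maxHeartbeats 400000
set_option maxSynthPendingDepth 5

variable {d : ℕ}

namespace Euc

theorem ringParam_zero : ringParam (0 : Euc d) = EuclideanSpace.single 1 (1 : ℝ) := by
  simp [ringParam]

/-- A diffeomorphism of Euclidean space that agrees with the tubular coordinates `ringParam` near
the origin and with a translation outside the unit ball. -/
structure Straightening (d : ℕ) where
  /-- The diffeomorphism. -/
  toFun : Euc d → Euc d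
  /-- The inverse diffeomorphism. -/
  inv : Euc d → Euc d
  /-- The radius of the ball where it agrees with `ringParam`. -/
  rad : ℝ
  rad_pos : 0 < rad
  contDiff : ContDiff ℝ ∞ toFun
  contDiff_inv : ContDiff ℝ ∞ inv
  left_inv : ∀ y, inv (toFun y) = y
  right_inv : ∀ z, toFun (inv z) = z
  eq_ringParam : ∀ y, ‖y‖ < rad → toFun y = ringParam y
  eq_translation : ∀ y, 1 ≤ ‖y‖ → toFun y = y + EuclideanSpace.single 1 1
  norm_fderiv_le : ∀ y u, ‖fderiv ℝ toFun y u‖ ≤ 2 * ‖u‖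

/-- At the origin `ringParam` has value e₁ and derivative the identity, so it differs from the
translation by e₁ by a map with vanishing 1-jet. -/
theorem nonempty_straightening (d : ℕ) : Nonempty (Straightening d) := by
  let e : Euc d := EuclideanSpace.single 1 1
  let R : Euc d → Euc d := fun y ↦ ringParam y - (y + e)
  have hR : ContDiff ℝ ∞ R := contDiff_ringParam.sub (contDiff_id.add contDiff_const)
  have hR0 : R 0 = 0 := by simp [R, e, ringParam_zero]
  have hdR : fderiv ℝ R 0 = 0 := by
    have h1 := (contDiff_ringParam (d := d)).differentiable (by simp) 0
    have h2 := (h1.hasFDerivAt.sub ((hasFDerivAt_id 0).add_const e)).fderiv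
    refine h2.trans ?_
    ext1 u
    simp [fderiv_ringParam]
  obtain ⟨S, r, hr, hS, hSR, hS1, hS'⟩ := exists_small_extension hR hR0 hdR
  obtain ⟨J, hJ, hJl, hJr⟩ := exists_contDiff_inverse hS hS' e
  refine ⟨⟨fun y ↦ y + e + S y, J, r, hr, (contDiff_id.add contDiff_const).add hS, hJ, hJl, hJr,
    ?_, ?_, ?_⟩⟩
  · intro y hy
    simp [hSR y hy, R]
  · intro y hy
    simp [hS1 y hy, e]
  · intro y u
    have h := (((hasFDerivAt_id y).add_const e).add (hS.differentiable (by simp) y).hasFDerivAt)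
    have h2 : fderiv ℝ (fun y ↦ y + e + S y) y u = u + fderiv ℝ S y u :=
      congrArg (fun L : Euc d →L[ℝ] Euc d ↦ L u) h.fderiv
    rw [h2]
    have h3 := (fderiv ℝ S y).le_of_opNorm_le (hS' y) u
    have h4 := norm_add_le u (fderiv ℝ S y u)
    have h5 := norm_nonneg u
    linarith

/-- The warped product form `Φ(tubeSq)² dy₀² + dy₁² + ⋯`. -/
def warpedForm (d : ℕ) (y : Euc d) : Euc d →L[ℝ] Euc d →L[ℝ] ℝ :=
  innerForm + (powerProfile (d + 2) (tubeSq y) ^ 2 - 1) •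
    (EuclideanSpace.proj 0 : Euc d →L[ℝ] ℝ).smulRight (EuclideanSpace.proj 0 : Euc d →L[ℝ] ℝ)

theorem warpedForm_apply (y u v : Euc d) : warpedForm d y u v =
    inner ℝ u v + (powerProfile (d + 2) (tubeSq y) ^ 2 - 1) * (u 0 * v 0) := by
  simp [warpedForm, innerForm_apply]

theorem contDiff_warpedForm : ContDiff ℝ ∞ (warpedForm d) := by
  rw [contDiff_clm_iff]
  intro u v
  simp only [warpedForm_apply]
  exact contDiff_const.add (((((contDiff_powerProfile (d + 2)).comp contDiff_tubeSq).pow 2).sub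
    contDiff_const).mul contDiff_const)

/-- The warped product metric. -/
def warpedMetric (d : ℕ) : SmoothMetric (Euc d) :=
  SmoothMetric.ofField (warpedForm d) contDiff_warpedForm
    (fun y u v ↦ by simp only [warpedForm_apply, real_inner_comm, mul_comm])
    (fun y u hu ↦ by
      rw [warpedForm_apply, real_inner_self_eq_norm_sq]
      have h1 : 0 < ‖u‖ ^ 2 := by positivity
      have h2 := one_le_powerProfile (d + 2) (tubeSq y)
      have h3 : 0 ≤ powerProfile (d + 2) (tubeSq y) ^ 2 - 1 := by nlinarith
      have h4 := mul_nonneg h3 (mul_self_nonneg (u 0))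
      linarith)

theorem warpedMetric_form (y u v : Euc d) : (warpedMetric d).form y u v =
    inner ℝ u v + (powerProfile (d + 2) (tubeSq y) ^ 2 - 1) * (u 0 * v 0) :=
  warpedForm_apply y u v

theorem fderiv_scl_add (a b : ℝ) (z x : Euc d) :
    fderiv ℝ (fun y ↦ scl a b y + z) x = scl a b := by
  rw [fderiv_add_const]; exact (scl a b).fderiv

theorem scl_scl_inv {a b : ℝ} (ha : a ≠ 0) (hb : b ≠ 0) (x : Euc d) :
    scl a b (scl a⁻¹ b⁻¹ x) = x := by
  rw [scl_scl, mul_inv_cancel₀ ha, mul_inv_cancel₀ hb, scl_one_one]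

theorem scl_inv_scl {a b : ℝ} (ha : a ≠ 0) (hb : b ≠ 0) (x : Euc d) :
    scl a⁻¹ b⁻¹ (scl a b x) = x := by
  rw [scl_scl, inv_mul_cancel₀ ha, inv_mul_cancel₀ hb, scl_one_one]

theorem linearIndependent_map_pair {L : Euc d →L[ℝ] Euc d} (hL : Function.Injective L) {u v : Euc d}
    (h : LinearIndependent ℝ ![u, v]) : LinearIndependent ℝ ![L u, L v] := by
  rw [LinearIndependent.pair_iff] at h ⊢
  intro s t hst
  apply h s t
  apply hL
  simpa using hst

theorem injective_scl {a b : ℝ} (ha : a ≠ 0) (hb : b ≠ 0) :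
    Function.Injective (scl a b : Euc d →L[ℝ] Euc d) :=
  Function.LeftInverse.injective (g := scl a⁻¹ b⁻¹) (scl_inv_scl ha hb)

theorem tubeSq_add_single (y : Euc d) (c : ℝ) :
    tubeSq (y + c • EuclideanSpace.single 0 (1 : ℝ)) = tubeSq y := by
  simp only [tubeSq, ← real_inner_self_eq_norm_sq, inner_add_left, inner_add_right,
    real_inner_smul_left, real_inner_smul_right, inner_single_right, inner_single_left]
  simp
  ring

/-- The hypothesis on the profile says exactly that the affine map is, near `x`, a homothety of the
warped product with factor `b`. -/
theorem warpedMetric_sectionalCurvature_scl {a b c : ℝ} (hb : b ≠ 0) {x : Euc d}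
    (h : ∀ᶠ y in nhds x, powerProfile (d + 2) (b ^ 2 * tubeSq y) * a
      = b * powerProfile (d + 2) (tubeSq y)) (u v : Euc d) :
    (warpedMetric d).sectionalCurvature (scl a b x + c • EuclideanSpace.single 0 (1 : ℝ))
      (scl a b u) (scl a b v) = (warpedMetric d).sectionalCurvature x u v / b ^ 2 := by
  have hΨ : ContDiff ℝ ∞ fun y : Euc d ↦ scl a b y + c • EuclideanSpace.single 0 (1 : ℝ) :=
    (scl a b).contDiff.add contDiff_const
  have := (warpedMetric d).sectionalCurvature_of_isometry (warpedMetric d) hΨ hb (x := x) (by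
    filter_upwards [h] with y hy u v
    rw [fderiv_scl_add, warpedMetric_form, warpedMetric_form, tubeSq_add_single, tubeSq_scl,
      inner_scl_scl, scl_apply_zero, scl_apply_zero]
    linear_combination (powerProfile (d + 2) (b ^ 2 * tubeSq y) * a
      + b * powerProfile (d + 2) (tubeSq y)) * (u 0 * v 0) * hy) u v
  rwa [fderiv_scl_add] at this

theorem isCompact_slice (d : ℕ) (r : ℝ) : IsCompact {x : Euc d | x 0 = 0 ∧ tubeSq x ≤ r ^ 2} := by
  have h0 : Continuous fun x : Euc d ↦ x 0 := (contDiff_coord 0).continuous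
  have h1 : Continuous fun x : Euc d ↦ tubeSq x := contDiff_tubeSq.continuous
  have hcl : IsClosed {x : Euc d | x 0 = 0 ∧ tubeSq x ≤ r ^ 2} :=
    (isClosed_singleton.preimage h0 (X := Euc d)).inter (isClosed_Iic.preimage h1)
  refine Metric.isCompact_of_isClosed_isBounded hcl
    ((Metric.isBounded_closedBall (x := (0 : Euc d)) (r := |r|)).subset ?_)
  rintro x ⟨hx0, hx⟩
  rw [mem_closedBall_zero_iff]
  simp only [tubeSq, hx0] at hx
  apply abs_le_of_sq_le_sq _ (abs_nonneg r) |> fun h ↦ (le_abs_self _).trans h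
  rw [sq_abs]; linarith

/-- The sectional curvature of the warped product metric decays quadratically. -/
theorem exists_warpedMetric_curvature_bound (d : ℕ) : ∃ C : ℝ, 0 < C ∧ ∀ x u v : Euc d,
    LinearIndependent ℝ ![u, v] →
      |(warpedMetric d).sectionalCurvature x u v| ≤ C / (1 + tubeSq x) := by
  -- Translations in y₀ are isometries, so only the slice y₀ = 0 matters; its part with `tubeSq` at
  -- most 9 is compact.
  obtain ⟨C, hC, hbound⟩ := (warpedMetric d).exists_sectionalCurvature_bound (isCompact_slice d 3)
  have key : ∀ (x u v : Euc d) (a b : ℝ), a ≠ 0 → 0 < b → tubeSq x ≤ 9 * b ^ 2 →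
      (∀ᶠ s in nhds (tubeSq x / b ^ 2), powerProfile (d + 2) (b ^ 2 * s) * a
        = b * powerProfile (d + 2) s) → LinearIndependent ℝ ![u, v] →
      |(warpedMetric d).sectionalCurvature x u v| ≤ C / b ^ 2 := by
    intro x u v a b ha hb hx h huv
    let x' : Euc d := scl a⁻¹ b⁻¹ (x + (-x 0) • EuclideanSpace.single 0 (1 : ℝ))
    have hx'0 : x' 0 = 0 := by simp [x', scl_apply_zero]; ring
    have hx' : tubeSq x' = tubeSq x / b ^ 2 := by
      simp only [x', tubeSq_scl, tubeSq_add_single]; field_simp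
    have hxx' : scl a b x' + x 0 • EuclideanSpace.single 0 (1 : ℝ) = x := by
      simp only [x', scl_scl_inv ha hb.ne']; module
    have hu : scl a b (scl a⁻¹ b⁻¹ u) = u := scl_scl_inv ha hb.ne' u
    have hv : scl a b (scl a⁻¹ b⁻¹ v) = v := scl_scl_inv ha hb.ne' v
    have e := warpedMetric_sectionalCurvature_scl (c := x 0) hb.ne' (x := x')
      (contDiff_tubeSq.continuous.continuousAt.eventually (by rw [hx']; exact h))
      (scl a⁻¹ b⁻¹ u) (scl a⁻¹ b⁻¹ v)
    rw [hxx', hu, hv] at e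
    rw [e, abs_div, abs_of_pos (by positivity : 0 < b ^ 2)]
    gcongr
    refine hbound x' ⟨hx'0, ?_⟩ _ _ (linearIndependent_map_pair
      (injective_scl (inv_ne_zero ha) (inv_ne_zero hb.ne')) huv)
    rw [hx', div_le_iff₀ (by positivity)]; linarith
  -- The constant 10 serves both cases: 1 + s ≤ 10 for s ≤ 9, and 9 / s ≤ 10 / (1 + s) for s ≥ 9.
  refine ⟨10 * C, by positivity, fun x u v huv ↦ ?_⟩
  have hx0 := tubeSq_nonneg x
  rcases le_or_gt (tubeSq x) 9 with h9 | h9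
  · refine (key x u v 1 1 one_ne_zero one_pos (by linarith) (by simp) huv).trans ?_
    rw [one_pow, div_one, le_div_iff₀ (by positivity)]
    nlinarith
  -- A homothety with factor b moves the point to `tubeSq` = 9, beyond 4, where the profile is the
  -- pure power. By homogeneity of that power the axis must be scaled by b / (b²)^(d+2).
  · set b : ℝ := √(tubeSq x) / 3 with hb
    have hb0 : 0 < b := by positivity
    have hb2 : b ^ 2 = tubeSq x / 9 := by
      rw [hb, div_pow, Real.sq_sqrt hx0]; norm_num
    have hq : tubeSq x / b ^ 2 = 9 := by rw [hb2]; field_simp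
    have hb1 : 1 ≤ b ^ 2 := by rw [hb2]; linarith
    refine (key x u v (b / (b ^ 2) ^ (d + 2)) b (by positivity) hb0 (by linarith) ?_ huv).trans ?_
    · rw [hq]
      filter_upwards [lt_mem_nhds (show (4 : ℝ) < 9 by norm_num)] with s hs
      rw [powerProfile_of_four_le _ hs.le, powerProfile_of_four_le _ (by nlinarith), mul_pow]
      field_simp
    · rw [hb2, le_div_iff₀ (by positivity), div_mul_eq_mul_div, div_le_iff₀ (by positivity)]
      nlinarith

end Euc

end StraighteningRing

/-! ### The levels and their gluing -/

section GlobalMetric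

set_option synthInstance.maxHeartbeats 400000
set_option maxSynthPendingDepth 5

variable {d : ℕ}

namespace Euc

/-- The relative radius of the collapsing tube at level `k`. -/
def tubeRad (k : ℕ) : ℝ := 1 / (32 * (k + 1))

theorem tubeRad_pos (k : ℕ) : 0 < tubeRad k := by unfold tubeRad; positivity

theorem tubeRad_le (k : ℕ) : tubeRad k ≤ 1 / 32 := by
  unfold tubeRad
  apply one_div_le_one_div_of_le (by norm_num)
  have : (0 : ℝ) ≤ k := k.cast_nonneg
  linarith

/-- The relative length of the collapsing circle at level `k`. -/
def circleLen (d k : ℕ) : ℝ := (tubeRad k ^ 2) ^ (d + 2)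

theorem circleLen_pos (d k : ℕ) : 0 < circleLen d k := by
  have := tubeRad_pos k; unfold circleLen; positivity

theorem circleLen_le_sq (d k : ℕ) : circleLen d k ≤ tubeRad k ^ 2 := by
  have h0 := tubeRad_pos k
  have h1 := tubeRad_le k
  exact pow_le_of_le_one (by positivity) (by nlinarith) (by simp)

theorem circleLen_le (d k : ℕ) : circleLen d k ≤ tubeRad k := by
  have h0 := tubeRad_pos k
  have h1 := tubeRad_le k
  have := circleLen_le_sq d k
  nlinarith

namespace Straightening

variable (S : Straightening d)

/-- The factor by which the angular direction of one level is contracted in the next one. -/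
def ratio : ℝ := min S.rad 1 / 8

theorem ratio_pos : 0 < S.ratio := by
  have := S.rad_pos; unfold ratio; positivity

theorem ratio_le : S.ratio ≤ 1 / 8 := by
  unfold ratio; linarith [min_le_right S.rad 1]

/-- This sends the ball of radius 4 in the coordinates of level k to where, at level k + 1, the
straightening is `ringParam`, so that the tube description applies to it. -/
theorem ratio_lt_rad : 4 * S.ratio < S.rad := by
  have := S.rad_pos
  unfold ratio; linarith [min_le_left S.rad 1]

/-- The size of level `k`. -/
def scale : ℕ → ℝ
  | 0 => 1
  -- A round ball in the core of level k + 1 appears with the factor `scale (k + 1) * ratio *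
  -- circleLen`, which has to equal `scale k`.
  | k + 1 => scale k / (S.ratio * circleLen d (k + 1))

theorem scale_pos (k : ℕ) : 0 < S.scale k := by
  induction k with
  | zero => exact one_pos
  | succ k ih => exact div_pos ih (mul_pos S.ratio_pos (circleLen_pos d _))

theorem scale_succ_mul (k : ℕ) :
    S.scale (k + 1) * (S.ratio * circleLen d (k + 1)) = S.scale k := by
  have := S.ratio_pos
  have := circleLen_pos d (k + 1)
  simp only [scale]; field_simp

/-- The linear coordinates of level `k`. -/
def coords (k : ℕ) : Euc d →L[ℝ] Euc d := scl (S.ratio ^ k) (S.scale k)⁻¹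

theorem coords_succ (k : ℕ) (x : Euc d) : S.coords (k + 1) x =
    scl S.ratio (S.ratio * circleLen d (k + 1)) (S.coords k x) := by
  have h := S.scale_succ_mul k
  have h1 := S.scale_pos k
  have h2 := S.scale_pos (k + 1)
  rw [coords, coords, scl_scl]
  congr 2
  · ring
  · rw [← h]
    have := S.ratio_pos
    have := circleLen_pos d (k + 1)
    field_simp

theorem coords_zero (x : Euc d) : S.coords 0 x = x := by
  simp [coords, scale, scl_one_one]

theorem norm_scl_le {a b : ℝ} (hb : 0 ≤ b) (hab : b ≤ a) (x : Euc d) :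
    ‖scl a b x‖ ≤ a * ‖x‖ := by
  have ha : 0 ≤ a := hb.trans hab
  apply abs_le_of_sq_le_sq _ (by positivity) |> fun h ↦ (le_abs_self _).trans h
  rw [← real_inner_self_eq_norm_sq, inner_scl_scl, real_inner_self_eq_norm_sq, mul_pow]
  have h1 := tubeSq_nonneg x
  unfold tubeSq at h1
  nlinarith [mul_nonneg (sub_nonneg.2 (pow_le_pow_left₀ hb hab 2)) h1]

theorem norm_coords_succ_le (k : ℕ) (x : Euc d) :
    ‖S.coords (k + 1) x‖ ≤ S.ratio * ‖S.coords k x‖ := by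
  have h1 := S.ratio_pos
  have h2 := circleLen_pos d (k + 1)
  have h3 := circleLen_le d (k + 1)
  have h4 := tubeRad_le (k + 1)
  rw [coords_succ]
  exact norm_scl_le (by positivity) (by nlinarith) _

theorem norm_coords_succ_lt {k : ℕ} {x : Euc d} (h : ‖S.coords k x‖ < 4) :
    ‖S.coords (k + 1) x‖ < 1 := by
  have h1 := S.norm_coords_succ_le k x
  have h2 := S.ratio_le
  have h3 := S.ratio_pos
  nlinarith [norm_nonneg (S.coords k x)]

theorem norm_coords_lt_of_lt {j k : ℕ} (hjk : j < k) {x : Euc d} (h : ‖S.coords j x‖ < 4) :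
    ‖S.coords k x‖ < 1 := by
  induction k, hjk using Nat.le_induction with
  | base => exact S.norm_coords_succ_lt h
  | succ k _ ih => exact S.norm_coords_succ_lt (ih.trans (by norm_num))

theorem norm_coords_lt_of_le {j k : ℕ} (hjk : j ≤ k) {x : Euc d} (h : ‖S.coords j x‖ < 4) :
    ‖S.coords k x‖ < 4 := by
  rcases hjk.eq_or_lt with rfl | hlt
  · exact h
  · exact (S.norm_coords_lt_of_lt hlt h).trans (by norm_num)

theorem norm_coords_le (k : ℕ) (x : Euc d) : ‖S.coords k x‖ ≤ S.ratio ^ k * ‖x‖ := by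
  induction k with
  | zero => simp [coords_zero]
  | succ k ih =>
    refine (S.norm_coords_succ_le k x).trans ?_
    rw [pow_succ']
    have := S.ratio_pos
    rw [mul_assoc]; gcongr

theorem exists_norm_coords_lt (x : Euc d) : ∃ k, ‖S.coords k x‖ < 4 := by
  have h1 : Tendsto (fun k ↦ S.ratio ^ k * ‖x‖) atTop (nhds (0 * ‖x‖)) :=
    (tendsto_pow_atTop_nhds_zero_of_lt_one S.ratio_pos.le
      (S.ratio_le.trans_lt (by norm_num))).mul_const _
  rw [zero_mul] at h1
  obtain ⟨k, hk⟩ := (h1.eventually (gt_mem_nhds (show (0 : ℝ) < 4 by norm_num))).exists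
  exact ⟨k, (S.norm_coords_le k x).trans_lt hk⟩

/-- The nonlinear coordinates of level `k`, in which the core of the tube is the unit circle. -/
def ringCoords (k : ℕ) (x : Euc d) : Euc d := S.toFun (S.coords k x)

theorem contDiff_ringCoords (k : ℕ) : ContDiff ℝ ∞ (S.ringCoords k) :=
  S.contDiff.comp (S.coords k).contDiff

theorem fderiv_ringCoords (k : ℕ) (x u : Euc d) : fderiv ℝ (S.ringCoords k) x u =
    fderiv ℝ S.toFun (S.coords k x) (S.coords k u) := by
  have h := ((S.contDiff.differentiable (by simp) (S.coords k x)).hasFDerivAt.comp x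
    (S.coords k).hasFDerivAt).fderiv
  exact congrArg (fun L : Euc d →L[ℝ] Euc d ↦ L u) h

theorem injective_fderiv (y : Euc d) : Function.Injective (fderiv ℝ S.toFun y) := by
  have h1 : HasFDerivAt (S.inv ∘ S.toFun) _ y :=
    (S.contDiff_inv.differentiable (by simp) (S.toFun y)).hasFDerivAt.comp y
      (S.contDiff.differentiable (by simp) y).hasFDerivAt
  have h2 : S.inv ∘ S.toFun = id := funext S.left_inv
  rw [h2] at h1
  have h3 := h1.unique (hasFDerivAt_id y)
  refine Function.LeftInverse.injective (g := fderiv ℝ S.inv (S.toFun y)) fun u ↦ ?_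
  exact congrArg (fun L : Euc d →L[ℝ] Euc d ↦ L u) h3

theorem coords_injective (k : ℕ) : Function.Injective (S.coords k) :=
  injective_scl (pow_pos S.ratio_pos k).ne' (inv_pos.2 (S.scale_pos k)).ne'

theorem injective_fderiv_ringCoords (k : ℕ) (x : Euc d) :
    Function.Injective (fderiv ℝ (S.ringCoords k) x) := by
  intro u v h
  rw [fderiv_ringCoords, fderiv_ringCoords] at h
  exact S.coords_injective k (S.injective_fderiv _ h)

/-- The metric of level `k`. -/
def levelForm (k : ℕ) (x : Euc d) : Euc d →L[ℝ] Euc d →L[ℝ] ℝ :=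
  S.scale k ^ 2 • (ringForm (tubeRad k) (S.ringCoords k x)).bilinearComp
    (fderiv ℝ (S.ringCoords k) x) (fderiv ℝ (S.ringCoords k) x)

theorem levelForm_apply (k : ℕ) (x u v : Euc d) : S.levelForm k x u v =
    S.scale k ^ 2 * ringForm (tubeRad k) (S.ringCoords k x)
      (fderiv ℝ (S.ringCoords k) x u) (fderiv ℝ (S.ringCoords k) x v) := by
  simp [levelForm]

theorem levelForm_symm (k : ℕ) (x u v : Euc d) : S.levelForm k x u v = S.levelForm k x v u := by
  rw [levelForm_apply, levelForm_apply, ringForm_symm]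

theorem levelForm_self_pos (k : ℕ) (x : Euc d) {u : Euc d} (hu : u ≠ 0) :
    0 < S.levelForm k x u u := by
  rw [levelForm_apply]
  refine mul_pos (pow_pos (S.scale_pos k) 2)
    (ringForm_self_pos (tubeRad_pos k) (tubeRad_le k) _ ?_)
  rwa [Ne, map_eq_zero_iff _ (S.injective_fderiv_ringCoords k x)]

theorem levelForm_self_nonneg (k : ℕ) (x u : Euc d) : 0 ≤ S.levelForm k x u u := by
  rcases eq_or_ne u 0 with rfl | hu
  · simp
  · exact (S.levelForm_self_pos k x hu).le

theorem contDiff_levelForm (k : ℕ) : ContDiff ℝ ∞ (S.levelForm k) := by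
  rw [contDiff_clm_iff]
  intro u v
  simp only [levelForm_apply]
  have h1 : ∀ u, ContDiff ℝ ∞ fun x ↦ fderiv ℝ (S.ringCoords k) x u := fun u ↦
    ((S.contDiff_ringCoords k).fderiv_right (m := ∞) (by simp)).clm_apply contDiff_const
  have h2 : ContDiff ℝ ∞ fun x ↦ ringForm (tubeRad k) (S.ringCoords k x) :=
    (contDiff_ringForm (tubeRad k)).comp (S.contDiff_ringCoords k)
  exact contDiff_const.mul ((h2.clm_apply (h1 u)).clm_apply (h1 v))

theorem levelForm_self_le (k : ℕ) (x u : Euc d) :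
    S.levelForm k x u u ≤ 4 * (S.scale k ^ 2 * ‖S.coords k u‖ ^ 2) := by
  rw [levelForm_apply]
  have h1 := ringForm_self_le (tubeRad_pos k) (tubeRad_le k) (S.ringCoords k x)
    (fderiv ℝ (S.ringCoords k) x u)
  have h2 := S.norm_fderiv_le (S.coords k x) (S.coords k u)
  rw [← fderiv_ringCoords] at h2
  have h3 : ‖fderiv ℝ (S.ringCoords k) x u‖ ^ 2 ≤ (2 * ‖S.coords k u‖) ^ 2 := by gcongr
  have h4 : 0 ≤ S.scale k ^ 2 := sq_nonneg _
  nlinarith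

theorem fderiv_of_one_lt {y : Euc d} (hy : 1 < ‖y‖) (u : Euc d) : fderiv ℝ S.toFun y u = u := by
  have h : S.toFun =ᶠ[nhds y] fun y ↦ y + EuclideanSpace.single 1 1 := by
    filter_upwards [continuous_norm.continuousAt.eventually (lt_mem_nhds hy)] with z hz
    exact S.eq_translation z hz.le
  rw [h.fderiv_eq, fderiv_add_const]
  simp

theorem fderiv_of_lt_rad {y : Euc d} (hy : ‖y‖ < S.rad) :
    fderiv ℝ S.toFun y = fderiv ℝ ringParam y := by
  have h : S.toFun =ᶠ[nhds y] ringParam := by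
    filter_upwards [continuous_norm.continuousAt.eventually (gt_mem_nhds hy)] with z hz
    exact S.eq_ringParam z hz
  exact h.fderiv_eq

theorem one_le_ringSq_of_three_le {y : Euc d} (hy : 3 ≤ ‖y‖) : 1 ≤ ringSq (S.toFun y) := by
  apply ringSq_of_norm_ge
  rw [S.eq_translation y (by linarith)]
  have h := norm_sub_norm_le y (-EuclideanSpace.single 1 (1 : ℝ))
  rw [sub_neg_eq_add, norm_neg, PiLp.norm_single] at h
  norm_num at h
  linarith

/-- Outer end: the straightening is a translation by a unit vector there, and its image has norm at
least 2, outside the region where the model is modified. -/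
theorem levelForm_of_three_le {k : ℕ} {x : Euc d} (h : 3 ≤ ‖S.coords k x‖) (u v : Euc d) :
    S.levelForm k x u v = S.scale k ^ 2 * inner ℝ (S.coords k u) (S.coords k v) := by
  have h1 : 1 / 16 ≤ ringSq (S.ringCoords k x) :=
    le_trans (by norm_num) (S.one_le_ringSq_of_three_le h)
  rw [levelForm_apply, ringForm_of_ge _ h1, fderiv_ringCoords, fderiv_ringCoords,
    S.fderiv_of_one_lt (by linarith), S.fderiv_of_one_lt (by linarith)]

theorem norm_coords_succ_lt_rad {k : ℕ} {x : Euc d} (h : ‖S.coords k x‖ < 4) :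
    ‖S.coords (k + 1) x‖ < S.rad := by
  have h1 := S.norm_coords_succ_le k x
  have h2 := S.ratio_lt_rad
  have h3 := S.ratio_pos
  nlinarith

/-- The inserted ball occupies only half the radius of the flat tube. The remaining shell is where
`tubeBump` makes its transition. -/
theorem tubeSq_coords_succ_le {k : ℕ} {x : Euc d} (h : ‖S.coords k x‖ < 4) :
    tubeSq (S.coords (k + 1) x) ≤ tubeRad (k + 1) ^ 2 / 4 := by
  rw [coords_succ, tubeSq_scl]
  have h1 : tubeSq (S.coords k x) ≤ 16 := by
    unfold tubeSq; nlinarith [norm_nonneg (S.coords k x), sq_nonneg (S.coords k x 0)]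
  have h2 := circleLen_le d (k + 1)
  have h3 := S.ratio_le
  have h4 := circleLen_pos d (k + 1)
  have h5 := S.ratio_pos
  have h6 : S.ratio * circleLen d (k + 1) ≤ 1 / 8 * tubeRad (k + 1) := by gcongr
  calc (S.ratio * circleLen d (k + 1)) ^ 2 * tubeSq (S.coords k x)
      ≤ (1 / 8 * tubeRad (k + 1)) ^ 2 * 16 := by
        gcongr
        exact tubeSq_nonneg _
    _ = _ := by ring

/-- Inner core: the factor `circleLen` on the angular direction is compensated by the unequal
entries of the scaling from `coords k` to `coords (k + 1)`, so the metric is round and coincides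
with the outer end of level k. -/
theorem levelForm_succ_of_lt {k : ℕ} {x : Euc d} (h : ‖S.coords k x‖ < 4) (u v : Euc d) :
    S.levelForm (k + 1) x u v = S.scale k ^ 2 * inner ℝ (S.coords k u) (S.coords k v) := by
  have hrad := S.norm_coords_succ_lt_rad h
  have ht := S.tubeSq_coords_succ_le h
  have hr0 := tubeRad_pos (k + 1)
  have hr1 := tubeRad_le (k + 1)
  rw [levelForm_apply, fderiv_ringCoords, fderiv_ringCoords, ringCoords,
    S.fderiv_of_lt_rad hrad, S.eq_ringParam _ hrad, ringForm_ringParam (by nlinarith),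
    circleProfile_of_le _ hr0 (by nlinarith), ← circleLen, coords_succ, coords_succ,
    inner_scl_scl, scl_apply_zero, scl_apply_zero, ← S.scale_succ_mul k]
  ring

theorem scale_sq_mul_le_succ (k : ℕ) (u : Euc d) :
    S.scale k ^ 2 * ‖S.coords k u‖ ^ 2 ≤ S.scale (k + 1) ^ 2 * ‖S.coords (k + 1) u‖ ^ 2 := by
  rw [coords_succ, ← real_inner_self_eq_norm_sq (scl _ _ _), inner_scl_scl,
    real_inner_self_eq_norm_sq, ← S.scale_succ_mul k]
  have h1 := S.ratio_pos
  have h2 := circleLen_pos d (k + 1)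
  have h3 : circleLen d (k + 1) ≤ 1 := by
    have := circleLen_le d (k + 1); have := tubeRad_le (k + 1); linarith
  have h4 : 0 ≤ S.ratio ^ 2 - (S.ratio * circleLen d (k + 1)) ^ 2 := by
    rw [mul_pow]
    have : circleLen d (k + 1) ^ 2 ≤ 1 := by nlinarith
    nlinarith [sq_nonneg S.ratio]
  have h5 := mul_nonneg (sq_nonneg (S.scale (k + 1)))
    (mul_nonneg h4 (mul_self_nonneg (S.coords k u 0)))
  nlinarith

theorem scale_sq_mul_le {j k : ℕ} (hjk : j ≤ k) (u : Euc d) :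
    S.scale j ^ 2 * ‖S.coords j u‖ ^ 2 ≤ S.scale k ^ 2 * ‖S.coords k u‖ ^ 2 := by
  induction k, hjk using Nat.le_induction with
  | base => exact le_rfl
  | succ k _ ih => exact ih.trans (S.scale_sq_mul_le_succ k u)

open Classical in
/-- The level of a point. -/
def level (x : Euc d) : ℕ := Nat.find (S.exists_norm_coords_lt x)

open Classical in
theorem norm_coords_level_lt (x : Euc d) : ‖S.coords (S.level x) x‖ < 4 :=
  Nat.find_spec (S.exists_norm_coords_lt x)

open Classical in
theorem level_le {k : ℕ} {x : Euc d} (h : ‖S.coords k x‖ < 4) : S.level x ≤ k :=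
  Nat.find_min' _ h

theorem four_le_norm_coords {k : ℕ} {x : Euc d} (h : k < S.level x) : 4 ≤ ‖S.coords k x‖ := by
  by_contra! hlt
  exact absurd (S.level_le hlt) (by omega)

/-- The metric obtained by gluing all levels. -/
def globalForm (x : Euc d) : Euc d →L[ℝ] Euc d →L[ℝ] ℝ := S.levelForm (S.level x) x

/-- Near `x` the level either stays the same or drops by exactly one. In the second case the point
lies in the shell between radii 3 and 4 of the lower level, where both levels are the same flat
metric. -/
theorem globalForm_eventuallyEq (x : Euc d) :
    S.globalForm =ᶠ[nhds x] S.levelForm (S.level x) := by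
  have hc : ∀ k, Continuous fun y ↦ ‖S.coords k y‖ := fun k ↦ (S.coords k).continuous.norm
  have h1 : ∀ᶠ y in nhds x, ‖S.coords (S.level x) y‖ < 4 :=
    (hc _).continuousAt.eventually (gt_mem_nhds (S.norm_coords_level_lt x))
  have h2 : ∀ᶠ y in nhds x, ∀ k, k + 1 = S.level x → 3 < ‖S.coords k y‖ := by
    rcases hk : S.level x with _ | k
    · exact Eventually.of_forall fun y k hk ↦ by omega
    · have h4 : 3 < ‖S.coords k x‖ :=
        lt_of_lt_of_le (by norm_num) (S.four_le_norm_coords (by omega))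
      filter_upwards [(hc k).continuousAt.eventually (lt_mem_nhds h4)] with y hy k' hk'
      obtain rfl : k' = k := by omega
      exact hy
  filter_upwards [h1, h2] with y hy1 hy2
  rcases (S.level_le hy1).eq_or_lt with he | hlt
  · rw [globalForm, he]
  · obtain ⟨k, hk⟩ : ∃ k, k + 1 = S.level x := ⟨S.level x - 1, by omega⟩
    have h3 := hy2 k hk
    have hkl : S.level y = k := by
      by_contra hne
      have := S.norm_coords_lt_of_lt (show S.level y < k by omega) (S.norm_coords_level_lt y)
      linarith
    have h4 : ‖S.coords k y‖ < 4 := hkl ▸ S.norm_coords_level_lt y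
    rw [globalForm, hkl, ← hk]
    ext u v
    rw [S.levelForm_of_three_le h3.le, S.levelForm_succ_of_lt h4]

/-- The glued metric as a smooth Riemannian metric. -/
def metric : SmoothMetric (Euc d) :=
  SmoothMetric.ofField S.globalForm
    (contDiff_iff_contDiffAt.2 fun x ↦
      (S.contDiff_levelForm _).contDiffAt.congr_of_eventuallyEq (S.globalForm_eventuallyEq x))
    (fun _ _ _ ↦ S.levelForm_symm _ _ _ _)
    (fun _ _ hu ↦ S.levelForm_self_pos _ _ hu)

theorem metric_form (x u v : Euc d) : S.metric.form x u v = S.levelForm (S.level x) x u v := rfl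

theorem metric_form_eventuallyEq (x : Euc d) :
    ∀ᶠ y in nhds x, ∀ u v, S.metric.form y u v = S.levelForm (S.level x) y u v := by
  filter_upwards [S.globalForm_eventuallyEq x] with y hy u v
  exact congrArg (fun B : Euc d →L[ℝ] Euc d →L[ℝ] ℝ ↦ B u v) hy

theorem metric_form_self_le {k : ℕ} {x : Euc d} (h : ‖S.coords k x‖ < 4) (u : Euc d) :
    S.metric.form x u u ≤ 4 * (S.scale k ^ 2 * ‖S.coords k u‖ ^ 2) := by
  rw [metric_form]
  refine (S.levelForm_self_le _ x u).trans ?_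
  gcongr 4 * ?_
  exact S.scale_sq_mul_le (S.level_le h) u

/-- At points of lower level the form of level k is flat and dominates, up to the factor 4, whatever
was inserted there. Paths in a tube can thus be measured as if nothing had been inserted. -/
theorem metric_form_self_le_levelForm {k : ℕ} {x : Euc d} (h : ‖S.coords k x‖ < 4) (u : Euc d) :
    S.metric.form x u u ≤ 4 * S.levelForm k x u u := by
  rcases (S.level_le h).eq_or_lt with he | hlt
  · rw [metric_form, he]
    linarith [S.levelForm_self_nonneg k x u]
  · obtain ⟨j, rfl⟩ : ∃ j, k = j + 1 := ⟨k - 1, by omega⟩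
    have hj := S.norm_coords_lt_of_le (show S.level x ≤ j by omega) (S.norm_coords_level_lt x)
    rw [S.levelForm_succ_of_lt hj, real_inner_self_eq_norm_sq]
    exact S.metric_form_self_le hj u

end Straightening

end Euc

end GlobalMetric

/-! ### Distance to the origin from above and below; completeness of the glued metric -/

section Distance

set_option synthInstance.maxHeartbeats 400000
set_option maxSynthPendingDepth 5

variable {d : ℕ}

namespace Euc

theorem inner_add_mul_self_pos {f : ℝ} (hf : 0 < f) {u : Euc d} (hu : u ≠ 0) :
    0 < inner ℝ u u + (f ^ 2 - 1) * (u 0 * u 0) := by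
  have h1 := tubeSq_nonneg u
  have h2 : inner ℝ u u + (f ^ 2 - 1) * (u 0 * u 0) = tubeSq u + f ^ 2 * u 0 ^ 2 := by
    rw [real_inner_self_eq_norm_sq, tubeSq]; ring
  rw [h2]
  by_cases h0 : u 0 = 0
  · have h3 : 0 < ‖u‖ ^ 2 := by positivity
    simpa [tubeSq, h0] using h3
  · positivity

theorem tubeSq_smul (t : ℝ) (y : Euc d) : tubeSq (t • y) = t ^ 2 * tubeSq y := by
  simp only [tubeSq, norm_smul, mul_pow, Real.norm_eq_abs, sq_abs, PiLp.smul_apply, smul_eq_mul]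
  ring

theorem sq_inner_sub_le (y u : Euc d) :
    (inner ℝ y u - y 0 * u 0) ^ 2 ≤ tubeSq y * tubeSq u := by
  have h1 := real_inner_mul_inner_self_le (scl 0 1 y) (scl 0 1 u)
  simp only [inner_scl_scl] at h1
  simp only [tubeSq, ← real_inner_self_eq_norm_sq]
  linarith

theorem fderiv_tubeSq (y u : Euc d) :
    fderiv ℝ tubeSq y u = 2 * (inner ℝ y u - y 0 * u 0) := by
  have h1 : HasFDerivAt (fun y : Euc d ↦ y 0) (EuclideanSpace.proj 0 : Euc d →L[ℝ] ℝ) y :=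
    (EuclideanSpace.proj 0 : Euc d →L[ℝ] ℝ).hasFDerivAt
  have h2 := ((hasStrictFDerivAt_norm_sq y).hasFDerivAt.sub (h1.pow 2)).fderiv
  refine (congrArg (fun L : Euc d →L[ℝ] ℝ ↦ L u) h2).trans ?_
  simp
  ring

/-- A smooth function equal to `0` for `s ≤ 1 / 4` and to `1` for `1 ≤ s`. -/
def stepProfile (s : ℝ) : ℝ := Real.smoothTransition ((s - 1 / 4) * (4 / 3))

theorem contDiff_stepProfile : ContDiff ℝ ∞ stepProfile :=
  Real.smoothTransition.contDiff.comp (by fun_prop)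

theorem stepProfile_of_le {s : ℝ} (hs : s ≤ 1 / 4) : stepProfile s = 0 :=
  Real.smoothTransition.zero_of_nonpos (by linarith)

theorem stepProfile_of_ge {s : ℝ} (hs : 1 ≤ s) : stepProfile s = 1 :=
  Real.smoothTransition.one_of_one_le (by linarith)

theorem stepProfile_nonneg (s : ℝ) : 0 ≤ stepProfile s := Real.smoothTransition.nonneg _

theorem stepProfile_le_one (s : ℝ) : stepProfile s ≤ 1 := Real.smoothTransition.le_one _

theorem exists_deriv_stepProfile_bound :
    ∃ A : ℝ, 0 < A ∧ ∀ s ∈ Set.Icc (0 : ℝ) 1, |deriv stepProfile s| ≤ A := by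
  obtain ⟨A, hA⟩ := (isCompact_Icc (a := (0 : ℝ)) (b := 1)).exists_bound_of_continuousOn
    (contDiff_stepProfile.continuous_deriv (by simp)).continuousOn
  exact ⟨max A 1, by positivity, fun s hs ↦ (hA s hs).trans (le_max_left _ _)⟩

namespace Straightening

variable (S : Straightening d)

theorem pow_le_scale (k : ℕ) : 8 ^ k ≤ S.scale k := by
  induction k with
  | zero => simp [scale]
  | succ k ih =>
    have h1 := S.ratio_pos
    have h2 := S.ratio_le
    have h3 := circleLen_pos d (k + 1)
    have h4 := circleLen_le d (k + 1)
    have h5 := tubeRad_le (k + 1)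
    simp only [scale]
    rw [le_div_iff₀ (by positivity)]
    have h6 : S.ratio * circleLen d (k + 1) ≤ 1 / 8 := by nlinarith
    calc (8 : ℝ) ^ (k + 1) * (S.ratio * circleLen d (k + 1)) ≤ 8 ^ (k + 1) * (1 / 8) := by gcongr
      _ = 8 ^ k := by rw [pow_succ]; ring
      _ ≤ _ := ih

theorem pow_le_scale_mul_tubeRad (k : ℕ) : 8 ^ k / 32 ≤ S.scale k * tubeRad k := by
  cases k with
  | zero => norm_num [scale, tubeRad]
  | succ k =>
    have h1 := S.ratio_pos
    have h2 := S.ratio_le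
    have h3 := circleLen_pos d (k + 1)
    have h4 := circleLen_le d (k + 1)
    have h5 := S.pow_le_scale k
    have h6 := S.scale_pos (k + 1)
    have h7 := tubeRad_pos (k + 1)
    have h8 := S.scale_succ_mul k
    have h9 : S.scale (k + 1) * (S.ratio * circleLen d (k + 1)) ≤
        S.scale (k + 1) * (1 / 8 * tubeRad (k + 1)) := by gcongr
    have h10 : (0 : ℝ) < 8 ^ k := by positivity
    rw [pow_succ]
    linarith

/-- The inverse of the linear coordinates of level `k`. -/
def coordsInv (k : ℕ) : Euc d →L[ℝ] Euc d := scl (S.ratio ^ k)⁻¹ (S.scale k)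

theorem coords_coordsInv (k : ℕ) (x : Euc d) : S.coords k (S.coordsInv k x) = x := by
  have := scl_scl_inv (pow_pos S.ratio_pos k).ne' (inv_pos.2 (S.scale_pos k)).ne' x
  rwa [inv_inv] at this

theorem coordsInv_coords (k : ℕ) (x : Euc d) : S.coordsInv k (S.coords k x) = x :=
  S.coords_injective k (S.coords_coordsInv k _)

/-- Tubular coordinates around the core circle of level `k`. -/
def tubeParam (k : ℕ) (y : Euc d) : Euc d := S.coordsInv k (S.inv (ringParam y))

theorem contDiff_tubeParam (k : ℕ) : ContDiff ℝ ∞ (S.tubeParam k) :=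
  (S.coordsInv k).contDiff.comp (S.contDiff_inv.comp contDiff_ringParam)

theorem ringCoords_tubeParam (k : ℕ) (y : Euc d) :
    S.ringCoords k (S.tubeParam k y) = ringParam y := by
  rw [ringCoords, tubeParam, coords_coordsInv, S.right_inv]

theorem toFun_zero : S.toFun 0 = ringParam 0 := S.eq_ringParam 0 (by simpa using S.rad_pos)

theorem tubeParam_zero (k : ℕ) : S.tubeParam k 0 = 0 := by
  rw [tubeParam, ← S.toFun_zero, S.left_inv, map_zero]

theorem exists_tubeParam_eq {k : ℕ} {x : Euc d} (h : ringSq (S.ringCoords k x) < 1 / 16) :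
    ∃ y : Euc d, |y 0| ≤ Real.pi ∧ tubeSq y = ringSq (S.ringCoords k x) ∧ S.tubeParam k y = x := by
  obtain ⟨y, h1, h2, h3⟩ := exists_ringParam_eq h
  refine ⟨y, h1, h2, ?_⟩
  rw [tubeParam, h3, ringCoords, S.left_inv, coordsInv_coords]

theorem fderiv_ringCoords_tubeParam (k : ℕ) (y u : Euc d) :
    fderiv ℝ (S.ringCoords k) (S.tubeParam k y) (fderiv ℝ (S.tubeParam k) y u) =
      fderiv ℝ ringParam y u := by
  have h : ringParam = S.ringCoords k ∘ S.tubeParam k :=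
    funext fun y ↦ (S.ringCoords_tubeParam k y).symm
  rw [h, fderiv_comp y ((S.contDiff_ringCoords k).differentiable (by simp) _)
    ((S.contDiff_tubeParam k).differentiable (by simp) _)]
  rfl

theorem levelForm_tubeParam (k : ℕ) {y : Euc d} (hy : tubeSq y ≤ 1 / 64) (u v : Euc d) :
    S.levelForm k (S.tubeParam k y) (fderiv ℝ (S.tubeParam k) y u)
      (fderiv ℝ (S.tubeParam k) y v) = S.scale k ^ 2 *
        (inner ℝ u v + (circleProfile (d + 2) (tubeRad k) (tubeSq y) ^ 2 - 1) * (u 0 * v 0)) := by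
  rw [levelForm_apply, fderiv_ringCoords_tubeParam, fderiv_ringCoords_tubeParam,
    ringCoords_tubeParam, ringForm_ringParam hy]

theorem injective_fderiv_tubeParam (k : ℕ) {y : Euc d} (hy : tubeSq y ≤ 1 / 64) :
    Function.Injective (fderiv ℝ (S.tubeParam k) y) := by
  rw [injective_iff_map_eq_zero]
  intro u hu
  by_contra hne
  have h1 := S.levelForm_tubeParam k hy u u
  have h2 := inner_add_mul_self_pos (circleProfile_pos (d + 2) (tubeRad_pos k) (tubeSq y)) hne
  rw [hu] at h1
  have h3 := mul_pos (pow_pos (S.scale_pos k) 2) h2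
  simp only [map_zero] at h1
  linarith

theorem surjective_fderiv_tubeParam (k : ℕ) {y : Euc d} (hy : tubeSq y ≤ 1 / 64) :
    Function.Surjective (fderiv ℝ (S.tubeParam k) y) :=
  (LinearMap.injective_iff_surjective
    (f := (fderiv ℝ (S.tubeParam k) y : Euc d →ₗ[ℝ] Euc d))).1 (S.injective_fderiv_tubeParam k hy)

theorem norm_coords_lt_three {k : ℕ} {x : Euc d} (h : ringSq (S.ringCoords k x) < 1) :
    ‖S.coords k x‖ < 3 := by
  by_contra! h3
  exact absurd (S.one_le_ringSq_of_three_le h3) (not_le.2 h)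

theorem edist_zero_le_of_norm_coords_lt {k : ℕ} {x : Euc d} (h : ‖S.coords k x‖ < 4) :
    S.metric.edist 0 x ≤ ENNReal.ofReal (8 * S.scale k) := by
  let γ : ℝ → Euc d := fun t ↦ t • x
  have hγ : ContDiff ℝ 1 γ := by fun_prop
  have hd : ∀ t, deriv γ t = x := by
    intro t
    have : HasDerivAt γ ((1 : ℝ) • x) t := (hasDerivAt_id t).smul_const x
    simpa using this.deriv
  have hT := S.scale_pos k
  have := S.metric.edist_le_of_path hγ (c := 8 * S.scale k) (fun t ht ↦ by
    rw [hd]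
    have h1 : ‖S.coords k (γ t)‖ < 4 := by
      simp only [γ, map_smul, norm_smul, Real.norm_of_nonneg ht.1]
      nlinarith [ht.2, norm_nonneg (S.coords k x)]
    refine (S.metric_form_self_le h1 x).trans ?_
    calc 4 * (S.scale k ^ 2 * ‖S.coords k x‖ ^ 2) ≤ 4 * (S.scale k ^ 2 * 4 ^ 2) := by gcongr
      _ = _ := by ring) (by positivity)
  simpa [γ] using this

/-- The path is the segment t • y in tubular coordinates. The angle is at most π < 4 and the circle
factor at most ε + √s, so the squared speed is at most 4 · 17 ≤ 100 times (T (ε + √s))². -/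
theorem edist_zero_le_of_ringSq_lt {k : ℕ} {x : Euc d}
    (h : ringSq (S.ringCoords k x) < 1 / 64) :
    S.metric.edist 0 x ≤
      ENNReal.ofReal (10 * (S.scale k * (tubeRad k + √(ringSq (S.ringCoords k x))))) := by
  obtain ⟨y, hy0, hyt, rfl⟩ := S.exists_tubeParam_eq (h.trans (by norm_num))
  rw [← hyt] at h ⊢
  have hT := S.scale_pos k
  have hε := tubeRad_pos k
  have hε' := tubeRad_le k
  have hs0 := tubeSq_nonneg y
  set q := √(tubeSq y) with hq
  have hq0 : 0 ≤ q := Real.sqrt_nonneg _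
  have hq2 : q ^ 2 = tubeSq y := Real.sq_sqrt hs0
  have hq1 : q ≤ 1 / 8 := by nlinarith
  let γ : ℝ → Euc d := fun t ↦ S.tubeParam k (t • y)
  have hγ : ContDiff ℝ 1 γ :=
    ((S.contDiff_tubeParam k).of_le (by simp)).comp (by fun_prop : ContDiff ℝ 1 fun t : ℝ ↦ t • y)
  have hd : ∀ t, deriv γ t = fderiv ℝ (S.tubeParam k) (t • y) y := by
    intro t
    have h1 : HasDerivAt (fun t : ℝ ↦ t • y) ((1 : ℝ) • y) t := (hasDerivAt_id t).smul_const y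
    rw [one_smul] at h1
    exact (((S.contDiff_tubeParam k).differentiable (by simp) _).hasFDerivAt.comp_hasDerivAt t
      h1).deriv
  have := S.metric.edist_le_of_path hγ (c := 10 * (S.scale k * (tubeRad k + q))) (fun t ht ↦ by
    rw [hd]
    have ht2 : t ^ 2 ≤ 1 := by nlinarith [ht.1, ht.2]
    have h1 : tubeSq (t • y) ≤ tubeSq y := by
      rw [tubeSq_smul]; exact mul_le_of_le_one_left hs0 ht2
    have h1' := tubeSq_nonneg (t • y)
    have h2 : ‖S.coords k (γ t)‖ < 4 := by
      refine (S.norm_coords_lt_three ?_).trans (by norm_num)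
      rw [ringCoords_tubeParam, ringSq_ringParam (by linarith)]; linarith
    refine (S.metric_form_self_le_levelForm h2 _).trans ?_
    rw [S.levelForm_tubeParam k (by linarith)]
    set f := circleProfile (d + 2) (tubeRad k) (tubeSq (t • y)) with hf
    have hf0 : 0 < f := circleProfile_pos _ hε _
    have hf1 : f ≤ tubeRad k ^ 2 + tubeSq (t • y) :=
      circleProfile_le (by simp) hε h1' (by nlinarith)
    have hf2 : f ≤ tubeRad k + q := by nlinarith
    have hy2 : y 0 ^ 2 ≤ 16 := by
      have := Real.pi_le_four
      have h3 : |y 0| ≤ 4 := by linarith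
      have h4 := abs_nonneg (y 0)
      rw [← sq_abs]; nlinarith
    have e : inner ℝ y y + (f ^ 2 - 1) * (y 0 * y 0) = q ^ 2 + f ^ 2 * y 0 ^ 2 := by
      rw [real_inner_self_eq_norm_sq, hq2, tubeSq]; ring
    rw [e]
    have h5 : f ^ 2 * y 0 ^ 2 ≤ (tubeRad k + q) ^ 2 * 16 := by gcongr
    have h6 : q ^ 2 ≤ (tubeRad k + q) ^ 2 := by gcongr; linarith
    have h7 : 0 ≤ S.scale k ^ 2 := sq_nonneg _
    have h8 : S.scale k ^ 2 * (q ^ 2 + f ^ 2 * y 0 ^ 2) ≤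
        S.scale k ^ 2 * (25 * (tubeRad k + q) ^ 2) := by
      gcongr; nlinarith [sq_nonneg (tubeRad k + q)]
    nlinarith) (by positivity)
  simpa [γ, tubeParam_zero] using this

theorem ringSq_ringCoords_le_of_level_lt {k : ℕ} {x : Euc d} (h : S.level x < k) :
    ringSq (S.ringCoords k x) ≤ tubeRad k ^ 2 / 4 := by
  obtain ⟨j, rfl⟩ : ∃ j, k = j + 1 := ⟨k - 1, by omega⟩
  have hj := S.norm_coords_lt_of_le (show S.level x ≤ j by omega) (S.norm_coords_level_lt x)
  have h1 := S.tubeSq_coords_succ_le hj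
  have h2 := tubeRad_le (j + 1)
  have h3 := tubeRad_pos (j + 1)
  rw [ringCoords, S.eq_ringParam _ (S.norm_coords_succ_lt_rad hj),
    ringSq_ringParam (by nlinarith)]
  exact h1

/-- A function that separates the origin from the exterior of the tube of level `k`. -/
def tubeBump (k : ℕ) (x : Euc d) : ℝ :=
  S.scale k * tubeRad k * stepProfile (ringSq (S.ringCoords k x) / tubeRad k ^ 2)

theorem contDiff_tubeBump (k : ℕ) : ContDiff ℝ ∞ (S.tubeBump k) := by
  have hε := tubeRad_pos k
  have hε' := tubeRad_le k
  rw [contDiff_iff_contDiffAt]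
  intro x
  by_cases h : radius (S.ringCoords k x) = 0
  · have h1 : 1 / 2 < ringSq (S.ringCoords k x) := by
      have := sq_le_ringSq (S.ringCoords k x)
      rw [h] at this; norm_num at this ⊢; linarith
    have h2 : S.tubeBump k =ᶠ[nhds x] fun _ ↦ S.scale k * tubeRad k * 1 := by
      filter_upwards [(continuous_ringSq.comp
        (S.contDiff_ringCoords k).continuous).continuousAt.eventually (lt_mem_nhds h1)] with z hz
      rw [tubeBump, stepProfile_of_ge]
      rw [le_div_iff₀ (by positivity)]
      simp only [Function.comp_apply] at hz
      nlinarith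
    exact contDiffAt_const.congr_of_eventuallyEq h2
  · exact contDiffAt_const.mul (contDiff_stepProfile.contDiffAt.comp x
      (((contDiffAt_ringSq h).comp x (S.contDiff_ringCoords k).contDiffAt).div_const _))

theorem tubeBump_nonneg (k : ℕ) (x : Euc d) : 0 ≤ S.tubeBump k x :=
  mul_nonneg (mul_pos (S.scale_pos k) (tubeRad_pos k)).le (stepProfile_nonneg _)

theorem tubeBump_le (k : ℕ) (x : Euc d) : S.tubeBump k x ≤ S.scale k * tubeRad k :=
  mul_le_of_le_one_right (mul_pos (S.scale_pos k) (tubeRad_pos k)).le (stepProfile_le_one _)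

theorem tubeBump_of_le {k : ℕ} {x : Euc d} (h : ringSq (S.ringCoords k x) ≤ tubeRad k ^ 2 / 4) :
    S.tubeBump k x = 0 := by
  have hε := tubeRad_pos k
  rw [tubeBump, stepProfile_of_le, mul_zero]
  rw [div_le_iff₀ (by positivity)]; linarith

theorem tubeBump_of_ge {k : ℕ} {x : Euc d} (h : tubeRad k ^ 2 ≤ ringSq (S.ringCoords k x)) :
    S.tubeBump k x = S.scale k * tubeRad k := by
  have hε := tubeRad_pos k
  rw [tubeBump, stepProfile_of_ge, mul_one]
  rw [le_div_iff₀ (by positivity)]; linarith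

theorem fderiv_tubeBump_sq_le {A : ℝ} (hA : ∀ s ∈ Set.Icc (0 : ℝ) 1, |deriv stepProfile s| ≤ A)
    (k : ℕ) (x u : Euc d) :
    (fderiv ℝ (S.tubeBump k) x u) ^ 2 ≤ (2 * A) ^ 2 * S.metric.form x u u := by
  have hε := tubeRad_pos k
  have hε' := tubeRad_le k
  have hT := S.scale_pos k
  have h0 : fderiv ℝ (S.tubeBump k) x = 0 →
      (fderiv ℝ (S.tubeBump k) x u) ^ 2 ≤ (2 * A) ^ 2 * S.metric.form x u u := by
    intro h
    rw [h]
    simpa using mul_nonneg (sq_nonneg (2 * A)) (S.metric.form_self_nonneg x u)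
  rcases le_or_gt (ringSq (S.ringCoords k x)) (tubeRad k ^ 2 / 4) with h1 | h1
  -- Where the bump takes its least or greatest value its derivative vanishes, so inserted levels
  -- never have to be examined.
  · refine h0 (IsLocalMin.fderiv_eq_zero (Eventually.of_forall fun z ↦ ?_))
    rw [S.tubeBump_of_le h1]; exact S.tubeBump_nonneg k z
  rcases le_or_gt (tubeRad k ^ 2) (ringSq (S.ringCoords k x)) with h2 | h2
  · refine h0 (IsLocalMax.fderiv_eq_zero (Eventually.of_forall fun z ↦ ?_))
    rw [S.tubeBump_of_ge h2]; exact S.tubeBump_le k z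
  have hε2 : tubeRad k ^ 2 < 1 / 64 := by nlinarith
  -- In the transition shell the metric is that of level k itself, since lower levels stay within
  -- `tubeRad k ^ 2 / 4`.
  have hlev : S.level x = k := by
    refine le_antisymm (S.level_le ((S.norm_coords_lt_three (by linarith)).trans (by norm_num))) ?_
    by_contra! hlt
    exact absurd (S.ringSq_ringCoords_le_of_level_lt hlt) (not_le.2 h1)
  rw [metric_form, hlev]
  obtain ⟨y, -, hyt, rfl⟩ := S.exists_tubeParam_eq (h2.trans (hε2.trans (by norm_num)))
  rw [← hyt] at h1 h2
  obtain ⟨u, rfl⟩ := S.surjective_fderiv_tubeParam k (by linarith : tubeSq y ≤ 1 / 64) u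
  rw [S.levelForm_tubeParam k (by linarith)]
  have e1 : fderiv ℝ (S.tubeBump k) (S.tubeParam k y) (fderiv ℝ (S.tubeParam k) y u) =
      fderiv ℝ (S.tubeBump k ∘ S.tubeParam k) y u := by
    rw [fderiv_comp y ((S.contDiff_tubeBump k).differentiable (by simp) _)
      ((S.contDiff_tubeParam k).differentiable (by simp) _)]
    rfl
  have e2 : S.tubeBump k ∘ S.tubeParam k =ᶠ[nhds y]
      fun z ↦ S.scale k * tubeRad k * stepProfile (tubeSq z / tubeRad k ^ 2) := by
    filter_upwards [contDiff_tubeSq.continuous.continuousAt.eventually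
      (gt_mem_nhds (show tubeSq y < 1 by linarith))] with z hz
    rw [Function.comp_apply, tubeBump, ringCoords_tubeParam, ringSq_ringParam hz.le]
  have e3 : fderiv ℝ (fun z ↦ S.scale k * tubeRad k * stepProfile (tubeSq z / tubeRad k ^ 2)) y u
      = S.scale k * tubeRad k * (deriv stepProfile (tubeSq y / tubeRad k ^ 2) *
        (2 * (inner ℝ y u - y 0 * u 0) / tubeRad k ^ 2)) := by
    have hτ : HasDerivAt stepProfile (deriv stepProfile (tubeSq y / tubeRad k ^ 2))
        (tubeSq y / tubeRad k ^ 2) :=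
      (contDiff_stepProfile.differentiable (by simp) _).hasDerivAt
    have hs : HasFDerivAt (fun z : Euc d ↦ tubeSq z / tubeRad k ^ 2)
        ((tubeRad k ^ 2)⁻¹ • fderiv ℝ tubeSq y) y := by
      simpa only [div_eq_mul_inv] using
        (contDiff_tubeSq.differentiable (by simp) y).hasFDerivAt.mul_const ((tubeRad k ^ 2)⁻¹)
    have h := ((hτ.comp_hasFDerivAt y hs).const_mul (S.scale k * tubeRad k)).fderiv
    refine (congrArg (fun L : Euc d →L[ℝ] ℝ ↦ L u) h).trans ?_
    simp only [smul_apply, smul_eq_mul, fderiv_tubeSq]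
    ring
  rw [e1, e2.fderiv_eq, e3]
  set s := tubeSq y / tubeRad k ^ 2 with hs
  have hs0 : 0 ≤ s := div_nonneg (tubeSq_nonneg y) (sq_nonneg _)
  have hs1 : s ≤ 1 := by rw [hs, div_le_one (by positivity)]; exact h2.le
  have hD : deriv stepProfile s ^ 2 ≤ A ^ 2 := by
    have := hA s ⟨hs0, hs1⟩
    rw [← sq_abs]; gcongr
  have hCS := sq_inner_sub_le y u
  have hu0 := tubeSq_nonneg u
  -- The bump depends only on the distance to the core, so Cauchy–Schwarz in the directions other
  -- than y₀ suffices and the small circle factor plays no role.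
  have hCS' : (inner ℝ y u - y 0 * u 0) ^ 2 ≤ tubeRad k ^ 2 * tubeSq u :=
    hCS.trans (by gcongr)
  set p := inner ℝ y u - y 0 * u 0 with hp
  have e4 : inner ℝ u u + (circleProfile (d + 2) (tubeRad k) (tubeSq y) ^ 2 - 1) * (u 0 * u 0)
      = tubeSq u + circleProfile (d + 2) (tubeRad k) (tubeSq y) ^ 2 * u 0 ^ 2 := by
    rw [real_inner_self_eq_norm_sq]; simp only [tubeSq]; ring
  rw [e4]
  calc (S.scale k * tubeRad k * (deriv stepProfile s * (2 * p / tubeRad k ^ 2))) ^ 2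
      = 4 * S.scale k ^ 2 * (deriv stepProfile s ^ 2 * (p ^ 2 / tubeRad k ^ 2)) := by
        field_simp
        ring
    _ ≤ 4 * S.scale k ^ 2 * (A ^ 2 * tubeSq u) := by
        gcongr
        rw [div_le_iff₀ (by positivity)]; linarith
    _ = (2 * A) ^ 2 * (S.scale k ^ 2 * tubeSq u) := by ring
    _ ≤ _ := by
        gcongr
        have : 0 ≤ circleProfile (d + 2) (tubeRad k) (tubeSq y) ^ 2 * u 0 ^ 2 := by positivity
        linarith

/-- Metric balls around the origin are contained in the tubes of comparable radius. -/
theorem exists_ball_subset_tube : ∃ c : ℝ, 0 < c ∧ ∀ k,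
    S.metric.ball 0 (c * (S.scale k * tubeRad k)) ⊆
      {x | ringSq (S.ringCoords k x) < tubeRad k ^ 2} := by
  obtain ⟨A, hA0, hA⟩ := exists_deriv_stepProfile_bound
  refine ⟨(2 * A)⁻¹, by positivity, fun k x hx ↦ ?_⟩
  have hε := tubeRad_pos k
  have hT := S.scale_pos k
  by_contra hge
  simp only [Set.mem_ofPred_eq, not_lt] at hge
  have h := S.metric.ofReal_abs_sub_le_edist ((S.contDiff_tubeBump k).of_le (by simp))
    (by positivity : 0 ≤ 2 * A) (S.fderiv_tubeBump_sq_le hA k) 0 x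
  have h0 : S.tubeBump k 0 = 0 := by
    apply S.tubeBump_of_le
    have h1 : S.ringCoords k 0 = ringParam 0 := by rw [ringCoords, map_zero, S.toFun_zero]
    have h2 : tubeSq (0 : Euc d) = 0 := by simp [tubeSq]
    rw [h1, ringSq_ringParam (by rw [h2]; norm_num), h2]
    positivity
  rw [h0, S.tubeBump_of_ge hge, sub_zero, abs_of_pos (by positivity)] at h
  have h3 : ENNReal.ofReal (2 * A) * S.metric.edist 0 x <
      ENNReal.ofReal (2 * A) * ENNReal.ofReal ((2 * A)⁻¹ * (S.scale k * tubeRad k)) :=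
    ENNReal.mul_lt_mul_right (by simpa using hA0) ENNReal.ofReal_ne_top hx
  rw [← ENNReal.ofReal_mul (by positivity), mul_inv_cancel_left₀ (by positivity)] at h3
  exact absurd (h.trans_lt h3) (lt_irrefl _)

theorem isCompact_norm_coords_le (k : ℕ) (r : ℝ) : IsCompact {x | ‖S.coords k x‖ ≤ r} := by
  have h : {x | ‖S.coords k x‖ ≤ r} = S.coordsInv k '' Metric.closedBall 0 r := by
    ext x
    constructor
    · intro hx
      exact ⟨S.coords k x, by simpa using hx, S.coordsInv_coords k x⟩
    · rintro ⟨y, hy, rfl⟩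
      simpa [coords_coordsInv] using hy
  rw [h]
  exact (isCompact_closedBall 0 r).image (S.coordsInv k).continuous

theorem metric_isComplete : S.metric.IsComplete := by
  obtain ⟨c, hc, hsub⟩ := S.exists_ball_subset_tube
  refine S.metric.isComplete_of_ball_subset_compact 0 fun r ↦ ?_
  obtain ⟨k, hk⟩ := pow_unbounded_of_one_lt (32 * r / c) (by norm_num : (1 : ℝ) < 8)
  refine ⟨{x | ‖S.coords k x‖ ≤ 3}, S.isCompact_norm_coords_le k 3, fun x hx ↦ ?_⟩
  have h1 := S.pow_le_scale_mul_tubeRad k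
  have h2 : r ≤ c * (S.scale k * tubeRad k) := by
    rw [div_lt_iff₀ hc] at hk
    nlinarith
  have h3 := hsub k (show x ∈ _ from lt_of_lt_of_le hx (ENNReal.ofReal_le_ofReal h2))
  have hε := tubeRad_pos k
  have hε' := tubeRad_le k
  exact (S.norm_coords_lt_three (lt_of_lt_of_le h3 (by nlinarith))).le

end Straightening

end Euc

end Distance

/-! ### Quadratic curvature decay -/

section CurvatureDecay

set_option synthInstance.maxHeartbeats 400000
set_option maxSynthPendingDepth 5

variable {d : ℕ}

namespace Euc

theorem linearIndependent_of_map_pair {L : Euc d →L[ℝ] Euc d} {u v : Euc d}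
    (h : LinearIndependent ℝ ![L u, L v]) : LinearIndependent ℝ ![u, v] := by
  rw [LinearIndependent.pair_iff] at h ⊢
  intro s t hst
  apply h s t
  rw [← map_smul, ← map_smul, ← map_add, hst, map_zero]

/-- The model metric outside the collapsing tubes. -/
def ringMetric (d : ℕ) : SmoothMetric (Euc d) :=
  SmoothMetric.ofField (ringForm (1 / 32)) (contDiff_ringForm _) (ringForm_symm _)
    (fun m _ hu ↦ ringForm_self_pos (by norm_num) le_rfl m hu)

theorem ringMetric_form (m u v : Euc d) :
    (ringMetric d).form m u v = ringForm (1 / 32) m u v := rfl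

namespace Straightening

variable (S : Straightening d)

/-- Scaling the radius by ε and the angle by ε/η absorbs both parameters, so the tubes of all levels
are locally homothetic, with factor T ε, to the single `warpedMetric`. -/
theorem metric_form_tubeParam_scl {k : ℕ} {w : Euc d}
    (hw : tubeRad k ^ 2 * tubeSq w < 1 / 64) :
    let A := scl (tubeRad k / circleLen d k) (tubeRad k)
    S.level (S.tubeParam k (A w)) = k →
    ∀ᶠ z in nhds w, ∀ u v, S.metric.form (S.tubeParam k (A z))
      (fderiv ℝ (fun z ↦ S.tubeParam k (A z)) z u) (fderiv ℝ (fun z ↦ S.tubeParam k (A z)) z v) =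
        (S.scale k * tubeRad k) ^ 2 * (warpedMetric d).form z u v := by
  intro A hlev
  have hε := tubeRad_pos k
  have hη := circleLen_pos d k
  have hc : Continuous fun z ↦ S.tubeParam k (A z) :=
    (S.contDiff_tubeParam k).continuous.comp A.continuous
  have h1 := hc.continuousAt.eventually (S.metric_form_eventuallyEq (S.tubeParam k (A w)))
  have h2 : ∀ᶠ z : Euc d in nhds w, tubeRad k ^ 2 * tubeSq z < 1 / 64 :=
    (continuous_const.mul contDiff_tubeSq.continuous).continuousAt.eventually (gt_mem_nhds hw)
  filter_upwards [h1, h2] with z hz1 hz2 u v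
  have hD : ∀ u, fderiv ℝ (fun z ↦ S.tubeParam k (A z)) z u =
      fderiv ℝ (S.tubeParam k) (A z) (A u) := by
    intro u
    have h := (((S.contDiff_tubeParam k).differentiable (by simp) (A z)).hasFDerivAt.comp z
      A.hasFDerivAt).fderiv
    exact congrArg (fun L : Euc d →L[ℝ] Euc d ↦ L u) h
  have ht : tubeSq (A z) = tubeRad k ^ 2 * tubeSq z := tubeSq_scl _ _ z
  have hf : circleProfile (d + 2) (tubeRad k) (tubeSq (A z)) =
      circleLen d k * powerProfile (d + 2) (tubeSq z) := by
    rw [ht, circleProfile, circleLen, mul_div_cancel_left₀ _ (by positivity)]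
  rw [hz1, hlev, hD, hD, S.levelForm_tubeParam k (by rw [ht]; exact hz2.le), hf,
    warpedMetric_form, inner_scl_scl, scl_apply_zero, scl_apply_zero]
  field_simp
  ring

theorem exists_curvature_bound_of_ringSq_lt (d : ℕ) : ∃ C : ℝ, 0 < C ∧
    ∀ (S : Straightening d) (x : Euc d),
      ringSq (S.ringCoords (S.level x) x) < 1 / 64 → ∀ u v : Euc d, LinearIndependent ℝ ![u, v] →
        |S.metric.sectionalCurvature x u v| ≤ C / (S.scale (S.level x) ^ 2 *
          (tubeRad (S.level x) ^ 2 + ringSq (S.ringCoords (S.level x) x))) := by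
  obtain ⟨C, hC, hbound⟩ := exists_warpedMetric_curvature_bound d
  refine ⟨C, hC, fun S x ↦ ?_⟩
  generalize hlev : S.level x = k
  intro hx u v huv
  have hε := tubeRad_pos k
  have hη := circleLen_pos d k
  have hT := S.scale_pos k
  obtain ⟨y, -, hyt, hyx⟩ := S.exists_tubeParam_eq (hx.trans (by norm_num))
  rw [← hyt] at hx ⊢
  have ha : tubeRad k / circleLen d k ≠ 0 := by positivity
  set A : Euc d →L[ℝ] Euc d := scl (tubeRad k / circleLen d k) (tubeRad k) with hA
  obtain ⟨w, rfl⟩ : ∃ w, A w = y := ⟨_, scl_scl_inv ha hε.ne' y⟩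
  have hw : tubeSq (A w) = tubeRad k ^ 2 * tubeSq w := tubeSq_scl _ _ w
  subst hyx
  have hsurj : Function.Surjective (fderiv ℝ (fun z ↦ S.tubeParam k (A z)) w) := by
    have h := (((S.contDiff_tubeParam k).differentiable (by simp) (A w)).hasFDerivAt.comp w
      A.hasFDerivAt).fderiv
    have h' : fderiv ℝ (fun z ↦ S.tubeParam k (A z)) w =
      (fderiv ℝ (S.tubeParam k) (A w)).comp A := h
    rw [h']
    exact (S.surjective_fderiv_tubeParam k hx.le).comp
      fun y ↦ ⟨_, scl_scl_inv ha hε.ne' y⟩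
  obtain ⟨u, rfl⟩ := hsurj u
  obtain ⟨v, rfl⟩ := hsurj v
  have e := S.metric.sectionalCurvature_of_isometry (warpedMetric d)
    ((S.contDiff_tubeParam k).comp A.contDiff) (mul_pos hT hε).ne'
    (S.metric_form_tubeParam_scl (by rw [← hw]; exact hx) hlev) u v
  refine (congrArg abs e).trans_le ?_
  rw [abs_div, abs_of_pos (by positivity : 0 < (S.scale k * tubeRad k) ^ 2)]
  have h1 := hbound w u v (linearIndependent_of_map_pair huv)
  have h2 := tubeSq_nonneg w
  rw [hw]
  calc _ ≤ C / (1 + tubeSq w) / (S.scale k * tubeRad k) ^ 2 := by gcongr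
    _ = _ := by rw [div_div]; congr 1; ring

/-- Outside the tubes every level is a rescaled piece of the one metric `ringMetric` over a fixed
compact set, so one constant serves all levels. -/
theorem exists_curvature_bound_of_le_ringSq : ∃ C : ℝ, 0 < C ∧
    ∀ x : Euc d, 1 / 64 ≤ ringSq (S.ringCoords (S.level x) x) →
      ∀ u v : Euc d, LinearIndependent ℝ ![u, v] →
        |S.metric.sectionalCurvature x u v| ≤ C / S.scale (S.level x) ^ 2 := by
  obtain ⟨C, hC, hbound⟩ := (ringMetric d).exists_sectionalCurvature_bound
    ((isCompact_closedBall (0 : Euc d) 4).image S.contDiff.continuous)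
  refine ⟨C, hC, fun x hx u v huv ↦ ?_⟩
  have hT := S.scale_pos (S.level x)
  have h1 : ∀ᶠ z in nhds x, 1 / 256 < ringSq (S.ringCoords (S.level x) z) :=
    (continuous_ringSq.comp (S.contDiff_ringCoords _).continuous).continuousAt.eventually
      (lt_mem_nhds (lt_of_lt_of_le (by norm_num) hx))
  have e := (ringMetric d).sectionalCurvature_of_isometry S.metric
    (S.contDiff_ringCoords (S.level x)) (inv_ne_zero hT.ne') (x := x) (by
      filter_upwards [h1, S.metric_form_eventuallyEq x] with z hz1 hz2 u v
      rw [hz2, levelForm_apply, ringMetric_form, ringForm_eq_of_lt (by norm_num) le_rfl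
        (tubeRad_pos (S.level x)) (tubeRad_le _) hz1.le]
      field_simp) u v
  have h2 := hbound (S.ringCoords (S.level x) x)
    ⟨_, by simpa using (S.norm_coords_level_lt x).le, rfl⟩ _ _
    (linearIndependent_map_pair (S.injective_fderiv_ringCoords (S.level x) x) huv)
  rw [e, abs_div, abs_of_pos (by positivity : 0 < (S.scale (S.level x))⁻¹ ^ 2),
    div_le_iff₀ (by positivity)] at h2
  rwa [div_eq_mul_inv, ← inv_pow]

/-- The second bound is quadratic decay seen from the origin; the first is needed to move the
basepoint. -/
theorem exists_curvature_mul_bound : ∃ C : ℝ, 0 < C ∧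
    ∀ x u v : Euc d, LinearIndependent ℝ ![u, v] →
      |S.metric.sectionalCurvature x u v| ≤ C ∧
      |S.metric.sectionalCurvature x u v| * S.metric.dist 0 x ^ 2 ≤ C := by
  obtain ⟨C₁, hC₁, h₁⟩ := exists_curvature_bound_of_ringSq_lt d
  obtain ⟨C₂, hC₂, h₂⟩ := S.exists_curvature_bound_of_le_ringSq
  -- 1024 = 32² comes from T ε ≥ 1/32; the distance estimates need only the factors 200 and 64.
  refine ⟨1024 * (C₁ + C₂), by positivity, fun x u v huv ↦ ?_⟩
  have hT := S.scale_pos (S.level x)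
  have hT1 : 1 ≤ S.scale (S.level x) := le_trans (one_le_pow₀ (by norm_num)) (S.pow_le_scale _)
  have hε := tubeRad_pos (S.level x)
  have hTε : 1 / 32 ≤ S.scale (S.level x) * tubeRad (S.level x) := by
    refine le_trans ?_ (S.pow_le_scale_mul_tubeRad _)
    have : (1 : ℝ) ≤ 8 ^ S.level x := one_le_pow₀ (by norm_num)
    linarith
  have hd0 : 0 ≤ S.metric.dist 0 x := ENNReal.toReal_nonneg
  rcases lt_or_ge (ringSq (S.ringCoords (S.level x) x)) (1 / 64) with hx | hx
  · have hs := ringSq_nonneg (S.ringCoords (S.level x) x)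
    have hK := h₁ S x hx u v huv
    have hd : S.metric.dist 0 x ≤ _ :=
      ENNReal.toReal_le_of_le_ofReal (by positivity) (S.edist_zero_le_of_ringSq_lt hx)
    set T := S.scale (S.level x)
    set ε := tubeRad (S.level x)
    set s := ringSq (S.ringCoords (S.level x) x)
    have hp : 0 < T ^ 2 * (ε ^ 2 + s) := by positivity
    rw [le_div_iff₀ hp] at hK
    have hq : √s ^ 2 = s := Real.sq_sqrt hs
    have hK0 := abs_nonneg (S.metric.sectionalCurvature x u v)
    constructor
    · have h3 : 1 / 1024 ≤ T ^ 2 * (ε ^ 2 + s) := by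
        have h4 : (1 / 32) ^ 2 ≤ (T * ε) ^ 2 := by gcongr
        have h5 : 0 ≤ T ^ 2 * s := by positivity
        nlinarith
      have := mul_le_mul_of_nonneg_left h3 hK0
      linarith
    · have h3 : S.metric.dist 0 x ^ 2 ≤ 200 * (T ^ 2 * (ε ^ 2 + s)) := by
        calc S.metric.dist 0 x ^ 2 ≤ (10 * (T * (ε + √s))) ^ 2 := by gcongr
          _ = 100 * (T ^ 2 * (ε + √s) ^ 2) := by ring
          _ ≤ 100 * (T ^ 2 * (2 * (ε ^ 2 + s))) := by
            gcongr
            nlinarith [sq_nonneg (ε - √s)]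
          _ = _ := by ring
      have := mul_le_mul_of_nonneg_left h3 hK0
      linarith
  · have hK := h₂ x hx u v huv
    have hd : S.metric.dist 0 x ≤ _ := ENNReal.toReal_le_of_le_ofReal (by positivity)
      (S.edist_zero_le_of_norm_coords_lt (S.norm_coords_level_lt x))
    set T := S.scale (S.level x)
    rw [le_div_iff₀ (by positivity)] at hK
    have hK0 := abs_nonneg (S.metric.sectionalCurvature x u v)
    constructor
    · have h3 : 1 ≤ T ^ 2 := one_le_pow₀ hT1
      have := mul_le_mul_of_nonneg_left h3 hK0
      linarith
    · have h3 : S.metric.dist 0 x ^ 2 ≤ 64 * T ^ 2 := by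
        calc S.metric.dist 0 x ^ 2 ≤ (8 * T) ^ 2 := by gcongr
          _ = _ := by ring
      have := mul_le_mul_of_nonneg_left h3 hK0
      linarith

end Straightening

end Euc

/-- The Riemannian distance satisfies the triangle inequality. -/
theorem SmoothMetric.dist_triangle {E : Type*} [NormedAddCommGroup E] [NormedSpace ℝ E]
    (g : SmoothMetric E) (x y z : E) : g.dist x z ≤ g.dist x y + g.dist y z := by
  unfold SmoothMetric.dist
  rw [← ENNReal.toReal_add (g.edist_ne_top x y) (g.edist_ne_top y z)]
  exact ENNReal.toReal_mono (ENNReal.add_ne_top.2 ⟨g.edist_ne_top x y, g.edist_ne_top y z⟩)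
    (g.edist_triangle x y z)

theorem SmoothMetric.dist_pos {E : Type*} [NormedAddCommGroup E] [NormedSpace ℝ E]
    (g : SmoothMetric E) {x y : E} (h : x ≠ y) : 0 < g.dist x y := by
  refine ENNReal.toReal_pos ?_ (g.edist_ne_top x y)
  intro h0
  exact h (@EMetricSpace.eq_of_edist_eq_zero E g.emetricSpace x y h0)

theorem Euc.Straightening.hasQuadraticCurvatureDecay (S : Euc.Straightening d) (m₀ : Euc d) :
    S.metric.HasQuadraticCurvatureDecay m₀ := by
  obtain ⟨C, hC, h⟩ := S.exists_curvature_mul_bound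
  set D := S.metric.dist m₀ 0
  -- From d(m₀, m)² ≤ 2 (D² + d(0, m)²), using the uniform bound for the first summand and the decay
  -- bound for the second.
  refine ⟨2 * (D ^ 2 + 1) * C, by positivity, fun m hm u v huv ↦ ?_⟩
  obtain ⟨h1, h2⟩ := h m u v huv
  have hd := S.metric.dist_pos hm.symm
  have ht := S.metric.dist_triangle m₀ 0 m
  rw [le_div_iff₀ (by positivity)]
  have h3 : S.metric.dist m₀ m ^ 2 ≤ 2 * (D ^ 2 + S.metric.dist 0 m ^ 2) := by
    calc S.metric.dist m₀ m ^ 2 ≤ (D + S.metric.dist 0 m) ^ 2 := by gcongr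
      _ ≤ _ := by nlinarith [sq_nonneg (D - S.metric.dist 0 m)]
  have h4 := mul_le_mul_of_nonneg_left h3 (abs_nonneg (S.metric.sectionalCurvature m u v))
  have h5 := mul_le_mul_of_nonneg_right h1 (sq_nonneg D)
  linarith

end CurvatureDecay

/-! ### Volumes of the levels and of the tubes -/

section Volume

set_option synthInstance.maxHeartbeats 400000
set_option maxSynthPendingDepth 5

variable {d : ℕ}

/-- The determinant of the pullback of a rank one perturbation of the Euclidean form. -/
theorem det_pullback_rank_one {n : ℕ} (T c : ℝ)
    (L : EuclideanSpace ℝ (Fin n) →L[ℝ] EuclideanSpace ℝ (Fin n))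
    (a : EuclideanSpace ℝ (Fin n)) :
    (Matrix.of fun i j : Fin n ↦ T ^ 2 * (inner ℝ (L (EuclideanSpace.single i 1))
      (L (EuclideanSpace.single j 1)) + c * (inner ℝ a (L (EuclideanSpace.single i 1)) *
        inner ℝ a (L (EuclideanSpace.single j 1))))).det =
      (T ^ n * L.det) ^ 2 * (1 + c * ‖a‖ ^ 2) := by
  let b := (EuclideanSpace.basisFun (Fin n) ℝ).toBasis
  let A : Matrix (Fin n) (Fin n) ℝ := LinearMap.toMatrix b b (L : _ →ₗ[ℝ] _)
  have hA : ∀ i j, A i j = L (EuclideanSpace.single j 1) i := by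
    intro i j
    simp [A, b, LinearMap.toMatrix_apply]
  have hdet : A.det = L.det := LinearMap.det_toMatrix b _
  -- The Gram matrix is T² Aᵀ (1 + c a aᵀ) A, to which the matrix determinant lemma applies.
  have e : (Matrix.of fun i j : Fin n ↦ T ^ 2 * (inner ℝ (L (EuclideanSpace.single i 1))
      (L (EuclideanSpace.single j 1)) + c * (inner ℝ a (L (EuclideanSpace.single i 1)) *
        inner ℝ a (L (EuclideanSpace.single j 1))))) =
      T ^ 2 • (A.transpose * (1 + Matrix.replicateCol Unit (fun i ↦ c * a i) *
        Matrix.replicateRow Unit (fun i ↦ a i)) * A) := by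
    have hM : A.transpose * (1 + Matrix.replicateCol Unit (fun i ↦ c * a i) *
        Matrix.replicateRow Unit (fun i ↦ a i)) * A = A.transpose * A +
        (A.transpose * Matrix.replicateCol Unit (fun i ↦ c * a i)) *
          (Matrix.replicateRow Unit (fun i ↦ a i) * A) := by
      simp only [Matrix.mul_add, Matrix.add_mul, Matrix.mul_one, Matrix.mul_assoc]
    have hin : ∀ u v : EuclideanSpace ℝ (Fin n), inner ℝ u v = ∑ l, u l * v l := by
      intro u v
      rw [PiLp.inner_apply]
      exact Finset.sum_congr rfl fun l _ ↦ by simp [mul_comm]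
    rw [hM]
    ext i j
    simp only [Matrix.of_apply, Matrix.smul_apply, Matrix.add_apply, Matrix.mul_apply,
      Finset.univ_unique, Finset.sum_singleton, Matrix.replicateCol_apply,
      Matrix.replicateRow_apply, Matrix.transpose_apply, hA, hin, smul_eq_mul]
    rw [← mul_assoc c, Finset.mul_sum (a := c)]
    congr 3
    exact Finset.sum_congr rfl fun l _ ↦ by ring
  rw [e, Matrix.det_smul, Matrix.det_mul, Matrix.det_mul, Matrix.det_transpose, hdet,
    Matrix.det_one_add_replicateCol_mul_replicateRow, Fintype.card_fin]
  have h3 : (fun i ↦ a i) ⬝ᵥ (fun i ↦ c * a i) = c * ‖a‖ ^ 2 := by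
    rw [EuclideanSpace.norm_sq_eq, Finset.mul_sum]
    exact Finset.sum_congr rfl fun l _ ↦ by simp; ring
  rw [h3]
  ring

namespace Euc

/-- The vector dual to `angularForm`. -/
def angularVec (m : Euc d) : Euc d :=
  m 1 • EuclideanSpace.single 0 (1 : ℝ) - m 0 • EuclideanSpace.single 1 (1 : ℝ)

theorem inner_angularVec (m u : Euc d) : inner ℝ (angularVec m) u = angularForm m u := by
  simp only [angularVec, inner_sub_left, real_inner_smul_left, inner_single_left,
    angularForm_apply]

theorem norm_angularVec_sq (m : Euc d) : ‖angularVec m‖ ^ 2 = radius m ^ 2 := by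
  rw [← real_inner_self_eq_norm_sq, inner_angularVec, angularForm_apply, radius_sq]
  simp [angularVec]
  ring

/-- In the core the left side is η² / r², and r > 3/4 there. -/
theorem one_add_ringCoeff_mul_le {ε : ℝ} (hε : 0 < ε) {m : Euc d}
    (hε' : ε ≤ 1 / 32) (h : ringSq m ≤ ε ^ 2) :
    1 + ringCoeff ε m * radius m ^ 2 ≤ (2 * (ε ^ 2) ^ (d + 2)) ^ 2 := by
  have h1 : ringSq m < 1 / 64 := by nlinarith
  have hr := radius_gt_of_ringSq_lt (h1.trans (by norm_num))
  have hr0 : 0 < radius m := by linarith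
  rw [ringCoeff, ringCutoff_of_le h1.le, circleProfile_of_le _ hε h]
  set η := (ε ^ 2) ^ (d + 2)
  have e : 1 + 1 * (η ^ 2 - radius m ^ 2) / radius m ^ 4 * radius m ^ 2 =
      η ^ 2 / radius m ^ 2 := by field_simp; ring
  rw [e, div_le_iff₀ (by positivity)]
  have h2 : 1 / 4 ≤ radius m ^ 2 := by nlinarith
  nlinarith [mul_le_mul_of_nonneg_left h2 (sq_nonneg η)]

namespace Straightening

variable (S : Straightening d)

theorem sqrt_det_gram (x : Euc d) : √((S.metric.gram x).det) =
    S.scale (S.level x) ^ (d + 2) * |(fderiv ℝ (S.ringCoords (S.level x)) x).det| *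
      √(1 + ringCoeff (tubeRad (S.level x)) (S.ringCoords (S.level x) x) *
        radius (S.ringCoords (S.level x) x) ^ 2) := by
  have hT := S.scale_pos (S.level x)
  have h := det_pullback_rank_one (S.scale (S.level x))
    (ringCoeff (tubeRad (S.level x)) (S.ringCoords (S.level x) x))
    (fderiv ℝ (S.ringCoords (S.level x)) x) (angularVec (S.ringCoords (S.level x) x))
  simp only [inner_angularVec, norm_angularVec_sq] at h
  have e : (S.metric.gram x).det = _ := h
  rw [e, Real.sqrt_mul (sq_nonneg _), Real.sqrt_sq_eq_abs, abs_mul,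
    abs_of_pos (pow_pos hT (d + 2))]

theorem injective_ringCoords (k : ℕ) : Function.Injective (S.ringCoords k) :=
  (Function.LeftInverse.injective S.left_inv).comp (S.coords_injective k)

/-- Change of variables by `ringCoords k`: the image lies in a compact set independent of the level,
and the density exceeds the Jacobian by at most Tⁿ b. -/
theorem volume_le_of_forall_level_eq {A : Set (Euc d)} (hA : MeasurableSet A) {k : ℕ}
    (hk : ∀ x ∈ A, S.level x = k) {b : ℝ} (hb : 0 ≤ b)
    (h : ∀ x ∈ A, 1 + ringCoeff (tubeRad k) (S.ringCoords k x) *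
      radius (S.ringCoords k x) ^ 2 ≤ b ^ 2) :
    S.metric.volume A ≤ ENNReal.ofReal (S.scale k ^ (d + 2) * b) *
      volume (S.toFun '' Metric.closedBall 0 4) := by
  have hT := S.scale_pos k
  have h1 := lintegral_abs_det_fderiv_eq_addHaar_image (volume : Measure (Euc d)) hA
    (fun x _ ↦ ((S.contDiff_ringCoords k).differentiable (by simp) x).hasFDerivAt.hasFDerivWithinAt)
    (S.injective_ringCoords k).injOn
  have h2 : S.ringCoords k '' A ⊆ S.toFun '' Metric.closedBall 0 4 := by
    rintro _ ⟨x, hx, rfl⟩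
    refine ⟨S.coords k x, ?_, rfl⟩
    have := S.norm_coords_level_lt x
    rw [hk x hx] at this
    simpa using this.le
  rw [SmoothMetric.volume, withDensity_apply _ hA]
  calc ∫⁻ x in A, ENNReal.ofReal √((S.metric.gram x).det)
      ≤ ∫⁻ x in A, ENNReal.ofReal (S.scale k ^ (d + 2) * b) *
          ENNReal.ofReal |(fderiv ℝ (S.ringCoords k) x).det| := by
        refine setLIntegral_mono' hA fun x hx ↦ ?_
        rw [← ENNReal.ofReal_mul (by positivity), S.sqrt_det_gram, hk x hx]
        apply ENNReal.ofReal_le_ofReal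
        have h3 := Real.sqrt_le_sqrt (h x hx)
        rw [Real.sqrt_sq hb] at h3
        rw [mul_right_comm]
        gcongr
    _ = ENNReal.ofReal (S.scale k ^ (d + 2) * b) * volume (S.ringCoords k '' A) := by
        rw [lintegral_const_mul' _ _ ENNReal.ofReal_ne_top, h1]
    _ ≤ _ := by gcongr

theorem isOpen_norm_coords_lt (k : ℕ) : IsOpen {x | ‖S.coords k x‖ < 4} :=
  isOpen_lt (S.coords k).continuous.norm continuous_const

theorem measurable_level : Measurable S.level := by
  refine measurable_of_Iic fun k ↦ ?_
  have : S.level ⁻¹' Set.Iic k = {x | ‖S.coords k x‖ < 4} := by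
    ext x
    exact ⟨fun h ↦ S.norm_coords_lt_of_le h (S.norm_coords_level_lt x), fun h ↦ S.level_le h⟩
  rw [this]
  exact (S.isOpen_norm_coords_lt k).measurableSet

theorem volume_level_eq_le (k : ℕ) : S.metric.volume {x | S.level x = k} ≤
    ENNReal.ofReal (S.scale k ^ (d + 2)) * volume (S.toFun '' Metric.closedBall 0 4) := by
  have := S.volume_le_of_forall_level_eq (S.measurable_level (measurableSet_singleton k))
    (k := k) (b := 1) (fun x hx ↦ hx) zero_le_one (fun x _ ↦ by
      have := (ringCoeff_mul_radius_sq_mem (tubeRad_pos k) (tubeRad_le k) (S.ringCoords k x)).2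
      linarith)
  rwa [mul_one] at this

/-- Since T_k = T_{k+1} · `ratio` · η and (`ratio` · η)ⁿ ≤ η / 8, everything inserted into a tube
has volume no larger than the bound for the tube itself. -/
theorem two_mul_scale_pow_le (k : ℕ) :
    2 * S.scale k ^ (d + 2) ≤ S.scale (k + 1) ^ (d + 2) * circleLen d (k + 1) := by
  have h1 := S.ratio_pos
  have h2 := S.ratio_le
  have h3 := circleLen_pos d (k + 1)
  have h4 := (circleLen_le d (k + 1)).trans (tubeRad_le (k + 1))
  have h5 := S.scale_pos (k + 1)
  rw [← S.scale_succ_mul k, mul_pow, mul_left_comm]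
  gcongr
  have h6 : (S.ratio * circleLen d (k + 1)) ^ (d + 2) ≤ S.ratio * circleLen d (k + 1) :=
    pow_le_of_le_one (by positivity) (by nlinarith) (by simp)
  nlinarith

/-- Summing over the levels below k: the volumes grow so fast that the last level dominates, up to
the factor 2. -/
theorem volume_norm_coords_lt_le (k : ℕ) : S.metric.volume {x | ‖S.coords k x‖ < 4} ≤
    ENNReal.ofReal (2 * S.scale k ^ (d + 2)) * volume (S.toFun '' Metric.closedBall 0 4) := by
  have hT := S.scale_pos
  have hsub : ∀ k x, ‖S.coords k x‖ < 4 → S.level x ≠ k → ∃ j, j + 1 = k ∧ ‖S.coords j x‖ < 4 := by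
    intro k x hx hne
    have := S.level_le hx
    exact ⟨k - 1, by omega,
      S.norm_coords_lt_of_le (show S.level x ≤ k - 1 by omega) (S.norm_coords_level_lt x)⟩
  induction k with
  | zero =>
    have h1 : {x | ‖S.coords 0 x‖ < 4} ⊆ {x | S.level x = 0} := by
      intro x hx
      by_contra hne
      obtain ⟨j, hj, -⟩ := hsub 0 x hx hne
      omega
    refine (measure_mono h1).trans ((S.volume_level_eq_le 0).trans ?_)
    gcongr
    have := hT 0
    linarith [pow_pos this (d + 2)]
  | succ k ih =>
    have h1 : {x | ‖S.coords (k + 1) x‖ < 4} ⊆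
        {x | ‖S.coords k x‖ < 4} ∪ {x | S.level x = k + 1} := by
      intro x hx
      by_cases hne : S.level x = k + 1
      · exact Or.inr hne
      · obtain ⟨j, hj, hlt⟩ := hsub (k + 1) x hx hne
        obtain rfl : j = k := by omega
        exact Or.inl hlt
    refine (measure_mono h1).trans ((measure_union_le _ _).trans
      ((add_le_add ih (S.volume_level_eq_le (k + 1))).trans ?_))
    have hk := pow_pos (hT k) (d + 2)
    have hk1 := pow_pos (hT (k + 1)) (d + 2)
    rw [← add_mul, ← ENNReal.ofReal_add (by positivity) (by positivity)]
    gcongr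
    have h2 := S.two_mul_scale_pow_le k
    have h3 := (circleLen_le d (k + 1)).trans (tubeRad_le (k + 1))
    nlinarith

/-- The volume of the tube of level `k + 1`. -/
theorem volume_tube_le (k : ℕ) :
    S.metric.volume {x | ringSq (S.ringCoords (k + 1) x) < tubeRad (k + 1) ^ 2} ≤
      ENNReal.ofReal (3 * (S.scale (k + 1) ^ (d + 2) * circleLen d (k + 1))) *
        volume (S.toFun '' Metric.closedBall 0 4) := by
  have hT := S.scale_pos (k + 1)
  have hε := tubeRad_pos (k + 1)
  have hε' := tubeRad_le (k + 1)
  have hη := circleLen_pos d (k + 1)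
  have hT' := S.scale_pos k
  let A := {x | S.level x = k + 1} ∩ {x | ringSq (S.ringCoords (k + 1) x) < tubeRad (k + 1) ^ 2}
  have hA : MeasurableSet A := (S.measurable_level (measurableSet_singleton (k + 1))).inter
    (isOpen_lt (continuous_ringSq.comp (S.contDiff_ringCoords (k + 1)).continuous)
      continuous_const).measurableSet
  have h1 : {x | ringSq (S.ringCoords (k + 1) x) < tubeRad (k + 1) ^ 2} ⊆
      {x | ‖S.coords k x‖ < 4} ∪ A := by
    intro x hx
    by_cases hne : S.level x = k + 1
    · exact Or.inr ⟨hne, hx⟩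
    · left
      have h3 : ringSq (S.ringCoords (k + 1) x) < 1 := lt_trans hx (by nlinarith)
      have := S.level_le ((S.norm_coords_lt_three h3).trans (by norm_num))
      exact S.norm_coords_lt_of_le (show S.level x ≤ k by omega) (S.norm_coords_level_lt x)
  have h2 := S.volume_le_of_forall_level_eq hA (fun x hx ↦ hx.1)
    (b := 2 * circleLen d (k + 1)) (by positivity)
    (fun x hx ↦ one_add_ringCoeff_mul_le hε hε' hx.2.le)
  refine (measure_mono h1).trans ((measure_union_le _ _).trans
    ((add_le_add (S.volume_norm_coords_lt_le k) h2).trans ?_))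
  rw [← add_mul, ← ENNReal.ofReal_add (by positivity) (by positivity)]
  gcongr
  have := S.two_mul_scale_pow_le k
  linarith

end Straightening

end Euc

end Volume

/-! ### Slow volume growth -/

section SlowVolumeGrowth

variable {d : ℕ}

theorem SmoothMetric.ball_subset_ball {E : Type*} [NormedAddCommGroup E] [NormedSpace ℝ E]
    (g : SmoothMetric E) {x y : E} {s t : ℝ} (hs : 0 ≤ s) (h : g.dist x y + s ≤ t) :
    g.ball y s ⊆ g.ball x t := by
  intro z hz
  have hd : 0 ≤ g.dist x y := ENNReal.toReal_nonneg
  calc g.edist x z ≤ g.edist x y + g.edist y z := g.edist_triangle x y z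
    _ < g.edist x y + ENNReal.ofReal s := ENNReal.add_lt_add_left (g.edist_ne_top x y) hz
    _ = ENNReal.ofReal (g.dist x y + s) := by
      rw [ENNReal.ofReal_add hd hs, SmoothMetric.dist, ENNReal.ofReal_toReal (g.edist_ne_top x y)]
    _ ≤ ENNReal.ofReal t := ENNReal.ofReal_le_ofReal h

namespace Euc

theorem tendsto_tubeRad : Tendsto tubeRad atTop (nhds 0) := by
  have h := (tendsto_one_div_add_atTop_nhds_zero_nat (𝕜 := ℝ)).const_mul (1 / 32)
  rw [mul_zero] at h
  refine h.congr fun k ↦ ?_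
  unfold tubeRad
  field_simp

namespace Straightening

variable (S : Straightening d)

theorem tendsto_scale_mul_tubeRad :
    Tendsto (fun k ↦ S.scale k * tubeRad k) atTop atTop :=
  tendsto_atTop_mono S.pow_le_scale_mul_tubeRad
    ((tendsto_pow_atTop_atTop_of_one_lt (by norm_num : (1 : ℝ) < 8)).atTop_div_const
      (by norm_num))

theorem hasSlowVolumeGrowth (m₀ : Euc d) : S.metric.HasSlowVolumeGrowth m₀ := by
  obtain ⟨c, hc, hsub⟩ := S.exists_ball_subset_tube
  set V := volume (S.toFun '' Metric.closedBall 0 4) with hV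
  have hVtop : V ≠ ⊤ :=
    ((isCompact_closedBall (0 : Euc d) 4).image S.contDiff.continuous).measure_lt_top.ne
  -- Half of the radius controlled around the origin: once r k ≥ d(0, m₀), the ball of radius r k
  -- around m₀ lies in the controlled ball.
  let r : ℕ → ℝ := fun k ↦ c * (S.scale (k + 1) * tubeRad (k + 1)) / 2
  have hr : Tendsto r atTop atTop :=
    ((S.tendsto_scale_mul_tubeRad.comp (tendsto_add_atTop_nat 1)).const_mul_atTop
      hc).atTop_div_const two_pos
  have hr0 : ∀ k, 0 < r k := fun k ↦ by
    have := S.scale_pos (k + 1)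
    have := tubeRad_pos (k + 1)
    positivity
  have hbound : ∀ᶠ k in atTop, S.metric.volume (S.metric.ball m₀ (r k)) /
      ENNReal.ofReal (r k ^ (d + 2)) ≤
        ENNReal.ofReal (3 * (2 / c) ^ (d + 2) * tubeRad (k + 1) ^ (d + 2)) * V := by
    filter_upwards [hr.eventually_ge_atTop (S.metric.dist 0 m₀)] with k hk
    have hT := S.scale_pos (k + 1)
    have hε := tubeRad_pos (k + 1)
    have h1 : S.metric.ball m₀ (r k) ⊆ S.metric.ball 0 (c * (S.scale (k + 1) * tubeRad (k + 1))) :=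
      S.metric.ball_subset_ball (hr0 k).le (by simp only [r] at hk ⊢; linarith)
    have h2 := (measure_mono (μ := S.metric.volume) (h1.trans (hsub (k + 1)))).trans
      (S.volume_tube_le k)
    have hp : 0 < r k ^ (d + 2) := pow_pos (hr0 k) _
    rw [ENNReal.div_le_iff (by simpa using hp) ENNReal.ofReal_ne_top, mul_right_comm,
      ← ENNReal.ofReal_mul (by positivity)]
    refine h2.trans (le_of_eq ?_)
    congr 2
    -- Here η / εⁿ = ε²ⁿ / εⁿ = εⁿ. The exponent in `circleLen` was chosen so that this quotient
    -- tends to 0.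
    simp only [r, circleLen, div_pow, mul_pow]
    field_simp
    ring
  have hlim : Tendsto (fun k ↦ ENNReal.ofReal
      (3 * (2 / c) ^ (d + 2) * tubeRad (k + 1) ^ (d + 2)) * V) atTop (nhds 0) := by
    have h1 : Tendsto (fun k ↦ 3 * (2 / c) ^ (d + 2) * tubeRad (k + 1) ^ (d + 2)) atTop
        (nhds (3 * (2 / c) ^ (d + 2) * 0 ^ (d + 2))) :=
      ((tendsto_tubeRad.comp (tendsto_add_atTop_nat 1)).pow (d + 2)).const_mul _
    have h2 := ENNReal.Tendsto.mul_const (b := V) (ENNReal.tendsto_ofReal h1) (Or.inr hVtop)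
    simpa using h2
  refine le_antisymm (ENNReal.le_of_forall_pos_le_add fun δ hδ _ ↦ ?_) bot_le
  rw [zero_add]
  -- For the lower limit it is enough to have the bound along the sequence of radii r k, which tends
  -- to infinity.
  refine liminf_le_of_frequently_le' (hr.frequently (Eventually.frequently ?_))
  filter_upwards [hbound, hlim.eventually (gt_mem_nhds (ENNReal.coe_pos.2 hδ))] with k h1 h2
  exact h1.trans h2.le

end Straightening

end Euc

end SlowVolumeGrowth

end

theorem proposition4 (n : ℕ) (hn : 1 < n) :
    ∃ g : SmoothMetric (EuclideanSpace ℝ (Fin n)), g.IsComplete ∧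
      ∀ m₀ : EuclideanSpace ℝ (Fin n),
        g.HasQuadraticCurvatureDecay m₀ ∧ g.HasSlowVolumeGrowth m₀ := by
  obtain ⟨d, rfl⟩ : ∃ d, n = d + 2 := ⟨n - 2, by omega⟩
  obtain ⟨S⟩ := Euc.nonempty_straightening d
  exact ⟨S.metric, S.metric_isComplete, fun m₀ ↦
    ⟨S.hasQuadraticCurvatureDecay m₀, S.hasSlowVolumeGrowth m₀⟩⟩
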